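/- Let $\mathbb T=\mathbb R/2\pi\mathbb Z$, $\lambda\in\mathbb Z$, $f\in L^2(\mathbb T^2;\mathbb R)$ and $g\in C^\infty(\mathbb T;\mathbb R)$, and put $$u_{\rm in}(x)=\big(f(\lambda x_1+x_2,x_3),\,-\lambda f(\lambda x_1+x_2,x_3)-g(x_3),\,0\big),\qquad x\in\mathbb T^3 .$$ For $\nu>0$ let $e^{\nu t\partial^2}g$ denote the solution at time $t$ of the heat equation on $\mathbb T$ with viscosity $\nu$ and initial value $g$, and let $F_\nu\in C([0,\infty);L^2(\mathbb T^2))\cap L^2_{\rm loc}([0,\infty);H^1(\mathbb T^2))$ be the (unique) solution, in the sense of distributions, of $$\partial_tF_\nu-(e^{\nu t\partial_2^2}g)(y_2)\,\partial_1F_\nu=\nu\big((\lambda^2+1)\partial_1^2+\partial_2^2\big)F_\nu\ \text{ in }(0,\infty)\times\mathbb T^2,\qquad F_\nu(0,\cdot)=f .$$ Consider the Navier--Stokes shear flow with viscosity $\nu$ $$u^\nu(t,x)=\big(F_\nu(t,\lambda x_1+x_2,x_3),\,-\lambda F_\nu(t,\lambda x_1+x_2,x_3)-(e^{\nu t\partial_3^2}g)(x_3),\,0\big)$$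 and the Euler shear flow $$u^E(t,x)=\big(f(\lambda x_1+x_2+tg(x_3),x_3),\,-\lambda f(\lambda x_1+x_2+tg(x_3),x_3)-g(x_3),\,0\big),$$ both with initial velocity $u_{\rm in}$. Then: 1. for every $T>0$, $u^\nu\to u^E$ in $L^2((0,T)\times\mathbb T^3)$ as $\nu\to0^+$; 2. for every $t\ge0$, $u^\nu(t,\cdot)\to u^E(t,\cdot)$ in $L^2(\mathbb T^3)$ as $\nu\to0^+$; 3. there is no anomalous dissipation: $u^\nu\in L^2(0,T;H^1(\mathbb T^3))$ for all $\nu,T>0$, and for every $t\ge0$ $$\lim_{\nu\to0^+}\nu\int_0^t\int_{\mathbb T^3}|\nabla u^\nu(s,x)|^2\,dx\,ds=0;$$ 4. if moreover $f\in L^3(\mathbb T^2;\mathbb R)$, then $u^E$ satisfies the local energy balance: for every nonnegative $\varphi\in C^\infty([0,\infty)\times\mathbb T^3;\mathbb R)$ and every $t\ge0$, $$\int_{\mathbb T^3}|u^E(t,x)|^2\varphi(t,x)\,dx-\int_{\mathbb T^3}|u_{\rm in}(x)|^2\varphi(0,x)\,dx=\int_0^t\int_{\mathbb T^3}\big(\partial_t\varphi\,|u^E|^2+|u^E|^2\,u^E\cdot\nabla\varphi\big)\,dx\,ds,$$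 all the integrals being absolutely convergent. -/

import Mathlib

open MeasureTheory Filter Topology

namespace ShearFlow

open scoped ContDiff

noncomputable section

instance fact_two_pi_pos : Fact (0 < 2 * Real.pi) := ⟨Real.two_pi_pos⟩

/-- The circle `ℝ / 2πℤ`, with Haar measure of total mass `2π`. -/
abbrev Circ : Type := AddCircle (2 * Real.pi)

/-- The torus `(ℝ / 2πℤ)^d`, with the product measure. -/
abbrev Torus (d : ℕ) : Type := Fin d → Circ

/-- The projection `ℝ^d → (ℝ / 2πℤ)^d`. -/
def proj {d : ℕ} (z : Fin d → ℝ) : Torus d := fun i => (z i : Circ)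

/-- `g ∈ C^∞(𝕋)`: the `2π`-periodic lift of `g` to `ℝ` is smooth. -/
def SmoothCirc (g : Circ → ℝ) : Prop := ContDiff ℝ ∞ (fun z : ℝ => g (z : Circ))

/-- `φ ∈ C^∞(𝕋^d)`: the periodic lift of `φ` to `ℝ^d` is smooth. -/
def SmoothTorus {d : ℕ} (φ : Torus d → ℝ) : Prop :=
  ContDiff ℝ ∞ (fun z : Fin d → ℝ => φ (proj z))

/-- `φ ∈ C^∞([0,∞) × 𝕋^d)`, smoothness being up to the boundary `t = 0`. -/
def SmoothHalfCylinder {d : ℕ} (φ : ℝ → Torus d → ℝ) : Prop :=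
  ContDiffOn ℝ ∞ (fun p : ℝ × (Fin d → ℝ) => φ p.1 (proj p.2)) (Set.Ici 0 ×ˢ Set.univ)

/-- `φ ∈ C_c^∞((0,∞) × 𝕋^d)`, extended by zero to all times. -/
def IsTestFunction {d : ℕ} (φ : ℝ → Torus d → ℝ) : Prop :=
  ContDiff ℝ ∞ (fun p : ℝ × (Fin d → ℝ) => φ p.1 (proj p.2)) ∧
    ∃ a b : ℝ, 0 < a ∧ ∀ t, t ∉ Set.Icc a b → ∀ x, φ t x = 0

/-- The classical partial derivative `∂_i φ` of a function on the torus. -/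
def pd {d : ℕ} (i : Fin d) (φ : Torus d → ℝ) (x : Torus d) : ℝ :=
  deriv (fun h : ℝ => φ (x + Pi.single i (h : Circ))) 0

/-- The measure `dt dx` on `(0,T) × 𝕋^d`. -/
def spacetime (d : ℕ) (T : ℝ) : Measure (ℝ × Torus d) :=
  (volume.restrict (Set.Ioo 0 T)).prod volume

/-- `w = ∇v` weakly on `𝕋^d`, with `v, w ∈ L²(𝕋^d)`, i.e. `v ∈ H¹(𝕋^d)` with gradient `w`. -/
def IsWeakGradient {d : ℕ} (v : Torus d → ℝ) (w : Fin d → Torus d → ℝ) : Prop :=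
  MemLp v 2 volume ∧ (∀ i, MemLp (w i) 2 volume) ∧
    ∀ φ : Torus d → ℝ, SmoothTorus φ → ∀ i, ∫ x, v x * pd i φ x = -∫ x, w i x * φ x

/-- `v ∈ L²(0,T; H¹(𝕋^d))` for every `T > 0`, and `D` is its spatial weak gradient
(which is determined by `v` up to a null set of `(0,∞) × 𝕋^d`). -/
def IsSpatialGradient {d : ℕ} (v : ℝ → Torus d → ℝ) (D : Fin d → ℝ → Torus d → ℝ) : Prop :=
  (∀ T : ℝ, 0 < T →
    MemLp (Function.uncurry v) 2 (spacetime d T) ∧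
      ∀ i, MemLp (Function.uncurry (D i)) 2 (spacetime d T)) ∧
    ∀ᵐ t ∂(volume.restrict (Set.Ioi (0 : ℝ))), IsWeakGradient (v t) (fun i => D i t)

/-- The heat semigroup `e^{τ ∂²} g` on the circle, `τ ≥ 0`: convolution of the periodic function
`g` with the heat kernel `(4πτ)^{-1/2} exp(-z²/(4τ))` of the line, i.e. with the centred Gaussian
law of variance `2τ` (the Dirac mass at `0` when `τ = 0`, so that `e^{0 ∂²} g = g`). -/
def heat (τ : ℝ) (g : Circ → ℝ) (x : Circ) : ℝ :=
  ∫ z : ℝ, g (x - (z : Circ)) ∂(ProbabilityTheory.gaussianReal 0 (2 * τ).toNNReal)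

/-- `F ∈ C([0,∞); L²(𝕋²)) ∩ L²_loc([0,∞); H¹(𝕋²))` solves, in the sense of distributions,
`∂_t F - (e^{νt∂_2²} g)(y_2) ∂_1 F = ν ((λ² + 1) ∂_1² + ∂_2²) F` in `(0,∞) × 𝕋²`, `F(0) = f`. -/
structure IsDriftHeatSolution (ν : ℝ) (lam : ℤ) (f : Torus 2 → ℝ) (g : Circ → ℝ)
    (F : ℝ → Torus 2 → ℝ) : Prop where
  memLp : ∀ t, 0 ≤ t → MemLp (F t) 2 volume
  continuous : ∀ t, 0 ≤ t →
    Tendsto (fun s => eLpNorm (fun y => F s y - F t y) 2 volume) (𝓝[Set.Ici 0] t) (𝓝 0)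
  gradient : ∃ D, IsSpatialGradient F D
  initial : F 0 =ᵐ[volume] f
  equation : ∀ φ : ℝ → Torus 2 → ℝ, IsTestFunction φ →
    ∫ t in Set.Ioi (0 : ℝ), ∫ y, F t y *
      (deriv (fun s => φ s y) t - heat (ν * t) g (y 1) * pd 0 (φ t) y
        + ν * (((lam : ℝ) ^ 2 + 1) * pd 0 (pd 0 (φ t)) y + pd 1 (pd 1 (φ t)) y)) = 0

/-- The initial velocity `(f(λx₁+x₂,x₃), -λ f(λx₁+x₂,x₃) - g(x₃), 0)`. -/
def uIn (lam : ℤ) (f : Torus 2 → ℝ) (g : Circ → ℝ) (x : Torus 3) : EuclideanSpace ℝ (Fin 3) :=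
  !₂[f ![lam • x 0 + x 1, x 2], -(lam : ℝ) * f ![lam • x 0 + x 1, x 2] - g (x 2), 0]

/-- The Navier–Stokes shear flow
`(F(t,λx₁+x₂,x₃), -λ F(t,λx₁+x₂,x₃) - (e^{νt∂_3²} g)(x₃), 0)`. -/
def uNS (ν : ℝ) (lam : ℤ) (g : Circ → ℝ) (F : ℝ → Torus 2 → ℝ) (t : ℝ) (x : Torus 3) :
    EuclideanSpace ℝ (Fin 3) :=
  !₂[F t ![lam • x 0 + x 1, x 2],
    -(lam : ℝ) * F t ![lam • x 0 + x 1, x 2] - heat (ν * t) g (x 2), 0]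

/-- The Euler shear flow
`(f(λx₁+x₂+t g(x₃),x₃), -λ f(λx₁+x₂+t g(x₃),x₃) - g(x₃), 0)`. -/
def uEuler (lam : ℤ) (f : Torus 2 → ℝ) (g : Circ → ℝ) (t : ℝ) (x : Torus 3) :
    EuclideanSpace ℝ (Fin 3) :=
  !₂[f ![lam • x 0 + x 1 + ((t * g (x 2) : ℝ) : Circ), x 2],
    -(lam : ℝ) * f ![lam • x 0 + x 1 + ((t * g (x 2) : ℝ) : Circ), x 2] - g (x 2), 0]

end

end ShearFlow

open ShearFlow

namespace ShearFlow

open scoped ContDiff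

/-! Everything reduces to the profile. In the coordinates (x_1, λx_1 + x_2, x_3) the profile does
not depend on x_1, and the inviscid profile f_t(y) = f(y_1 + t g(y_2), y_2) is a measure-preserving
rearrangement of f, so that ‖f_t‖ = ‖f‖ in L².

The inviscid limit is weak convergence combined with an energy inequality. The energy equality
`IsDriftHeatSolution.energy_eq` gives ‖F_ν(t)‖ ≤ ‖f‖. For smooth φ the transported function φ_t
solves the inviscid equation, so the adjoint drift-heat operator sends it to O(√ν + ν), the √ν being
the size of e^{νt∂²}g - g. Hence ⟨F_ν(t), φ_t⟩ → ⟨f, φ⟩, and density of smooth functions gives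
⟨F_ν(t), f_t⟩ → ‖f‖² (`tendsto_integral_mul_transport`). Expanding the square, ‖F_ν(t) - f_t‖² ≤
2‖f‖² - 2⟨F_ν(t), f_t⟩ → 0. In particular ‖F_ν(t)‖ → ‖f‖, and through the energy equality this says
that the dissipation vanishes. Convergence in space-time follows by dominated convergence in time.

The energy equality cannot be read off by testing with F itself, which is not smooth. Instead, a du
Bois-Reymond argument makes every Fourier coefficient of F differentiable for t > 0, and Parseval's
identity sums the resulting equations; the H¹ bound supplies the majorant. The transport term drops
out because its coefficient does not depend on y_1.

The local energy balance is Lagrangian. Along the Euler flow x_3 is fixed and the phase λx_1 + x_2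
moves with velocity -g(x_3), so each particle keeps its velocity and moves on a straight line, and
the flow map preserves volume. The balance is then the fundamental theorem of calculus for φ along
each line, integrated over the particles. Fubini's theorem needs |u|³ integrable, which is where f ∈
L³ enters. -/

/-! ### Smooth functions on the torus and their partial derivatives. -/

theorem isOpenQuotientMap_proj {d : ℕ} : IsOpenQuotientMap (proj : (Fin d → ℝ) → Torus d) :=
  IsOpenQuotientMap.piMap fun _ => QuotientAddGroup.isOpenQuotientMap_mk

theorem proj_surjective {d : ℕ} : Function.Surjective (proj : (Fin d → ℝ) → Torus d) :=
  isOpenQuotientMap_proj.surjective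

theorem continuous_proj {d : ℕ} : Continuous (proj : (Fin d → ℝ) → Torus d) :=
  isOpenQuotientMap_proj.continuous

theorem continuous_of_lift {d : ℕ} {X : Type*} [TopologicalSpace X] {φ : Torus d → X}
    (h : Continuous fun z : Fin d → ℝ => φ (proj z)) : Continuous φ :=
  isOpenQuotientMap_proj.isQuotientMap.continuous_iff.2 h

theorem continuous_of_lift_time {d : ℕ} {X : Type*} [TopologicalSpace X] {φ : ℝ → Torus d → X}
    (h : Continuous fun p : ℝ × (Fin d → ℝ) => φ p.1 (proj p.2)) :
    Continuous (Function.uncurry φ) :=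
  (IsOpenQuotientMap.id.prodMap isOpenQuotientMap_proj).isQuotientMap.continuous_iff.2 h

@[simp]
theorem proj_apply {d : ℕ} (z : Fin d → ℝ) (i : Fin d) : proj z i = (z i : Circ) := rfl

theorem proj_add {d : ℕ} (z w : Fin d → ℝ) : proj (z + w) = proj z + proj w := by
  ext i; simp [proj]

theorem proj_zero {d : ℕ} : proj (0 : Fin d → ℝ) = 0 := by
  ext i; simp [proj]

theorem proj_single {d : ℕ} (i : Fin d) (h : ℝ) :
    proj (Pi.single i h : Fin d → ℝ) = Pi.single i (h : Circ) := by
  ext j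
  by_cases hj : j = i
  · subst hj; simp [proj]
  · simp [proj, hj]

theorem exists_bound_of_continuous {X : Type*} [TopologicalSpace X] [CompactSpace X] {φ : X → ℝ}
    (hφ : Continuous φ) : ∃ C, 0 ≤ C ∧ ∀ x, |φ x| ≤ C := by
  obtain ⟨C, hC⟩ := isCompact_univ.exists_bound_of_continuousOn hφ.continuousOn
  exact ⟨max C 0, le_max_right _ _, fun x => (hC x trivial).trans (le_max_left _ _)⟩

theorem SmoothTorus.continuous {d : ℕ} {φ : Torus d → ℝ} (h : SmoothTorus φ) : Continuous φ :=
  continuous_of_lift (ContDiff.continuous h)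

theorem pd_proj {d : ℕ} (i : Fin d) (φ : Torus d → ℝ) (z : Fin d → ℝ) :
    pd i φ (proj z) = deriv (fun h : ℝ => φ (proj (z + h • Pi.single i (1 : ℝ)))) 0 := by
  unfold pd
  congr 1
  ext h
  rw [proj_add, ← proj_single, ← Pi.single_smul, smul_eq_mul, mul_one]

theorem SmoothTorus.pd_proj {d : ℕ} {φ : Torus d → ℝ} (hφ : SmoothTorus φ) (i : Fin d)
    (z : Fin d → ℝ) :
    pd i φ (proj z) = fderiv ℝ (fun z => φ (proj z)) z (Pi.single i 1) := by
  rw [ShearFlow.pd_proj]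
  have h1 : DifferentiableAt ℝ (fun z => φ (proj z)) z :=
    (ContDiff.differentiable hφ (by simp)).differentiableAt
  have := h1.lineDeriv_eq_fderiv (v := Pi.single i (1 : ℝ))
  rw [← this]
  rfl

theorem SmoothTorus.pd {d : ℕ} {φ : Torus d → ℝ} (hφ : SmoothTorus φ) (i : Fin d) :
    SmoothTorus (pd i φ) := by
  unfold SmoothTorus
  simp_rw [hφ.pd_proj i]
  exact (ContDiff.fderiv_right hφ (m := ∞) (by simp)).clm_apply contDiff_const

/-- The derivative of a smooth function on the torus along a straight line. -/
theorem SmoothTorus.hasDerivAt_line {d : ℕ} {φ : Torus d → ℝ} (hφ : SmoothTorus φ)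
    (x : Torus d) (v : Fin d → ℝ) (h : ℝ) :
    HasDerivAt (fun h : ℝ => φ (x + proj (h • v)))
      (∑ i, v i * ShearFlow.pd i φ (x + proj (h • v))) h := by
  obtain ⟨z, rfl⟩ := proj_surjective x
  simp_rw [← proj_add, hφ.pd_proj]
  have h1 : HasFDerivAt (fun z => φ (proj z)) (fderiv ℝ (fun z => φ (proj z)) (z + h • v))
      (z + h • v) :=
    ((ContDiff.differentiable hφ (by simp)).differentiableAt).hasFDerivAt
  have h2 : HasDerivAt (fun h : ℝ => z + h • v) v h := by
    simpa using ((hasDerivAt_id h).smul_const v).const_add z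
  have h3 := h1.comp_hasDerivAt h h2
  have e : v = ∑ i, v i • (Pi.single i 1 : Fin d → ℝ) := by
    ext j
    simp [Finset.sum_apply, Pi.single_apply]
  have h4 : fderiv ℝ (fun z => φ (proj z)) (z + h • v) v
      = ∑ i, v i * fderiv ℝ (fun z => φ (proj z)) (z + h • v) (Pi.single i 1) := by
    conv_lhs => rw [e, map_sum]
    simp only [map_smul, smul_eq_mul, ← e]
  rw [← h4]
  exact h3

theorem SmoothTorus.hasDerivAt_pd {d : ℕ} {φ : Torus d → ℝ} (hφ : SmoothTorus φ)
    (x : Torus d) (i : Fin d) :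
    HasDerivAt (fun h : ℝ => φ (x + Pi.single i (h : Circ))) (ShearFlow.pd i φ x) 0 := by
  have := hφ.hasDerivAt_line x (Pi.single i 1) 0
  have e : ∀ h : ℝ, proj (h • Pi.single i (1 : ℝ) : Fin d → ℝ) = Pi.single i (h : Circ) := by
    intro h
    rw [← proj_single, ← Pi.single_smul, smul_eq_mul, mul_one]
  simp_rw [e] at this
  simpa [Pi.single_apply] using this

theorem SmoothTorus.const {d : ℕ} (c : ℝ) : SmoothTorus (fun _ : Torus d => c) := contDiff_const

theorem SmoothTorus.mul {d : ℕ} {φ ψ : Torus d → ℝ} (hφ : SmoothTorus φ) (hψ : SmoothTorus ψ) :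
    SmoothTorus (fun x => φ x * ψ x) := ContDiff.mul hφ hψ

theorem SmoothTorus.add {d : ℕ} {φ ψ : Torus d → ℝ} (hφ : SmoothTorus φ) (hψ : SmoothTorus ψ) :
    SmoothTorus (fun x => φ x + ψ x) := ContDiff.add hφ hψ

theorem SmoothTorus.pd_mul {d : ℕ} {φ ψ : Torus d → ℝ} (hφ : SmoothTorus φ) (hψ : SmoothTorus ψ)
    (i : Fin d) (x : Torus d) :
    ShearFlow.pd i (fun x => φ x * ψ x) x
      = ShearFlow.pd i φ x * ψ x + φ x * ShearFlow.pd i ψ x := by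
  have := ((hφ.hasDerivAt_pd x i).fun_mul (hψ.hasDerivAt_pd x i)).deriv
  simpa [ShearFlow.pd] using this

theorem integrable_mul_of_continuous {X : Type*} [TopologicalSpace X] [CompactSpace X]
    [MeasurableSpace X] [OpensMeasurableSpace X] {μ : Measure X} {w ψ : X → ℝ}
    (hw : Integrable w μ) (hψ : Continuous ψ) : Integrable (fun x => w x * ψ x) μ := by
  obtain ⟨C, -, hC⟩ := exists_bound_of_continuous hψ
  have h1 : AEStronglyMeasurable ψ μ :=
    hψ.measurable.aestronglyMeasurable
  exact hw.mul_bdd h1 (ae_of_all _ hC)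

/-- The translation falls on the smooth factor, so integrability of w is enough to differentiate
under the integral. -/
theorem SmoothTorus.hasDerivAt_integral_line {d : ℕ} {φ : Torus d → ℝ} (hφ : SmoothTorus φ)
    {w : Torus d → ℝ} (hw : Integrable w volume) (v : Fin d → ℝ) :
    HasDerivAt (fun h : ℝ => ∫ x, w x * φ (x + proj (h • v)))
      (∫ x, w x * ∑ i, v i * ShearFlow.pd i φ x) 0 := by
  have hc : Continuous (fun x => ∑ i, v i * ShearFlow.pd i φ x) :=
    continuous_finsetSum _ fun i _ => continuous_const.mul (hφ.pd i).continuous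
  obtain ⟨C, -, hC⟩ := exists_bound_of_continuous hc
  have key := hasDerivAt_integral_of_dominated_loc_of_deriv_le (μ := (volume : Measure (Torus d)))
    (F := fun (h : ℝ) x => w x * φ (x + proj (h • v)))
    (F' := fun (h : ℝ) x => w x * ∑ i, v i * ShearFlow.pd i φ (x + proj (h • v)))
    (x₀ := (0 : ℝ)) (s := Set.univ) (bound := fun x => |w x| * C) univ_mem
    (Eventually.of_forall fun h => (integrable_mul_of_continuous hw
      (hφ.continuous.comp (continuous_add_const _))).aestronglyMeasurable)
    (integrable_mul_of_continuous hw (hφ.continuous.comp (continuous_add_const _)))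
    (integrable_mul_of_continuous hw (hc.comp (continuous_add_const _))).aestronglyMeasurable
    (ae_of_all _ fun x h _ => ?_) (hw.abs.mul_const C)
    (ae_of_all _ fun x h _ => (hφ.hasDerivAt_line x v h).const_mul (w x))
  · simpa [proj_zero] using key.2
  · rw [norm_mul]
    exact mul_le_mul_of_nonneg_left (hC _) (abs_nonneg _)

/-- A function invariant under the translations along `v` has vanishing weak derivative along
`v`. -/
theorem SmoothTorus.integral_mul_line_eq_zero {d : ℕ} {φ : Torus d → ℝ} (hφ : SmoothTorus φ)
    {w : Torus d → ℝ} (hw : Integrable w volume) (v : Fin d → ℝ)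
    (hinv : ∀ (h : ℝ) x, w (x + proj (h • v)) = w x) :
    ∫ x, w x * ∑ i, v i * ShearFlow.pd i φ x = 0 := by
  have h1 := hφ.hasDerivAt_integral_line hw v
  -- Changing variables by the translation and using the invariance of w, the integral does not
  -- depend on h.
  have h2 : (fun h : ℝ => ∫ x, w x * φ (x + proj (h • v))) = fun _ => ∫ x, w x * φ x := by
    ext h
    rw [← integral_add_right_eq_self (fun x => w x * φ x) (proj (h • v))]
    simp_rw [hinv]
  rw [h2] at h1
  exact h1.unique (hasDerivAt_const _ _)

theorem SmoothTorus.integral_pd_eq_zero {d : ℕ} {φ : Torus d → ℝ} (hφ : SmoothTorus φ)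
    (i : Fin d) : ∫ x, ShearFlow.pd i φ x = 0 := by
  have := hφ.integral_mul_line_eq_zero (w := fun _ => 1) (integrable_const _) (Pi.single i 1)
    (fun _ _ => rfl)
  simpa [Pi.single_apply] using this

theorem SmoothTorus.integral_mul_pd {d : ℕ} {φ ψ : Torus d → ℝ} (hφ : SmoothTorus φ)
    (hψ : SmoothTorus ψ) (i : Fin d) :
    ∫ x, φ x * ShearFlow.pd i ψ x = -∫ x, ShearFlow.pd i φ x * ψ x := by
  have h := (hφ.mul hψ).integral_pd_eq_zero i
  simp_rw [hφ.pd_mul hψ] at h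
  have hi : ∀ {a b : Torus d → ℝ}, SmoothTorus a → SmoothTorus b →
      Integrable (fun x => a x * b x) volume := fun {a b} ha hb =>
    (ha.mul hb).continuous.integrable_of_hasCompactSupport
      (HasCompactSupport.of_compactSpace _)
  rw [integral_add (hi (hφ.pd i) hψ) (hi hφ (hψ.pd i))] at h
  linarith

/-! ### Smooth functions on the circle and the heat semigroup. -/

/-- The derivative of a function on the circle. -/
noncomputable def circDeriv (g : Circ → ℝ) (x : Circ) : ℝ :=
  deriv (fun h : ℝ => g (x + (h : Circ))) 0

theorem circ_coe_surjective : Function.Surjective (fun z : ℝ => (z : Circ)) :=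
  QuotientAddGroup.mk_surjective

theorem SmoothCirc.continuous {g : Circ → ℝ} (hg : SmoothCirc g) : Continuous g :=
  (QuotientAddGroup.isOpenQuotientMap_mk.isQuotientMap.continuous_iff).2 (ContDiff.continuous hg)

theorem circDeriv_coe (g : Circ → ℝ) (z : ℝ) :
    circDeriv g (z : Circ) = deriv (fun z : ℝ => g (z : Circ)) z := by
  unfold circDeriv
  simp_rw [← AddCircle.coe_add]
  rw [deriv_comp_const_add (f := fun z : ℝ => g (z : Circ)), add_zero]

theorem SmoothCirc.circDeriv {g : Circ → ℝ} (hg : SmoothCirc g) :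
    SmoothCirc (circDeriv g) := by
  unfold SmoothCirc
  simp_rw [circDeriv_coe]
  exact (contDiff_infty_iff_deriv.1 hg).2

theorem SmoothCirc.hasDerivAt {g : Circ → ℝ} (hg : SmoothCirc g) (x : Circ) (h : ℝ) :
    HasDerivAt (fun h : ℝ => g (x + (h : Circ))) (ShearFlow.circDeriv g (x + (h : Circ))) h := by
  obtain ⟨z, rfl⟩ := circ_coe_surjective x
  simp only [← AddCircle.coe_add]
  rw [circDeriv_coe]
  have h1 : HasDerivAt (fun z : ℝ => g (z : Circ)) (deriv (fun z : ℝ => g (z : Circ)) (z + h))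
      (z + h) := ((ContDiff.differentiable hg (by simp)).differentiableAt).hasDerivAt
  exact h1.comp_const_add z h

theorem SmoothCirc.exists_lipschitz {g : Circ → ℝ} (hg : SmoothCirc g) :
    ∃ L, 0 ≤ L ∧ ∀ (x : Circ) (h : ℝ), |g (x + (h : Circ)) - g x| ≤ L * |h| := by
  obtain ⟨L, hL, hb⟩ := exists_bound_of_continuous hg.circDeriv.continuous
  refine ⟨L, hL, fun x h => ?_⟩
  have := Convex.norm_image_sub_le_of_norm_hasDerivWithin_le (s := Set.univ) (x := 0) (y := h)
    (f := fun h : ℝ => g (x + (h : Circ)))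
    (fun y _ => (hg.hasDerivAt x y).hasDerivWithinAt) (fun y _ => hb _) convex_univ trivial trivial
  simpa using this

/-- Rescaling to the standard Gaussian moves τ from the measure into the integrand, where continuity
in τ and the rate √τ can be seen. -/
theorem heat_eq_integral {g : Circ → ℝ} (hg : Continuous g) (τ : ℝ) (x : Circ) :
    heat τ g x = ∫ z : ℝ, g (x - ((Real.sqrt (2 * τ) * z : ℝ) : Circ))
      ∂(ProbabilityTheory.gaussianReal 0 1) := by
  have h1 : ProbabilityTheory.gaussianReal 0 (2 * τ).toNNReal
      = (ProbabilityTheory.gaussianReal 0 1).map (Real.sqrt (2 * τ) * ·) := by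
    rw [ProbabilityTheory.gaussianReal_map_const_mul]
    congr 1
    · simp
    · ext
      rw [mul_one]
      -- For negative τ both `toNNReal` and `Real.sqrt` return zero, and both laws are the Dirac
      -- mass at 0.
      rcases le_total 0 (2 * τ) with h | h
      · rw [Real.coe_toNNReal _ h]
        exact (Real.sq_sqrt h).symm
      · simp [Real.sqrt_eq_zero_of_nonpos h, h]
  have hc : Continuous fun z : ℝ => g (x - (z : Circ)) :=
    hg.comp (continuous_const.sub (AddCircle.continuous_mk' _))
  unfold heat
  rw [h1, integral_map (by fun_prop) hc.aestronglyMeasurable]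

theorem continuous_heat_uncurry {g : Circ → ℝ} (hg : Continuous g) :
    Continuous fun p : ℝ × Circ => heat p.1 g p.2 := by
  simp_rw [heat_eq_integral hg]
  obtain ⟨C, -, hC⟩ := exists_bound_of_continuous hg
  have hc : Continuous fun q : (ℝ × Circ) × ℝ =>
      g (q.1.2 - ((Real.sqrt (2 * q.1.1) * q.2 : ℝ) : Circ)) :=
    hg.comp (by
      refine (continuous_snd.comp continuous_fst).sub ((AddCircle.continuous_mk' _).comp ?_)
      fun_prop)
  refine continuous_of_dominated (bound := fun _ => C)
    (fun p => (hc.comp (by fun_prop : Continuous fun z : ℝ => (p, z))).aestronglyMeasurable)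
    (fun p => ae_of_all _ fun z => hC _) (integrable_const _) (ae_of_all _ fun z => ?_)
  exact hc.comp (by fun_prop : Continuous fun p : ℝ × Circ => (p, z))

theorem continuous_heat {g : Circ → ℝ} (hg : Continuous g) (τ : ℝ) : Continuous (heat τ g) :=
  (continuous_heat_uncurry hg).comp (by fun_prop : Continuous fun x : Circ => (τ, x))

theorem abs_heat_le {g : Circ → ℝ} {C : ℝ} (hC : ∀ x, |g x| ≤ C) (τ : ℝ) (x : Circ) :
    |heat τ g x| ≤ C := by
  have h := norm_integral_le_of_norm_le_const
    (μ := ProbabilityTheory.gaussianReal 0 (2 * τ).toNNReal)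
    (f := fun z : ℝ => g (x - (z : Circ))) (C := C) (ae_of_all _ fun z => hC _)
  simpa [heat] using h

theorem SmoothCirc.hasDerivAt_heat {g : Circ → ℝ} (hg : SmoothCirc g) (τ : ℝ) (x : Circ) (h : ℝ) :
    HasDerivAt (fun h : ℝ => heat τ g (x + (h : Circ)))
      (heat τ (ShearFlow.circDeriv g) (x + (h : Circ))) h := by
  obtain ⟨C, -, hC⟩ := exists_bound_of_continuous hg.circDeriv.continuous
  have hm : ∀ {k : Circ → ℝ}, Continuous k → ∀ h : ℝ, AEStronglyMeasurable
      (fun z : ℝ => k (x + (h : Circ) - (z : Circ)))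
      (ProbabilityTheory.gaussianReal 0 (2 * τ).toNNReal) := fun {k} hk h =>
    (hk.comp (continuous_const.sub (AddCircle.continuous_mk' _))).aestronglyMeasurable
  obtain ⟨C', -, hC'⟩ := exists_bound_of_continuous hg.continuous
  exact (hasDerivAt_integral_of_dominated_loc_of_deriv_le
    (μ := ProbabilityTheory.gaussianReal 0 (2 * τ).toNNReal)
    (F := fun (h : ℝ) (z : ℝ) => g (x + (h : Circ) - (z : Circ)))
    (F' := fun (h : ℝ) (z : ℝ) => ShearFlow.circDeriv g (x + (h : Circ) - (z : Circ)))
    (x₀ := h) (s := Set.univ) (bound := fun _ => C) univ_mem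
    (Eventually.of_forall fun h => hm hg.continuous h)
    (Integrable.of_bound (hm hg.continuous h) C' (ae_of_all _ fun z => hC' _))
    (hm hg.circDeriv.continuous h)
    (ae_of_all _ fun z h _ => hC _) (integrable_const _)
    (ae_of_all _ fun z h _ => by
      simp_rw [add_sub_right_comm]
      exact hg.hasDerivAt _ h)).2

theorem SmoothCirc.circDeriv_heat {g : Circ → ℝ} (hg : SmoothCirc g) (τ : ℝ) :
    ShearFlow.circDeriv (heat τ g) = heat τ (ShearFlow.circDeriv g) := by
  ext x
  have := (hg.hasDerivAt_heat τ x 0).deriv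
  simpa [ShearFlow.circDeriv] using this

theorem SmoothCirc.heat {g : Circ → ℝ} (hg : SmoothCirc g) (τ : ℝ) :
    SmoothCirc (heat τ g) := by
  have hd : ∀ {g : Circ → ℝ}, SmoothCirc g → ∀ z : ℝ,
      HasDerivAt (fun z : ℝ => ShearFlow.heat τ g (z : Circ))
        (ShearFlow.heat τ (ShearFlow.circDeriv g) (z : Circ)) z := by
    intro g hg z
    simpa using hg.hasDerivAt_heat τ 0 z
  -- Differentiation commutes with the semigroup, so the order of smoothness is raised by induction,
  -- for all smooth g at once.
  have key : ∀ (n : ℕ) (g : Circ → ℝ), SmoothCirc g →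
      ContDiff ℝ n (fun z : ℝ => ShearFlow.heat τ g (z : Circ)) := by
    intro n
    induction n with
    | zero =>
      intro g hg
      exact contDiff_zero.2 ((continuous_heat hg.continuous τ).comp (AddCircle.continuous_mk' _))
    | succ n ih =>
      intro g hg
      have e : ((n + 1 : ℕ) : WithTop ℕ∞) = (n : WithTop ℕ∞) + 1 := by norm_cast
      rw [e, contDiff_succ_iff_deriv]
      refine ⟨fun z => (hd hg z).differentiableAt, by simp, ?_⟩
      rw [show deriv (fun z : ℝ => ShearFlow.heat τ g (z : Circ)) =
        fun z : ℝ => ShearFlow.heat τ (ShearFlow.circDeriv g) (z : Circ) from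
        funext fun z => (hd hg z).deriv]
      exact ih _ hg.circDeriv
  exact contDiff_infty.2 fun n => key n g hg

/-- The constant is the Lipschitz constant of g times the first absolute moment of the Gaussian.
This is the origin of the rate √ν in the inviscid limit. -/
theorem SmoothCirc.exists_heat_sub_le {g : Circ → ℝ} (hg : SmoothCirc g) :
    ∃ K, 0 ≤ K ∧ ∀ τ x, |ShearFlow.heat τ g x - g x| ≤ K * Real.sqrt τ := by
  obtain ⟨L, hL, hb⟩ := hg.exists_lipschitz
  set γ := ProbabilityTheory.gaussianReal 0 1
  have hi : Integrable (fun z : ℝ => |z|) γ :=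
    ((ProbabilityTheory.memLp_id_gaussianReal 1).integrable le_rfl).abs
  refine ⟨L * Real.sqrt 2 * ∫ z, |z| ∂γ, by positivity, fun τ x => ?_⟩
  have hc : Integrable (fun z : ℝ => g (x - ((Real.sqrt (2 * τ) * z : ℝ) : Circ))) γ := by
    obtain ⟨C, -, hC⟩ := exists_bound_of_continuous hg.continuous
    refine Integrable.of_bound (Continuous.aestronglyMeasurable ?_) C (ae_of_all _ fun z => hC _)
    exact hg.continuous.comp (continuous_const.sub
      ((AddCircle.continuous_mk' _).comp (by fun_prop)))
  have e : ShearFlow.heat τ g x - g x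
      = ∫ z : ℝ, (g (x - ((Real.sqrt (2 * τ) * z : ℝ) : Circ)) - g x) ∂γ := by
    rw [heat_eq_integral hg.continuous, integral_sub hc (integrable_const _)]
    simp [γ]
  rw [e]
  refine (abs_integral_le_integral_abs).trans ?_
  calc ∫ z : ℝ, |g (x - ((Real.sqrt (2 * τ) * z : ℝ) : Circ)) - g x| ∂γ
      ≤ ∫ z : ℝ, L * Real.sqrt (2 * τ) * |z| ∂γ := by
        refine integral_mono_of_nonneg (ae_of_all _ fun z => abs_nonneg _) (hi.const_mul _)
          (ae_of_all _ fun z => ?_)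
        have := hb x (-(Real.sqrt (2 * τ) * z))
        rw [abs_neg, abs_mul, abs_of_nonneg (Real.sqrt_nonneg _), AddCircle.coe_neg,
          ← sub_eq_add_neg] at this
        simpa [mul_assoc] using this
    _ = L * Real.sqrt 2 * (∫ z, |z| ∂γ) * Real.sqrt τ := by
        rw [integral_const_mul, Real.sqrt_mul (by norm_num)]
        ring

theorem SmoothCirc.smoothTorus {d : ℕ} {g : Circ → ℝ} (hg : SmoothCirc g) (i : Fin d) :
    SmoothTorus (fun x : Torus d => g (x i)) :=
  ContDiff.comp (g := fun z : ℝ => g (z : Circ)) hg (contDiff_apply ℝ ℝ i)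

theorem pd_circ {d : ℕ} (g : Circ → ℝ) (i : Fin d) (x : Torus d) :
    pd i (fun x : Torus d => g (x i)) x = ShearFlow.circDeriv g (x i) := by
  simp [pd, ShearFlow.circDeriv]

theorem pd_circ_of_ne {d : ℕ} (g : Circ → ℝ) {i j : Fin d} (hij : j ≠ i) (x : Torus d) :
    pd j (fun x : Torus d => g (x i)) x = 0 := by
  simp [pd, hij.symm]

/-! ### Fourier series on the torus: Parseval's identity and density of smooth functions. -/

/-- The character `x ↦ exp(i n·x)` of the torus. -/
noncomputable def character {d : ℕ} (n : Fin d → ℤ) : C(Torus d, ℂ) where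
  toFun x := ∏ i, fourier (n i) (x i)
  continuous_toFun := by fun_prop

theorem character_proj {d : ℕ} (n : Fin d → ℤ) (z : Fin d → ℝ) :
    character n (proj z) = Complex.exp ((∑ i, n i * z i : ℝ) * Complex.I) := by
  simp only [character, ContinuousMap.coe_mk, proj_apply, fourier_coe_apply]
  rw [← Complex.exp_sum]
  push_cast
  rw [Finset.sum_mul]
  congr 1
  refine Finset.sum_congr rfl fun i _ => ?_
  have : (Real.pi : ℂ) ≠ 0 := by exact_mod_cast Real.pi_ne_zero
  field_simp

theorem character_neg {d : ℕ} (n : Fin d → ℤ) (x : Torus d) :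
    character (-n) x = (starRingEnd ℂ) (character n x) := by
  simp only [character, Pi.neg_apply, fourier_neg, ContinuousMap.coe_mk, map_prod]

theorem character_add {d : ℕ} (m n : Fin d → ℤ) (x : Torus d) :
    character (m + n) x = character m x * character n x := by
  simp only [character, Pi.add_apply, fourier_add, ContinuousMap.coe_mk, ← Finset.prod_mul_distrib]

/-- The star subalgebra of `C(𝕋^d, ℂ)` generated by the characters. -/
noncomputable def characterSubalgebra (d : ℕ) : StarSubalgebra ℂ C(Torus d, ℂ) where
  toSubalgebra := Algebra.adjoin ℂ (Set.range character)
  star_mem' := by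
    change Algebra.adjoin ℂ (Set.range character) ≤ star (Algebra.adjoin ℂ (Set.range character))
    refine Algebra.adjoin_le ?_
    rintro _ ⟨n, rfl⟩
    refine Algebra.subset_adjoin ⟨-n, ?_⟩
    ext1 x
    simp only [character_neg, starRingEnd_apply, ContinuousMap.star_apply]

/-- Products of characters are characters, so the linear span is already an algebra. -/
theorem characterSubalgebra_coe {d : ℕ} :
    (characterSubalgebra d).toSubalgebra.toSubmodule = Submodule.span ℂ (Set.range character) := by
  apply Algebra.adjoin_eq_span_of_subset
  refine .trans (fun x => Submonoid.closure_induction (fun _ => id) ⟨0, ?_⟩ ?_)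
    Submodule.subset_span
  · ext z
    simp [character]
  · rintro _ _ _ _ ⟨m, rfl⟩ ⟨n, rfl⟩
    exact ⟨m + n, ContinuousMap.ext (character_add m n)⟩

/-- In a coordinate where the two points differ, the character of frequency one is the injection of
the circle into ℂ. -/
theorem characterSubalgebra_separatesPoints {d : ℕ} :
    (characterSubalgebra d).SeparatesPoints := by
  classical
  intro x y hxy
  obtain ⟨i, hi⟩ := Function.ne_iff.1 hxy
  refine ⟨_, ⟨character (Pi.single i 1), Algebra.subset_adjoin ⟨Pi.single i 1, rfl⟩, rfl⟩, ?_⟩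
  have e : ∀ z : Torus d, character (Pi.single i 1) z = fourier 1 (z i) := by
    intro z
    simp only [character, ContinuousMap.coe_mk]
    rw [Finset.prod_eq_single i (fun j _ hj => by simp [Pi.single_eq_of_ne hj]) (by simp)]
    simp
  dsimp only
  rw [e, e, fourier_one, fourier_one]
  contrapose hi
  exact AddCircle.injective_toCircle Real.two_pi_pos.ne' (Circle.ext hi)

theorem span_character_closure_eq_top {d : ℕ} :
    (Submodule.span ℂ (Set.range (character (d := d)))).topologicalClosure = ⊤ := by
  rw [← characterSubalgebra_coe]
  exact congr_arg (Subalgebra.toSubmodule <| StarSubalgebra.toSubalgebra ·)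
    (ContinuousMap.starSubalgebra_topologicalClosure_eq_top_of_separatesPoints _
      characterSubalgebra_separatesPoints)

/-- The characters as elements of `L²`. -/
noncomputable abbrev characterLp {d : ℕ} (n : Fin d → ℤ) :
    Lp ℂ 2 (volume : Measure (Torus d)) :=
  ContinuousMap.toLp (E := ℂ) 2 volume ℂ (character n)

theorem span_characterLp_closure_eq_top {d : ℕ} :
    (Submodule.span ℂ (Set.range (characterLp (d := d)))).topologicalClosure = ⊤ := by
  simpa only [Submodule.map_span, ContinuousLinearMap.coe_coe, ← Set.range_comp,
    Function.comp_def] using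
    (ContinuousMap.toLp_denseRange ℂ (volume : Measure (Torus d)) ℂ
      (p := 2) (by simp)).topologicalClosure_map_submodule span_character_closure_eq_top

theorem integral_fourier_circ (k : ℤ) :
    ∫ x : Circ, fourier k x = if k = 0 then (2 * Real.pi : ℂ) else 0 := by
  have h := (orthonormal_iff_ite.mp <| orthonormal_fourier (T := 2 * Real.pi)) 0 k
  simp only [ContinuousMap.inner_toLp, ← fourier_neg, ← fourier_add] at h
  -- Orthonormality is known for the normalised Haar measure, and `volume` is 2π times it.
  rw [AddCircle.volume_eq_smul_haarAddCircle, integral_smul_measure]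
  have e : ∫ x : Circ, fourier k x ∂AddCircle.haarAddCircle = if 0 = k then 1 else 0 := by
    rw [← h]
    simp
  rw [e, ENNReal.toReal_ofReal Real.two_pi_pos.le]
  by_cases hk : k = 0
  · simp [hk]
  · simp [hk, Ne.symm hk]

theorem inner_characterLp {d : ℕ} (m n : Fin d → ℤ) :
    inner ℂ (characterLp m) (characterLp n) = if m = n then (2 * Real.pi : ℂ) ^ d else 0 := by
  simp only [ContinuousMap.inner_toLp, ← character_neg]
  have e : ∀ x : Torus d, character n x * character (-m) x
      = ∏ i, fourier ((n + -m) i) (x i) := fun x => by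
    rw [← character_add]; rfl
  simp_rw [e]
  rw [MeasureTheory.integral_fintype_prod_volume_eq_prod
    (fun i => fun x : Circ => (fourier ((n + -m) i) x : ℂ))]
  simp_rw [integral_fourier_circ]
  split_ifs with h
  · simp [h]
  · obtain ⟨i, hi⟩ := Function.ne_iff.mp h
    refine Finset.prod_eq_zero (Finset.mem_univ i) (if_neg ?_)
    simp only [Pi.add_apply, Pi.neg_apply]
    omega

/-- The normalising factor making the characters orthonormal. -/
noncomputable def characterScale (d : ℕ) : ℝ := (Real.sqrt ((2 * Real.pi) ^ d))⁻¹

theorem characterScale_sq (d : ℕ) : characterScale d ^ 2 * (2 * Real.pi) ^ d = 1 := by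
  have h : (0 : ℝ) < (2 * Real.pi) ^ d := by positivity
  rw [characterScale, inv_pow, Real.sq_sqrt h.le, inv_mul_cancel₀ h.ne']

theorem characterScale_ne_zero (d : ℕ) : characterScale d ≠ 0 := by
  have := characterScale_sq d
  intro h
  simp [h] at this

theorem orthonormal_character {d : ℕ} :
    Orthonormal ℂ (fun n : Fin d → ℤ => (characterScale d : ℂ) • characterLp n) := by
  rw [orthonormal_iff_ite]
  intro m n
  rw [inner_smul_left, inner_smul_right, inner_characterLp]
  split_ifs
  · rw [Complex.conj_ofReal, ← mul_assoc, ← sq]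
    exact_mod_cast characterScale_sq d
  · simp

/-- The Hilbert basis of `L²(𝕋^d; ℂ)` given by the normalised characters. -/
noncomputable def characterBasis (d : ℕ) :
    HilbertBasis (Fin d → ℤ) ℂ (Lp ℂ 2 (volume : Measure (Torus d))) :=
  HilbertBasis.mk orthonormal_character <| by
    rw [← span_characterLp_closure_eq_top]
    refine Submodule.topologicalClosure_mono (Submodule.span_le.2 ?_)
    rintro _ ⟨n, rfl⟩
    have h : (characterScale d : ℂ) ≠ 0 := by exact_mod_cast characterScale_ne_zero d
    rw [SetLike.mem_coe, ← inv_smul_smul₀ h (characterLp n)]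
    exact Submodule.smul_mem _ _ (Submodule.subset_span ⟨n, rfl⟩)

/-- `x ↦ cos(n·x)` on the torus. -/
noncomputable def cosTorus {d : ℕ} (n : Fin d → ℤ) (x : Torus d) : ℝ := (character n x).re

/-- `x ↦ sin(n·x)` on the torus. -/
noncomputable def sinTorus {d : ℕ} (n : Fin d → ℤ) (x : Torus d) : ℝ := (character n x).im

theorem cosTorus_proj {d : ℕ} (n : Fin d → ℤ) (z : Fin d → ℝ) :
    cosTorus n (proj z) = Real.cos (∑ i, n i * z i) := by
  rw [cosTorus, character_proj, Complex.exp_ofReal_mul_I_re]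

theorem sinTorus_proj {d : ℕ} (n : Fin d → ℤ) (z : Fin d → ℝ) :
    sinTorus n (proj z) = Real.sin (∑ i, n i * z i) := by
  rw [sinTorus, character_proj, Complex.exp_ofReal_mul_I_im]

theorem contDiff_phase {d : ℕ} (n : Fin d → ℤ) :
    ContDiff ℝ ∞ (fun z : Fin d → ℝ => ∑ i, (n i : ℝ) * z i) :=
  ContDiff.sum fun i _ => contDiff_const.mul (contDiff_apply ℝ ℝ i)

theorem smoothTorus_cosTorus {d : ℕ} (n : Fin d → ℤ) : SmoothTorus (cosTorus n) := by
  unfold SmoothTorus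
  simp_rw [cosTorus_proj]
  exact Real.contDiff_cos.comp (contDiff_phase n)

theorem smoothTorus_sinTorus {d : ℕ} (n : Fin d → ℤ) : SmoothTorus (sinTorus n) := by
  unfold SmoothTorus
  simp_rw [sinTorus_proj]
  exact Real.contDiff_sin.comp (contDiff_phase n)

theorem hasDerivAt_phase {d : ℕ} (n : Fin d → ℤ) (i : Fin d) (z : Fin d → ℝ) :
    HasDerivAt (fun h : ℝ => ∑ j, (n j : ℝ) * (z + h • (Pi.single i (1 : ℝ) : Fin d → ℝ)) j) (n i) 0 := by
  have e : (fun h : ℝ => ∑ j, (n j : ℝ) * (z + h • (Pi.single i (1 : ℝ) : Fin d → ℝ)) j)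
      = fun h : ℝ => (∑ j, (n j : ℝ) * z j) + h * n i := by
    ext h
    simp [mul_add, Finset.sum_add_distrib, Pi.single_apply, mul_comm]
  rw [e]
  simpa using ((hasDerivAt_id (0 : ℝ)).mul_const (n i : ℝ)).const_add (∑ j, (n j : ℝ) * z j)

theorem pd_cosTorus {d : ℕ} (n : Fin d → ℤ) (i : Fin d) (x : Torus d) :
    pd i (cosTorus n) x = -(n i : ℝ) * sinTorus n x := by
  obtain ⟨z, rfl⟩ := proj_surjective x
  rw [pd_proj]
  simp_rw [cosTorus_proj, sinTorus_proj]
  have := (hasDerivAt_phase n i z).cos.deriv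
  rw [this]
  simp [mul_comm]

theorem pd_sinTorus {d : ℕ} (n : Fin d → ℤ) (i : Fin d) (x : Torus d) :
    pd i (sinTorus n) x = (n i : ℝ) * cosTorus n x := by
  obtain ⟨z, rfl⟩ := proj_surjective x
  rw [pd_proj]
  simp_rw [cosTorus_proj, sinTorus_proj]
  have := (hasDerivAt_phase n i z).sin.deriv
  rw [this]
  simp [mul_comm]

/-- The inner product is conjugate linear in its first argument, whence the minus sign. For a real
function the complex coefficient carries exactly the cosine and sine integrals, and the rest of the
proof uses only those. -/
theorem inner_characterLp_ofReal {d : ℕ} (n : Fin d → ℤ) {v : Torus d → ℝ}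
    (hv : MemLp v 2 volume) :
    inner ℂ (characterLp n) (hv.ofReal (K := ℂ)).toLp
      = ((∫ x, v x * cosTorus n x : ℝ) : ℂ) - (∫ x, v x * sinTorus n x : ℝ) * Complex.I := by
  have hi := hv.integrable one_le_two
  rw [L2.inner_def]
  have e : (fun x => inner ℂ ((characterLp n : Lp ℂ 2 volume) x)
      (((hv.ofReal (K := ℂ)).toLp : Lp ℂ 2 volume) x)) =ᵐ[volume]
      fun x => ((v x * cosTorus n x : ℝ) : ℂ) - ((v x * sinTorus n x : ℝ) : ℂ) * Complex.I := by
    filter_upwards [ContinuousMap.coeFn_toLp (E := ℂ) (p := 2) (𝕜 := ℂ) volume (character n),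
      (hv.ofReal (K := ℂ)).coeFn_toLp] with x h1 h2
    rw [h1, h2]
    apply Complex.ext <;> simp [cosTorus, sinTorus, mul_comm]
  rw [integral_congr_ae e, integral_sub, integral_mul_const, integral_complex_ofReal,
    integral_complex_ofReal]
  · exact (integrable_mul_of_continuous hi (smoothTorus_cosTorus n).continuous).ofReal
  · exact (integrable_mul_of_continuous hi (smoothTorus_sinTorus n).continuous).ofReal.mul_const _

/-- **Parseval's identity** for real functions on the torus. -/
theorem hasSum_parseval {d : ℕ} {v w : Torus d → ℝ} (hv : MemLp v 2 volume)
    (hw : MemLp w 2 volume) :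
    HasSum (fun n : Fin d → ℤ => (∫ x, v x * cosTorus n x) * (∫ x, w x * cosTorus n x)
      + (∫ x, v x * sinTorus n x) * (∫ x, w x * sinTorus n x))
      ((2 * Real.pi) ^ d * ∫ x, v x * w x) := by
  have h := Complex.hasSum_re ((characterBasis d).hasSum_inner_mul_inner
    (hv.ofReal (K := ℂ)).toLp (hw.ofReal (K := ℂ)).toLp)
  have e1 : (inner ℂ ((hv.ofReal (K := ℂ)).toLp : Lp ℂ 2 volume) (hw.ofReal (K := ℂ)).toLp).re
      = ∫ x, v x * w x := by
    rw [L2.inner_def]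
    have e : (fun x => inner ℂ (((hv.ofReal (K := ℂ)).toLp : Lp ℂ 2 volume) x)
        (((hw.ofReal (K := ℂ)).toLp : Lp ℂ 2 volume) x)) =ᵐ[volume]
        fun x => ((v x * w x : ℝ) : ℂ) := by
      filter_upwards [(hv.ofReal (K := ℂ)).coeFn_toLp, (hw.ofReal (K := ℂ)).coeFn_toLp]
        with x h1 h2
      rw [h1, h2]
      simp [mul_comm]
    rw [integral_congr_ae e, integral_complex_ofReal, Complex.ofReal_re]
  rw [e1] at h
  have h2 := h.mul_left ((2 * Real.pi) ^ d)
  refine h2.congr_fun fun n => ?_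
  have hb : (characterBasis d) n = (characterScale d : ℂ) • characterLp n := by
    rw [characterBasis, HilbertBasis.coe_mk]
  rw [hb, inner_smul_left, inner_smul_right, ← inner_conj_symm, inner_characterLp_ofReal n hv,
    inner_characterLp_ofReal n hw]
  have hs := characterScale_sq d
  simp only [map_sub, map_mul, Complex.conj_ofReal, Complex.conj_I, Complex.mul_re, Complex.sub_re,
    Complex.sub_im, Complex.mul_im, Complex.ofReal_re, Complex.ofReal_im, Complex.I_re,
    Complex.I_im, Complex.neg_re, Complex.neg_im]
  linear_combination (-((∫ x, v x * cosTorus n x) * (∫ x, w x * cosTorus n x)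
      + (∫ x, v x * sinTorus n x) * (∫ x, w x * sinTorus n x))) * hs

/-- Real and imaginary parts are tracked together because complex scalars mix them. -/
theorem exists_smooth_of_mem_span {d : ℕ} (p : Lp ℂ 2 (volume : Measure (Torus d)))
    (hp : p ∈ Submodule.span ℂ (Set.range (characterLp (d := d)))) :
    ∃ φ ψ : Torus d → ℝ, SmoothTorus φ ∧ SmoothTorus ψ ∧
      ∀ᵐ x, p x = (φ x : ℂ) + (ψ x : ℂ) * Complex.I := by
  induction hp using Submodule.span_induction with
  | mem p h =>
    obtain ⟨n, rfl⟩ := h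
    refine ⟨cosTorus n, sinTorus n, smoothTorus_cosTorus n, smoothTorus_sinTorus n, ?_⟩
    filter_upwards [ContinuousMap.coeFn_toLp (E := ℂ) (p := 2) (𝕜 := ℂ) volume (character n)]
      with x h
    rw [h, cosTorus, sinTorus, Complex.re_add_im]
  | zero =>
    refine ⟨fun _ => 0, fun _ => 0, .const 0, .const 0, ?_⟩
    filter_upwards [Lp.coeFn_zero ℂ 2 (volume : Measure (Torus d))] with x h
    simp
  | add p q _ _ hp hq =>
    obtain ⟨φ, ψ, h1, h2, h3⟩ := hp
    obtain ⟨φ', ψ', h1', h2', h3'⟩ := hq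
    refine ⟨_, _, h1.add h1', h2.add h2', ?_⟩
    filter_upwards [h3, h3', Lp.coeFn_add p q] with x a b c
    rw [c, Pi.add_apply, a, b]
    push_cast
    ring
  | smul c p _ hp =>
    obtain ⟨φ, ψ, h1, h2, h3⟩ := hp
    refine ⟨fun x => c.re * φ x + -c.im * ψ x, fun x => c.re * ψ x + c.im * φ x,
      ((SmoothTorus.const c.re).mul h1).add ((SmoothTorus.const (-c.im)).mul h2),
      ((SmoothTorus.const c.re).mul h2).add ((SmoothTorus.const c.im).mul h1), ?_⟩
    filter_upwards [h3, Lp.coeFn_smul c p] with x a b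
    rw [b, Pi.smul_apply, a]
    apply Complex.ext <;> simp
    ring

/-- Smooth functions are dense in `L²(𝕋^d)`. -/
theorem exists_smooth_eLpNorm_sub_lt {d : ℕ} {v : Torus d → ℝ} (hv : MemLp v 2 volume)
    {ε : ENNReal} (hε : 0 < ε) :
    ∃ φ, SmoothTorus φ ∧ eLpNorm (fun x => v x - φ x) 2 volume < ε := by
  have h : (hv.ofReal (K := ℂ)).toLp ∈ closure
      (Submodule.span ℂ (Set.range (characterLp (d := d))) : Set (Lp ℂ 2 volume)) := by
    rw [← Submodule.topologicalClosure_coe, span_characterLp_closure_eq_top]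
    trivial
  obtain ⟨p, hp, hlt⟩ := EMetric.mem_closure_iff.1 h ε hε
  obtain ⟨φ, ψ, hφ, -, hpe⟩ := exists_smooth_of_mem_span p hp
  refine ⟨φ, hφ, lt_of_le_of_lt ?_ hlt⟩
  rw [Lp.edist_def]
  -- Since v is real, passing to the real part of the complex approximant does not increase the
  -- error.
  refine eLpNorm_mono_ae ?_
  filter_upwards [hpe, (hv.ofReal (K := ℂ)).coeFn_toLp] with x h1 h2
  rw [Pi.sub_apply, h1, h2]
  refine le_trans (le_of_eq ?_) (Complex.abs_re_le_norm _)
  simp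

/-! ### Weak derivatives in time on the half line. -/

theorem integrable_of_continuousOn_Ioi {f : ℝ → ℝ} (hf : ContinuousOn f (Set.Ioi 0)) {a b : ℝ}
    (ha : 0 < a) (h0 : ∀ t, t ∉ Set.Icc a b → f t = 0) : Integrable f volume := by
  have h1 : IntegrableOn f (Set.Icc a b) volume :=
    (hf.mono fun t ht => ha.trans_le ht.1).integrableOn_Icc
  rwa [integrableOn_iff_integrable_of_support_subset] at h1
  exact Function.support_subset_iff'.2 h0

theorem setIntegral_Ioi_eq_integral {f : ℝ → ℝ} {a b : ℝ}
    (ha : 0 < a) (h0 : ∀ t, t ∉ Set.Icc a b → f t = 0) :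
    ∫ t in Set.Ioi (0 : ℝ), f t = ∫ t, f t :=
  setIntegral_eq_integral_of_forall_compl_eq_zero fun t ht =>
    h0 t fun h => ht (ha.trans_le h.1)

theorem integral_eq_interval_of_support {f : ℝ → ℝ} {a b : ℝ} (hab : a ≤ b)
    (h0 : ∀ t, t ∉ Set.Ioc a b → f t = 0) : ∫ t, f t = ∫ t in a..b, f t := by
  rw [intervalIntegral.integral_of_le hab, setIntegral_eq_integral_of_forall_compl_eq_zero h0]

/-- A smooth compactly supported function of integral zero on the half line is the derivative of
such a function. -/
theorem exists_primitive_of_integral_eq_zero {ψ : ℝ → ℝ} (hψ : ContDiff ℝ ∞ ψ) {a b : ℝ}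
    (hab : a ≤ b) (h0 : ∀ t, t ∉ Set.Ioc a b → ψ t = 0) (hint : ∫ t, ψ t = 0) :
    ∃ θ : ℝ → ℝ, ContDiff ℝ ∞ θ ∧ deriv θ = ψ ∧ ∀ t, t ∉ Set.Icc a b → θ t = 0 := by
  have hd : ∀ t, HasDerivAt (fun t => ∫ s in a..t, ψ s) (ψ t) t := fun t =>
    hψ.continuous.integral_hasStrictDerivAt a t |>.hasDerivAt
  have hde : deriv (fun t => ∫ s in a..t, ψ s) = ψ := funext fun t => (hd t).deriv
  refine ⟨_, contDiff_infty_iff_deriv.2 ⟨fun t => (hd t).differentiableAt, by rw [hde]; exact hψ⟩, hde,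
    fun t ht => ?_⟩
  rw [integral_eq_interval_of_support hab h0] at hint
  rcases lt_or_ge t a with hta | hta
  · rw [intervalIntegral.integral_symm, intervalIntegral.integral_of_le hta.le,
      setIntegral_eq_zero_of_forall_eq_zero, neg_zero]
    exact fun s hs => h0 s fun h => absurd h.1 (not_lt.2 hs.2)
  · have htb : b < t := by
      by_contra! h
      exact ht ⟨hta, h⟩
    rw [← intervalIntegral.integral_add_adjacent_intervals
      (hψ.continuous.intervalIntegrable a b) (hψ.continuous.intervalIntegrable b t), hint, zero_add,
      intervalIntegral.integral_of_le htb.le, setIntegral_eq_zero_of_forall_eq_zero]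
    exact fun s hs => h0 s fun h => absurd h.2 (not_le.2 hs.1)

/-- **Du Bois-Reymond lemma** on the half line. -/
theorem exists_eq_const_of_weak_deriv_eq_zero {H : ℝ → ℝ} (hH : ContinuousOn H (Set.Ioi 0))
    (h : ∀ θ : ℝ → ℝ, ContDiff ℝ ∞ θ → (∃ a b : ℝ, 0 < a ∧ ∀ t, t ∉ Set.Icc a b → θ t = 0) →
      ∫ t in Set.Ioi (0 : ℝ), H t * deriv θ t = 0) :
    ∃ c, ∀ t, 0 < t → H t = c := by
  -- A bump of integral one supported in (1, 3), away from time zero; the constant is the average of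
  -- H against it.
  let bump : ContDiffBump (2 : ℝ) := ⟨1 / 2, 1, by norm_num, by norm_num⟩
  let η : ℝ → ℝ := bump.normed volume
  have hη : ContDiff ℝ ∞ η := bump.contDiff_normed
  have hη1 : ∫ t, η t = 1 := bump.integral_normed
  have hη0 : ∀ t, t ∉ Set.Ioo (1 : ℝ) 3 → η t = 0 := by
    intro t ht
    have : t ∉ Function.support η := by
      rw [bump.support_normed_eq, Real.ball_eq_Ioo]
      convert! ht using 2
      all_goals norm_num
    simpa using this
  refine ⟨∫ t, H t * η t, ?_⟩
  have key : ∀ᵐ t ∂(volume : Measure ℝ), t ∈ Set.Ioi (0 : ℝ) →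
      H t - ∫ t, H t * η t = 0 := by
    refine isOpen_Ioi.ae_eq_zero_of_integral_contDiff_smul_eq_zero
      ((hH.sub continuousOn_const).locallyIntegrableOn measurableSet_Ioi) fun ψ hψ hc hs => ?_
    obtain ⟨a, b, ha, hab, h3b, ha1, h0⟩ : ∃ a b : ℝ, 0 < a ∧ a ≤ b ∧ 3 ≤ b ∧ a ≤ 1 ∧
        ∀ t, t ∉ Set.Ioc a b → ψ t = 0 := by
      obtain ⟨b, hb⟩ := hc.isCompact.bddAbove
      obtain ⟨a, ha, hb'⟩ : ∃ a : ℝ, 0 < a ∧ ∀ t ∈ tsupport ψ, a < t := by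
        rcases (tsupport ψ).eq_empty_or_nonempty with he | hne
        · exact ⟨1, one_pos, by simp [he]⟩
        · obtain ⟨m, hm, hmin⟩ := hc.isCompact.exists_isLeast hne
          have : (0 : ℝ) < m := hs hm
          exact ⟨m / 2, by linarith, fun t ht => by linarith [hmin ht]⟩
      refine ⟨min a 1, max b 3, by positivity, ?_, le_max_right _ _, min_le_right _ _, ?_⟩
      · exact (min_le_right _ _).trans ((by norm_num : (1 : ℝ) ≤ 3).trans (le_max_right _ _))
      · intro t ht
        by_contra hne
        have hmem : t ∈ tsupport ψ := subset_tsupport _ hne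
        exact ht ⟨(min_le_left _ _).trans_lt (hb' t hmem), (hb hmem).trans (le_max_left _ _)⟩
    have hη0' : ∀ t, t ∉ Set.Ioc a b → η t = 0 := fun t ht => hη0 t fun h =>
      ht ⟨ha1.trans_lt h.1, h.2.le.trans h3b⟩
    have hI : ∀ {k : ℝ → ℝ}, ContDiff ℝ ∞ k → (∀ t, t ∉ Set.Ioc a b → k t = 0) →
        Integrable (fun t => H t * k t) volume ∧ Integrable k volume := fun {k} hk hk0 =>
      ⟨integrable_of_continuousOn_Ioi (hH.mul hk.continuous.continuousOn) ha fun t ht => by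
        rw [hk0 t fun h => ht ⟨h.1.le, h.2⟩, mul_zero],
      integrable_of_continuousOn_Ioi hk.continuous.continuousOn ha fun t ht =>
        hk0 t fun h => ht ⟨h.1.le, h.2⟩⟩
    -- Removing the multiple (∫ ψ) η leaves a function of mean zero, hence the derivative of an
    -- admissible test function.
    obtain ⟨θ, hθ, hdθ, hθ0⟩ := exists_primitive_of_integral_eq_zero
      (ψ := fun t => ψ t - (∫ s, ψ s) * η t) (hψ.sub (contDiff_const.mul hη)) hab
      (fun t ht => by rw [h0 t ht, hη0' t ht]; ring) (by
        rw [integral_sub (hI hψ h0).2 ((hI hη hη0').2.const_mul _), integral_const_mul, hη1]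
        ring)
    have h1 := h θ hθ ⟨a, b, ha, hθ0⟩
    rw [hdθ] at h1
    dsimp only at h1
    rw [setIntegral_Ioi_eq_integral (a := a) (b := b) ha fun t ht => by
      rw [h0 t fun h => ht ⟨h.1.le, h.2⟩, hη0' t fun h => ht ⟨h.1.le, h.2⟩]; ring] at h1
    have e1 : ∀ t, H t * (ψ t - (∫ s, ψ s) * η t) = H t * ψ t - (∫ s, ψ s) * (H t * η t) :=
      fun t => by ring
    simp_rw [e1] at h1
    rw [integral_sub (hI hψ h0).1 ((hI hη hη0').1.const_mul _), integral_const_mul] at h1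
    have e2 : ∀ t, ψ t • (H t - ∫ t, H t * η t) = H t * ψ t - ψ t * ∫ t, H t * η t :=
      fun t => by rw [smul_eq_mul]; ring
    simp_rw [e2]
    rw [integral_sub (hI hψ h0).1 ((hI hψ h0).2.mul_const _), integral_mul_const]
    exact h1
  have hae : H =ᵐ[volume.restrict (Set.Ioi 0)] fun _ => ∫ t, H t * η t := by
    rw [Filter.EventuallyEq, ae_restrict_iff' measurableSet_Ioi]
    filter_upwards [key] with t ht h
    exact sub_eq_zero.1 (ht h)
  have := Measure.eqOn_of_ae_eq hae hH continuousOn_const (by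
    rw [interior_Ioi]; exact subset_closure)
  exact fun t ht => this ht

/-- A continuous function with continuous weak derivative on the half line is differentiable. -/
theorem hasDerivAt_of_weak_deriv {A B : ℝ → ℝ} (hA : ContinuousOn A (Set.Ioi 0))
    (hB : ContinuousOn B (Set.Ioi 0))
    (h : ∀ θ : ℝ → ℝ, ContDiff ℝ ∞ θ → (∃ a b : ℝ, 0 < a ∧ ∀ t, t ∉ Set.Icc a b → θ t = 0) →
      ∫ t in Set.Ioi (0 : ℝ), (A t * deriv θ t + B t * θ t) = 0) {t : ℝ} (ht : 0 < t) :
    HasDerivAt A (B t) t := by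
  have hP : ∀ t, 0 < t → HasDerivAt (fun t => ∫ s in (1 : ℝ)..t, B s) (B t) t := by
    intro t ht
    refine intervalIntegral.integral_hasDerivAt_right ?_
      (hB.stronglyMeasurableAtFilter isOpen_Ioi t ht) (hB.continuousAt (Ioi_mem_nhds ht))
    refine (hB.mono fun s hs => ?_).intervalIntegrable
    rw [Set.mem_uIcc] at hs
    rcases hs with hs | hs
    · exact one_pos.trans_le hs.1
    · exact ht.trans_le hs.1
  -- The primitive starts at time 1 because nothing is assumed about B near 0. The difference A - P
  -- then has zero weak derivative.
  set P := fun t => ∫ s in (1 : ℝ)..t, B s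
  have hPc : ContinuousOn P (Set.Ioi 0) := fun t ht => (hP t ht).continuousAt.continuousWithinAt
  obtain ⟨c, hc⟩ := exists_eq_const_of_weak_deriv_eq_zero (hA.sub hPc) fun θ hθ hs => by
    obtain ⟨a, b, ha, h0⟩ := hs
    have hd0 : ∀ t, t ∉ Set.Icc a b → deriv θ t = 0 := by
      intro t ht
      have : θ =ᶠ[𝓝 t] fun _ => 0 := by
        filter_upwards [isClosed_Icc.isOpen_compl.mem_nhds ht] with s hs using h0 s hs
      rw [this.deriv_eq, deriv_const]
    have hdc : Continuous (deriv θ) := hθ.continuous_deriv (by simp)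
    have h1 := h θ hθ ⟨a, b, ha, h0⟩
    have hi : ∀ {k l : ℝ → ℝ}, ContinuousOn k (Set.Ioi 0) → Continuous l →
        (∀ t, t ∉ Set.Icc a b → l t = 0) → Integrable (fun t => k t * l t) volume :=
      fun {k l} hk hl hl0 => integrable_of_continuousOn_Ioi (hk.mul hl.continuousOn) ha
        fun t ht => by rw [hl0 t ht, mul_zero]
    have h2 : ∫ t in Set.Ioi (0 : ℝ), (P t * deriv θ t + B t * θ t) = 0 := by
      rw [setIntegral_Ioi_eq_integral (a := a) (b := b) ha fun t ht => by
        rw [h0 t ht, hd0 t ht]; ring]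
      -- The interval is widened so that θ vanishes at both ends; the maximum covers the case b < a.
      have hle : a / 2 ≤ max a b + 1 := by linarith [le_max_left a b]
      rw [integral_eq_interval_of_support (a := a / 2) (b := max a b + 1) hle fun t ht => ?_]
      · rw [intervalIntegral.integral_eq_sub_of_hasDerivAt (f := fun t => P t * θ t)]
        · rw [h0 _ fun h => ?_, h0 _ fun h => ?_]
          · ring
          · linarith [h.1]
          · linarith [h.2, le_max_right a b]
        · intro t ht
          rw [Set.uIcc_of_le hle] at ht
          have := (hP t (by linarith [ht.1])).mul
            ((hθ.differentiable (by simp)).differentiableAt (x := t)).hasDerivAt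
          rwa [add_comm] at this
        · exact ((hi hPc hdc hd0).add (hi hB hθ.continuous h0)).intervalIntegrable
      · have : t ∉ Set.Icc a b := fun h => ht
          ⟨by linarith [h.1], by linarith [h.2, le_max_right a b]⟩
        rw [h0 t this, hd0 t this]
        ring
    have e : ∀ t, (A t - P t) * deriv θ t = (A t * deriv θ t + B t * θ t)
        - (P t * deriv θ t + B t * θ t) := fun t => by ring
    simp only [Pi.sub_apply, e]
    have i1 : Integrable (fun t => A t * deriv θ t + B t * θ t) volume :=
      (hi hA hdc hd0).add (hi hB hθ.continuous h0)
    have i2 : Integrable (fun t => P t * deriv θ t + B t * θ t) volume :=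
      (hi hPc hdc hd0).add (hi hB hθ.continuous h0)
    rw [integral_sub i1.integrableOn i2.integrableOn, h1, h2, sub_zero]
  have h3 := (hP t ht).add_const c
  refine h3.congr_of_eventuallyEq ?_
  filter_upwards [Ioi_mem_nhds ht] with s hs
  rw [← hc s hs, Pi.sub_apply]
  ring

/-! ### The weak equation at fixed times. -/

/-- Smooth functions on `ℝ × 𝕋^d`. -/
def SmoothCylinder {d : ℕ} (φ : ℝ → Torus d → ℝ) : Prop :=
  ContDiff ℝ ∞ (fun p : ℝ × (Fin d → ℝ) => φ p.1 (proj p.2))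

theorem SmoothCylinder.smoothTorus {d : ℕ} {φ : ℝ → Torus d → ℝ} (h : SmoothCylinder φ) (t : ℝ) :
    SmoothTorus (φ t) :=
  ContDiff.comp (g := fun p : ℝ × (Fin d → ℝ) => φ p.1 (proj p.2)) h
    (contDiff_const.prodMk contDiff_id : ContDiff ℝ ∞ fun z : Fin d → ℝ => (t, z))

theorem SmoothCylinder.continuous {d : ℕ} {φ : ℝ → Torus d → ℝ} (h : SmoothCylinder φ) :
    Continuous (Function.uncurry φ) :=
  continuous_of_lift_time (ContDiff.continuous h)

theorem SmoothTorus.smoothCylinder {d : ℕ} {φ : Torus d → ℝ} (h : SmoothTorus φ) :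
    SmoothCylinder (fun _ => φ) :=
  ContDiff.comp (g := fun z : Fin d → ℝ => φ (proj z)) h contDiff_snd

theorem SmoothCylinder.hasFDerivAt {d : ℕ} {φ : ℝ → Torus d → ℝ} (h : SmoothCylinder φ)
    (p : ℝ × (Fin d → ℝ)) :
    HasFDerivAt (fun p : ℝ × (Fin d → ℝ) => φ p.1 (proj p.2))
      (fderiv ℝ (fun p : ℝ × (Fin d → ℝ) => φ p.1 (proj p.2)) p) p :=
  ((ContDiff.differentiable h (by simp)).differentiableAt).hasFDerivAt

theorem SmoothCylinder.hasDerivAt_time_proj {d : ℕ} {φ : ℝ → Torus d → ℝ} (h : SmoothCylinder φ)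
    (t : ℝ) (z : Fin d → ℝ) :
    HasDerivAt (fun s => φ s (proj z))
      (fderiv ℝ (fun p : ℝ × (Fin d → ℝ) => φ p.1 (proj p.2)) (t, z) (1, 0)) t :=
  (h.hasFDerivAt (t, z)).comp_hasDerivAt (f := fun s : ℝ => (s, z)) t
    ((hasDerivAt_id t).prodMk (hasDerivAt_const t z))

theorem SmoothCylinder.hasDerivAt_time {d : ℕ} {φ : ℝ → Torus d → ℝ} (h : SmoothCylinder φ)
    (t : ℝ) (x : Torus d) : HasDerivAt (fun s => φ s x) (deriv (fun s => φ s x) t) t := by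
  obtain ⟨z, rfl⟩ := proj_surjective x
  exact (h.hasDerivAt_time_proj t z).differentiableAt.hasDerivAt

theorem SmoothCylinder.deriv_time {d : ℕ} {φ : ℝ → Torus d → ℝ} (h : SmoothCylinder φ) :
    SmoothCylinder (fun t x => deriv (fun s => φ s x) t) := by
  unfold SmoothCylinder
  simp_rw [(h.hasDerivAt_time_proj _ _).deriv]
  exact (ContDiff.fderiv_right h (m := ∞) (by simp)).clm_apply contDiff_const

theorem SmoothCylinder.pd {d : ℕ} {φ : ℝ → Torus d → ℝ} (h : SmoothCylinder φ) (i : Fin d) :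
    SmoothCylinder (fun t => pd i (φ t)) := by
  have e : ∀ (t : ℝ) (z : Fin d → ℝ), ShearFlow.pd i (φ t) (proj z)
      = fderiv ℝ (fun p : ℝ × (Fin d → ℝ) => φ p.1 (proj p.2)) (t, z) (0, Pi.single i 1) := by
    intro t z
    rw [pd_proj]
    have h1 : HasDerivAt (fun r : ℝ => (t, z + r • (Pi.single i (1 : ℝ) : Fin d → ℝ)))
        ((0 : ℝ), (Pi.single i (1 : ℝ) : Fin d → ℝ)) 0 := by
      refine (hasDerivAt_const (0 : ℝ) t).prodMk ?_
      simpa using ((hasDerivAt_id (0 : ℝ)).smul_const (Pi.single i (1 : ℝ) : Fin d → ℝ)).const_add z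
    have h2 : HasFDerivAt (fun p : ℝ × (Fin d → ℝ) => φ p.1 (proj p.2))
        (fderiv ℝ (fun p : ℝ × (Fin d → ℝ) => φ p.1 (proj p.2)) (t, z))
        (t, z + (0 : ℝ) • (Pi.single i (1 : ℝ) : Fin d → ℝ)) := by
      simpa using h.hasFDerivAt (t, z)
    exact (h2.comp_hasDerivAt (0 : ℝ) h1).deriv
  unfold SmoothCylinder
  simp_rw [e]
  exact (ContDiff.fderiv_right h (m := ∞) (by simp)).clm_apply contDiff_const

/-- The pairing of an `L²`-continuous curve with a continuous function is continuous. -/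
theorem continuousOn_integral_mul {d : ℕ} {F : ℝ → Torus d → ℝ}
    (hF : ∀ t, 0 ≤ t → MemLp (F t) 2 volume)
    (hc : ∀ t, 0 ≤ t →
      Tendsto (fun s => eLpNorm (fun y => F s y - F t y) 2 volume) (𝓝[Set.Ici 0] t) (𝓝 0))
    {ψ : ℝ → Torus d → ℝ} (hψ : Continuous (Function.uncurry ψ)) :
    ContinuousOn (fun t => ∫ y, F t y * ψ t y) (Set.Ici 0) := by
  classical
  -- The default value 0 can occur only at negative times, where no integrability is assumed.
  let G : ℝ → Lp ℝ 2 (volume : Measure (Torus d)) := fun t =>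
    if h : MemLp (F t) 2 volume then h.toLp else 0
  have hG : ∀ {t} (ht : 0 ≤ t), G t = (hF t ht).toLp := fun {t} ht => dif_pos (hF t ht)
  have hGc : ContinuousOn G (Set.Ici 0) := by
    intro t ht
    rw [ContinuousWithinAt, Lp.tendsto_Lp_iff_tendsto_eLpNorm']
    refine (hc t ht).congr' ?_
    filter_upwards [self_mem_nhdsWithin] with s hs
    refine eLpNorm_congr_ae ?_
    rw [hG hs, hG ht]
    filter_upwards [(hF s hs).coeFn_toLp, (hF t ht).coeFn_toLp] with y h1 h2
    rw [Pi.sub_apply, h1, h2]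
  let Ψ : C(ℝ, C(Torus d, ℝ)) := ContinuousMap.curry ⟨_, hψ⟩
  have hΨ : Continuous fun t => ContinuousMap.toLp (E := ℝ) 2 (volume : Measure (Torus d)) ℝ (Ψ t) :=
    (ContinuousLinearMap.continuous _).comp Ψ.continuous
  refine (hGc.inner hΨ.continuousOn (𝕜 := ℝ)).congr fun t ht => ?_
  dsimp only
  rw [L2.inner_def]
  refine integral_congr_ae ?_
  rw [hG ht]
  filter_upwards [(hF t ht).coeFn_toLp,
    ContinuousMap.coeFn_toLp (E := ℝ) (p := 2) (𝕜 := ℝ) volume (Ψ t)] with y h1 h2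
  rw [h1, h2]
  simp [Ψ, mul_comm]

theorem continuous_heat_mul {d : ℕ} {g : Circ → ℝ} (hg : Continuous g) (ν : ℝ) (i : Fin d) :
    Continuous fun p : ℝ × Torus d => heat (ν * p.1) g (p.2 i) :=
  (continuous_heat_uncurry hg).comp
    ((continuous_const.mul continuous_fst).prodMk ((continuous_apply i).comp continuous_snd))

/-- The adjoint operator `∂_t - (e^{νt∂²}g) ∂_1 + ν((λ²+1)∂_1² + ∂_2²)`. -/
noncomputable def adjointOp (ν : ℝ) (lam : ℤ) (g : Circ → ℝ) (φ : ℝ → Torus 2 → ℝ) (t : ℝ)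
    (y : Torus 2) : ℝ :=
  deriv (fun s => φ s y) t - heat (ν * t) g (y 1) * pd 0 (φ t) y
    + ν * (((lam : ℝ) ^ 2 + 1) * pd 0 (pd 0 (φ t)) y + pd 1 (pd 1 (φ t)) y)

theorem continuous_adjointOp {ν : ℝ} {lam : ℤ} {g : Circ → ℝ} (hg : Continuous g)
    {φ : ℝ → Torus 2 → ℝ} (hφ : SmoothCylinder φ) :
    Continuous (Function.uncurry (adjointOp ν lam g φ)) := by
  have h1 := hφ.deriv_time.continuous
  have h2 := (hφ.pd 0).continuous
  have h3 := ((hφ.pd 0).pd 0).continuous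
  have h4 := ((hφ.pd 1).pd 1).continuous
  exact (h1.sub ((continuous_heat_mul hg ν 1).mul h2)).add
    (continuous_const.mul ((continuous_const.mul h3).add h4))

section WeakFormulation

variable {ν : ℝ} {lam : ℤ} {f : Torus 2 → ℝ} {g : Circ → ℝ} {F : ℝ → Torus 2 → ℝ}

theorem IsDriftHeatSolution.continuousOn_pairing (h : IsDriftHeatSolution ν lam f g F)
    {ψ : ℝ → Torus 2 → ℝ} (hψ : Continuous (Function.uncurry ψ)) :
    ContinuousOn (fun t => ∫ y, F t y * ψ t y) (Set.Ici 0) :=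
  continuousOn_integral_mul h.memLp h.continuous hψ

theorem isTestFunction_mul {θ : ℝ → ℝ} (hθ : ContDiff ℝ ∞ θ) {a b : ℝ} (ha : 0 < a)
    (h0 : ∀ t, t ∉ Set.Icc a b → θ t = 0) {φ : ℝ → Torus 2 → ℝ} (hφ : SmoothCylinder φ) :
    IsTestFunction fun t y => θ t * φ t y :=
  ⟨(hθ.comp contDiff_fst).mul hφ, a, b, ha, fun t ht x => by
    dsimp only
    rw [h0 t ht, zero_mul]⟩

/-- The weak formulation at fixed times, against functions smooth on `ℝ × 𝕋²`. -/
theorem IsDriftHeatSolution.hasDerivAt_pairing (h : IsDriftHeatSolution ν lam f g F)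
    (hg : Continuous g) {φ : ℝ → Torus 2 → ℝ} (hφ : SmoothCylinder φ) {t : ℝ} (ht : 0 < t) :
    HasDerivAt (fun t => ∫ y, F t y * φ t y) (∫ y, F t y * adjointOp ν lam g φ t y) t := by
  have hA := h.continuousOn_pairing hφ.continuous
  have hB := h.continuousOn_pairing (continuous_adjointOp (ν := ν) (lam := lam) hg hφ)
  refine hasDerivAt_of_weak_deriv (B := fun t => ∫ y, F t y * adjointOp ν lam g φ t y)
    (hA.mono Set.Ioi_subset_Ici_self) (hB.mono Set.Ioi_subset_Ici_self) ?_ ht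
  -- The test functions θ(t) φ(t, y) turn the distributional equation into a weak derivative in time
  -- of the pairing with φ.
  rintro θ hθ ⟨a, b, ha, h0⟩
  refine Eq.trans ?_ (h.equation _ (isTestFunction_mul hθ ha h0 hφ))
  refine setIntegral_congr_fun measurableSet_Ioi fun t ht => ?_
  replace ht : (0 : ℝ) < t := ht
  have hF := (h.memLp t (le_of_lt ht)).integrable one_le_two
  have hs : ∀ i : Fin 2, ∀ ψ : Torus 2 → ℝ, ∀ y,
      pd i (fun y => θ t * ψ y) y = θ t * pd i ψ y := fun i ψ y => by
    simp only [pd]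
    rw [deriv_const_mul_field']
  have hs' : ∀ i : Fin 2, ∀ ψ : Torus 2 → ℝ,
      pd i (fun y => θ t * ψ y) = fun y => θ t * pd i ψ y := fun i ψ => funext (hs i ψ)
  have hd : ∀ y, deriv (fun s => θ s * φ s y) t
      = deriv θ t * φ t y + θ t * deriv (fun s => φ s y) t := fun y =>
    (((hθ.differentiable (by simp)).differentiableAt (x := t)).hasDerivAt.fun_mul
      (hφ.hasDerivAt_time t y)).deriv
  have e : ∀ y, F t y * (deriv (fun s => θ s * φ s y) t
      - heat (ν * t) g (y 1) * pd 0 (fun y => θ t * φ t y) y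
        + ν * (((lam : ℝ) ^ 2 + 1) * pd 0 (pd 0 (fun y => θ t * φ t y)) y
          + pd 1 (pd 1 (fun y => θ t * φ t y)) y))
      = F t y * φ t y * deriv θ t + F t y * adjointOp ν lam g φ t y * θ t := fun y => by
    simp only [hs', hd, adjointOp]
    ring
  simp_rw [e]
  rw [integral_add, integral_mul_const, integral_mul_const]
  · exact (integrable_mul_of_continuous hF (hφ.smoothTorus t).continuous).mul_const _
  · refine (integrable_mul_of_continuous hF ?_).mul_const _
    exact (continuous_adjointOp hg hφ).comp (by fun_prop : Continuous fun y : Torus 2 => (t, y))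

end WeakFormulation

/-! ### Fourier coefficients of gradients and of the transport term. -/

/-- The spectral pairing `Re (v̂(n) conj ŵ(n))` of two real functions. -/
noncomputable def spectral {d : ℕ} (v w : Torus d → ℝ) (n : Fin d → ℤ) : ℝ :=
  (∫ x, v x * cosTorus n x) * (∫ x, w x * cosTorus n x)
    + (∫ x, v x * sinTorus n x) * (∫ x, w x * sinTorus n x)

theorem spectral_self_nonneg {d : ℕ} (v : Torus d → ℝ) (n : Fin d → ℤ) : 0 ≤ spectral v v n :=
  add_nonneg (mul_self_nonneg _) (mul_self_nonneg _)

/-- This provides the summable majorant of the transport cross term in the energy equality. -/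
theorem abs_two_mul_spectral_le {d : ℕ} (v w : Torus d → ℝ) (n : Fin d → ℤ) :
    |2 * spectral v w n| ≤ spectral v v n + spectral w w n := by
  unfold spectral
  generalize (∫ x, v x * cosTorus n x) = a
  generalize (∫ x, w x * cosTorus n x) = b
  generalize (∫ x, v x * sinTorus n x) = c
  generalize (∫ x, w x * sinTorus n x) = e
  rw [abs_le]
  constructor <;> nlinarith [sq_nonneg (a - b), sq_nonneg (a + b), sq_nonneg (c - e),
    sq_nonneg (c + e)]

theorem hasSum_spectral {d : ℕ} {v w : Torus d → ℝ} (hv : MemLp v 2 volume)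
    (hw : MemLp w 2 volume) : HasSum (spectral v w) ((2 * Real.pi) ^ d * ∫ x, v x * w x) :=
  hasSum_parseval hv hw

theorem IsWeakGradient.integral_mul_cosTorus {d : ℕ} {v : Torus d → ℝ} {w : Fin d → Torus d → ℝ}
    (h : IsWeakGradient v w) (n : Fin d → ℤ) (i : Fin d) :
    ∫ x, w i x * cosTorus n x = n i * ∫ x, v x * sinTorus n x := by
  have := h.2.2 _ (smoothTorus_cosTorus n) i
  simp_rw [pd_cosTorus] at this
  have e : ∀ x, v x * (-(n i : ℝ) * sinTorus n x) = -(n i : ℝ) * (v x * sinTorus n x) :=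
    fun x => by ring
  simp_rw [e, integral_const_mul] at this
  linarith

theorem IsWeakGradient.integral_mul_sinTorus {d : ℕ} {v : Torus d → ℝ} {w : Fin d → Torus d → ℝ}
    (h : IsWeakGradient v w) (n : Fin d → ℤ) (i : Fin d) :
    ∫ x, w i x * sinTorus n x = -(n i * ∫ x, v x * cosTorus n x) := by
  have := h.2.2 _ (smoothTorus_sinTorus n) i
  simp_rw [pd_sinTorus] at this
  have e : ∀ x, v x * ((n i : ℝ) * cosTorus n x) = (n i : ℝ) * (v x * cosTorus n x) :=
    fun x => by ring
  simp_rw [e, integral_const_mul] at this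
  linarith

theorem memLp_mul_of_continuous {X : Type*} [TopologicalSpace X] [CompactSpace X]
    [MeasurableSpace X] [OpensMeasurableSpace X] {μ : Measure X} {w ψ : X → ℝ}
    {p : ENNReal} (hψ : Continuous ψ) (hw : MemLp w p μ) : MemLp (fun x => ψ x * w x) p μ := by
  obtain ⟨C, -, hC⟩ := exists_bound_of_continuous hψ
  refine hw.of_le_mul (c := C) (hψ.measurable.aestronglyMeasurable.mul hw.1)
    (ae_of_all _ fun x => ?_)
  rw [norm_mul]
  exact mul_le_mul_of_nonneg_right (hC x) (norm_nonneg _)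

/-- A transport term with coefficient independent of the transport direction does no work. -/
theorem IsWeakGradient.integral_transport_eq_zero {v : Torus 2 → ℝ} {w : Fin 2 → Torus 2 → ℝ}
    (h : IsWeakGradient v w) {k : Circ → ℝ} (hk : SmoothCirc k) :
    ∫ y, w 0 y * (k (y 1) * v y) = 0 := by
  have hk2 : SmoothTorus (fun y : Torus 2 => k (y 1)) := hk.smoothTorus 1
  have hpd : ∀ {ψ : Torus 2 → ℝ}, SmoothTorus ψ → ∀ y,
      pd 0 (fun y => k (y 1) * ψ y) y = k (y 1) * pd 0 ψ y := fun {ψ} hψ y => by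
    rw [hk2.pd_mul hψ, pd_circ_of_ne k (by decide)]
    ring
  have hH : MemLp (fun y => k (y 1) * v y) 2 volume := memLp_mul_of_continuous hk2.continuous h.1
  have hK : MemLp (fun y => k (y 1) * w 0 y) 2 volume :=
    memLp_mul_of_continuous hk2.continuous (h.2.1 0)
  have hcK : ∀ n, ∫ y, k (y 1) * w 0 y * cosTorus n y
      = n 0 * ∫ y, k (y 1) * v y * sinTorus n y := fun n => by
    have := h.2.2 _ (hk2.mul (smoothTorus_cosTorus n)) 0
    simp_rw [hpd (smoothTorus_cosTorus n), pd_cosTorus] at this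
    have e : ∀ x, v x * (k (x 1) * (-(n 0 : ℝ) * sinTorus n x))
        = -(n 0 : ℝ) * (k (x 1) * v x * sinTorus n x) := fun x => by ring
    have e' : ∀ x, w 0 x * (k (x 1) * cosTorus n x) = k (x 1) * w 0 x * cosTorus n x :=
      fun x => by ring
    simp_rw [e, e', integral_const_mul] at this
    linarith
  have hsK : ∀ n, ∫ y, k (y 1) * w 0 y * sinTorus n y
      = -(n 0 * ∫ y, k (y 1) * v y * cosTorus n y) := fun n => by
    have := h.2.2 _ (hk2.mul (smoothTorus_sinTorus n)) 0
    simp_rw [hpd (smoothTorus_sinTorus n), pd_sinTorus] at this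
    have e : ∀ x, v x * (k (x 1) * ((n 0 : ℝ) * cosTorus n x))
        = (n 0 : ℝ) * (k (x 1) * v x * cosTorus n x) := fun x => by ring
    have e' : ∀ x, w 0 x * (k (x 1) * sinTorus n x) = k (x 1) * w 0 x * sinTorus n x :=
      fun x => by ring
    simp_rw [e, e', integral_const_mul] at this
    linarith
  have h1 := hasSum_spectral (h.2.1 0) hH
  have h2 := hasSum_spectral h.1 hK
  -- Since k does not depend on the first variable, moving the derivative costs only a sign in every
  -- mode. Both series sum to the same integral, which therefore equals its own negative.
  have h3 : HasSum (spectral v fun y => k (y 1) * w 0 y)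
      (-((2 * Real.pi) ^ 2 * ∫ y, w 0 y * (k (y 1) * v y))) := by
    refine h1.neg.congr_fun fun n => ?_
    unfold spectral
    rw [hcK, hsK, h.integral_mul_cosTorus, h.integral_mul_sinTorus]
    ring
  have h4 := h3.unique h2
  have e : ∀ y, v y * (k (y 1) * w 0 y) = w 0 y * (k (y 1) * v y) := fun y => by ring
  simp_rw [e] at h4
  have : (2 * Real.pi) ^ 2 ≠ 0 := by positivity
  have h5 : (2 * Real.pi) ^ 2 * ∫ y, w 0 y * (k (y 1) * v y) = 0 := by linarith
  exact (mul_eq_zero.1 h5).resolve_left this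

/-! ### The energy equality. -/

section Energy

variable {ν : ℝ} {lam : ℤ} {f : Torus 2 → ℝ} {g : Circ → ℝ} {F : ℝ → Torus 2 → ℝ}

theorem IsDriftHeatSolution.memLp_transport (h : IsDriftHeatSolution ν lam f g F)
    (hg : Continuous g) {t : ℝ} (ht : 0 ≤ t) :
    MemLp (fun y => heat (ν * t) g (y 1) * F t y) 2 volume :=
  memLp_mul_of_continuous (ψ := fun y : Torus 2 => heat (ν * t) g (y 1))
    ((continuous_heat hg _).comp (continuous_apply 1)) (h.memLp t ht)

/-- The eigenvalues of `-((λ²+1)∂_1² + ∂_2²)`. -/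
noncomputable def symbol (lam : ℤ) (n : Fin 2 → ℤ) : ℝ :=
  ((lam : ℝ) ^ 2 + 1) * (n 0 : ℝ) ^ 2 + (n 1 : ℝ) ^ 2

/-- The cosine is an admissible test function and an eigenfunction of the diffusion. The transport
term remains as a coefficient of the product of drift and solution. -/
theorem IsDriftHeatSolution.hasDerivAt_cos (h : IsDriftHeatSolution ν lam f g F)
    (hg : Continuous g) (n : Fin 2 → ℤ) {t : ℝ} (ht : 0 < t) :
    HasDerivAt (fun t => ∫ y, F t y * cosTorus n y)
      (n 0 * (∫ y, heat (ν * t) g (y 1) * F t y * sinTorus n y)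
        - ν * symbol lam n * ∫ y, F t y * cosTorus n y) t := by
  convert h.hasDerivAt_pairing hg (smoothTorus_cosTorus n).smoothCylinder ht using 1
  have hF := (h.memLp t ht.le).integrable one_le_two
  have hH := (h.memLp_transport hg ht.le).integrable one_le_two
  have e1 : pd 0 (cosTorus n) = fun y => -(n 0 : ℝ) * sinTorus n y := funext (pd_cosTorus n 0)
  have e2 : pd 1 (cosTorus n) = fun y => -(n 1 : ℝ) * sinTorus n y := funext (pd_cosTorus n 1)
  have hs : ∀ (c : ℝ) (i : Fin 2) y, pd i (fun y => c * sinTorus n y) y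
      = c * (n i * cosTorus n y) := fun c i y => by
    rw [← pd_sinTorus]
    simp only [pd]
    rw [deriv_const_mul_field']
  have e : ∀ y, F t y * adjointOp ν lam g (fun _ => cosTorus n) t y
      = n 0 * (heat (ν * t) g (y 1) * F t y * sinTorus n y)
        - ν * symbol lam n * (F t y * cosTorus n y) := fun y => by
    simp only [adjointOp, e1, e2, hs, deriv_const, symbol]
    ring
  simp_rw [e]
  rw [integral_sub, integral_const_mul, integral_const_mul]
  · exact (integrable_mul_of_continuous hH (smoothTorus_sinTorus n).continuous).const_mul _
  · exact (integrable_mul_of_continuous hF (smoothTorus_cosTorus n).continuous).const_mul _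

theorem IsDriftHeatSolution.hasDerivAt_sin (h : IsDriftHeatSolution ν lam f g F)
    (hg : Continuous g) (n : Fin 2 → ℤ) {t : ℝ} (ht : 0 < t) :
    HasDerivAt (fun t => ∫ y, F t y * sinTorus n y)
      (-(n 0 * ∫ y, heat (ν * t) g (y 1) * F t y * cosTorus n y)
        - ν * symbol lam n * ∫ y, F t y * sinTorus n y) t := by
  convert h.hasDerivAt_pairing hg (smoothTorus_sinTorus n).smoothCylinder ht using 1
  have hF := (h.memLp t ht.le).integrable one_le_two
  have hH := (h.memLp_transport hg ht.le).integrable one_le_two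
  have e1 : pd 0 (sinTorus n) = fun y => (n 0 : ℝ) * cosTorus n y := funext (pd_sinTorus n 0)
  have e2 : pd 1 (sinTorus n) = fun y => (n 1 : ℝ) * cosTorus n y := funext (pd_sinTorus n 1)
  have hs : ∀ (c : ℝ) (i : Fin 2) y, pd i (fun y => c * cosTorus n y) y
      = c * (-n i * sinTorus n y) := fun c i y => by
    rw [← pd_cosTorus]
    simp only [pd]
    rw [deriv_const_mul_field']
  have e : ∀ y, F t y * adjointOp ν lam g (fun _ => sinTorus n) t y
      = -(n 0 : ℝ) * (heat (ν * t) g (y 1) * F t y * cosTorus n y)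
        - ν * symbol lam n * (F t y * sinTorus n y) := fun y => by
    simp only [adjointOp, e1, e2, hs, deriv_const, symbol]
    ring
  simp_rw [e]
  rw [integral_sub, integral_const_mul, integral_const_mul]
  · ring
  · exact (integrable_mul_of_continuous hH (smoothTorus_cosTorus n).continuous).const_mul _
  · exact (integrable_mul_of_continuous hF (smoothTorus_sinTorus n).continuous).const_mul _

/-- The time derivative of the spectral density of a solution. -/
noncomputable def spectralRate (ν : ℝ) (lam : ℤ) (g : Circ → ℝ) (F : ℝ → Torus 2 → ℝ)
    (n : Fin 2 → ℤ) (t : ℝ) : ℝ :=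
  2 * n 0 * ((∫ y, F t y * cosTorus n y) * (∫ y, heat (ν * t) g (y 1) * F t y * sinTorus n y)
      - (∫ y, F t y * sinTorus n y) * ∫ y, heat (ν * t) g (y 1) * F t y * cosTorus n y)
    - 2 * ν * symbol lam n * spectral (F t) (F t) n

theorem IsDriftHeatSolution.hasDerivAt_spectral (h : IsDriftHeatSolution ν lam f g F)
    (hg : Continuous g) (n : Fin 2 → ℤ) {t : ℝ} (ht : 0 < t) :
    HasDerivAt (fun t => spectral (F t) (F t) n) (spectralRate ν lam g F n t) t := by
  have h1 := h.hasDerivAt_cos hg n ht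
  have h2 := h.hasDerivAt_sin hg n ht
  refine ((h1.fun_mul h1).fun_add (h2.fun_mul h2)).congr_deriv ?_
  unfold spectralRate spectral
  ring

theorem IsDriftHeatSolution.continuousOn_spectral (h : IsDriftHeatSolution ν lam f g F)
    (n : Fin 2 → ℤ) : ContinuousOn (fun t => spectral (F t) (F t) n) (Set.Ici 0) := by
  have h1 := h.continuousOn_pairing (smoothTorus_cosTorus n).smoothCylinder.continuous
  have h2 := h.continuousOn_pairing (smoothTorus_sinTorus n).smoothCylinder.continuous
  exact (h1.mul h1).add (h2.mul h2)

theorem IsDriftHeatSolution.continuousOn_spectralRate (h : IsDriftHeatSolution ν lam f g F)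
    (hg : Continuous g) (n : Fin 2 → ℤ) :
    ContinuousOn (spectralRate ν lam g F n) (Set.Ici 0) := by
  have h1 := h.continuousOn_pairing (smoothTorus_cosTorus n).smoothCylinder.continuous
  have h2 := h.continuousOn_pairing (smoothTorus_sinTorus n).smoothCylinder.continuous
  have hH : ∀ {ψ : Torus 2 → ℝ}, SmoothTorus ψ →
      ContinuousOn (fun t => ∫ y, heat (ν * t) g (y 1) * F t y * ψ y) (Set.Ici 0) := by
    intro ψ hψ
    have := h.continuousOn_pairing (ψ := fun t y => heat (ν * t) g (y 1) * ψ y)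
      ((continuous_heat_mul hg ν 1).mul hψ.smoothCylinder.continuous)
    refine this.congr fun t _ => integral_congr_ae (ae_of_all _ fun y => ?_)
    dsimp only
    ring
  have h3 := hH (smoothTorus_cosTorus n)
  have h4 := hH (smoothTorus_sinTorus n)
  exact (continuousOn_const.mul ((h1.mul h4).sub (h2.mul h3))).sub
    (continuousOn_const.mul (h.continuousOn_spectral n))

/-- The derivative exists only for t > 0; continuity in L² up to t = 0 lets the fundamental theorem
of calculus reach the initial datum. -/
theorem IsDriftHeatSolution.integral_spectralRate (h : IsDriftHeatSolution ν lam f g F)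
    (hg : Continuous g) (n : Fin 2 → ℤ) {T : ℝ} (hT : 0 ≤ T) :
    ∫ t in Set.Ioo 0 T, spectralRate ν lam g F n t
      = spectral (F T) (F T) n - spectral (F 0) (F 0) n := by
  rw [← integral_Ioc_eq_integral_Ioo, ← intervalIntegral.integral_of_le hT]
  refine intervalIntegral.integral_eq_sub_of_hasDerivAt_of_le hT
    ((h.continuousOn_spectral n).mono fun t ht => ht.1)
    (fun t ht => h.hasDerivAt_spectral hg n ht.1) ?_
  refine ((h.continuousOn_spectralRate hg n).mono fun t ht => ?_).intervalIntegrable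
  rw [Set.uIcc_of_le hT] at ht
  exact ht.1

/-- The frequency weights are absorbed into the coefficients of the weak gradient, which makes the
rate summable over the modes. -/
theorem spectralRate_eq {t : ℝ} {D : Fin 2 → Torus 2 → ℝ} (hD : IsWeakGradient (F t) D)
    (n : Fin 2 → ℤ) :
    spectralRate ν lam g F n t
      = -(2 * spectral (D 0) (fun y => heat (ν * t) g (y 1) * F t y) n)
        - 2 * ν * (((lam : ℝ) ^ 2 + 1) * spectral (D 0) (D 0) n + spectral (D 1) (D 1) n) := by
  unfold spectralRate spectral symbol
  rw [hD.integral_mul_cosTorus, hD.integral_mul_sinTorus, hD.integral_mul_cosTorus,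
    hD.integral_mul_sinTorus]
  ring

/-- **Energy equality** for the drift-heat equation. -/
theorem IsDriftHeatSolution.energy_eq (h : IsDriftHeatSolution ν lam f g F) (hν : 0 < ν)
    (hg : SmoothCirc g) {D : Fin 2 → ℝ → Torus 2 → ℝ} (hD : IsSpatialGradient F D) {T : ℝ}
    (hT : 0 ≤ T) :
    (∫ y, F T y * F T y)
      + 2 * ν * ∫ t in Set.Ioo 0 T, ∫ y, (((lam : ℝ) ^ 2 + 1) * (D 0 t y) ^ 2 + (D 1 t y) ^ 2)
      = ∫ y, f y * f y := by
  have hf : ∫ y, f y * f y = ∫ y, F 0 y * F 0 y := integral_congr_ae (by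
    filter_upwards [h.initial] with y hy
    rw [hy])
  rcases hT.eq_or_lt with rfl | hT
  · simp [hf]
  have hDt : ∀ᵐ t ∂(volume.restrict (Set.Ioo 0 T)), 0 < t ∧ IsWeakGradient (F t) fun i => D i t :=
    by
    refine (ae_restrict_of_ae_restrict_of_subset Set.Ioo_subset_Ioi_self hD.2).mp ?_
    refine (ae_restrict_mem measurableSet_Ioo).mono fun t ht ht' => ⟨ht.1, ht'⟩
  have hsq : ∀ {v : Torus 2 → ℝ}, ∀ y, v y * v y = v y ^ 2 := fun {v} y => (sq (v y)).symm
  set H : ℝ → Torus 2 → ℝ := fun t y => heat (ν * t) g (y 1) * F t y with hHdef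
  have hHst : MemLp (Function.uncurry H) 2 (spacetime 2 T) := by
    obtain ⟨C, -, hC⟩ := exists_bound_of_continuous hg.continuous
    refine (hD.1 T hT).1.of_le_mul (c := C)
      ((continuous_heat_mul hg.continuous ν 1).measurable.aestronglyMeasurable.mul
        (hD.1 T hT).1.1) (ae_of_all _ fun p => ?_)
    rw [Function.uncurry_def, norm_mul]
    exact mul_le_mul_of_nonneg_right (abs_heat_le hC _ _) (norm_nonneg _)
  have hint : ∀ {k : ℝ → Torus 2 → ℝ}, MemLp (Function.uncurry k) 2 (spacetime 2 T) →
      Integrable (fun t => ∫ y, k t y * k t y) (volume.restrict (Set.Ioo 0 T)) := by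
    intro k hk
    have := hk.integrable_sq.integral_prod_left
    simpa only [Function.uncurry, sq] using this
  set c : ℝ := (2 * Real.pi) ^ 2
  have hc : c ≠ 0 := by positivity
  -- The sum over modes is exchanged with the time integral. In the majorant the cross term is split
  -- between the drift product H and `D 0`, which accounts for the additional 1 in the coefficient
  -- of `D 0`.
  have key := hasSum_integral_of_dominated_convergence
    (μ := volume.restrict (Set.Ioo 0 T)) (F := spectralRate ν lam g F)
    (f := fun t => -(2 * ν * c) * ∫ y, (((lam : ℝ) ^ 2 + 1) * (D 0 t y) ^ 2 + (D 1 t y) ^ 2))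
    (fun n t => spectral (H t) (H t) n
      + (1 + 2 * ν * ((lam : ℝ) ^ 2 + 1)) * spectral (D 0 t) (D 0 t) n
      + 2 * ν * spectral (D 1 t) (D 1 t) n)
    (fun n => (((h.continuousOn_spectralRate hg.continuous n).mono
      fun t ht => (ht.1.le : (0 : ℝ) ≤ t)).aestronglyMeasurable measurableSet_Ioo))
    (fun n => ?_) ?_ ?_ ?_
  · have h1 : HasSum (fun n => ∫ t in Set.Ioo 0 T, spectralRate ν lam g F n t)
        (c * (∫ y, F T y * F T y) - c * ∫ y, F 0 y * F 0 y) := by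
      simp_rw [h.integral_spectralRate hg.continuous _ hT.le]
      exact (hasSum_spectral (h.memLp T hT.le) (h.memLp T hT.le)).sub
        (hasSum_spectral (h.memLp 0 le_rfl) (h.memLp 0 le_rfl))
    have h2 := h1.unique key
    rw [integral_const_mul] at h2
    rw [hf]
    refine mul_left_cancel₀ hc ?_
    linear_combination h2
  · filter_upwards [hDt] with t ht
    rw [spectralRate_eq ht.2]
    have h1 := abs_two_mul_spectral_le (D 0 t) (H t) n
    have h2 : 0 ≤ 2 * ν * (((lam : ℝ) ^ 2 + 1) * spectral (D 0 t) (D 0 t) n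
        + spectral (D 1 t) (D 1 t) n) := by
      have := spectral_self_nonneg (D 0 t) n
      have := spectral_self_nonneg (D 1 t) n
      positivity
    rw [Real.norm_eq_abs]
    refine (abs_sub _ _).trans ?_
    rw [abs_neg, abs_of_nonneg h2]
    linarith
  · filter_upwards [hDt] with t ht
    have hH := h.memLp_transport hg.continuous ht.1.le
    exact (((hasSum_spectral hH hH).summable).add
      ((hasSum_spectral (ht.2.2.1 0) (ht.2.2.1 0)).summable.mul_left _)).add
      ((hasSum_spectral (ht.2.2.1 1) (ht.2.2.1 1)).summable.mul_left _)
  · have hi : Integrable (fun t => c * (∫ y, H t y * H t y)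
        + (1 + 2 * ν * ((lam : ℝ) ^ 2 + 1)) * (c * ∫ y, D 0 t y * D 0 t y)
        + 2 * ν * (c * ∫ y, D 1 t y * D 1 t y)) (volume.restrict (Set.Ioo 0 T)) :=
      (((hint hHst).const_mul c).add (((hint ((hD.1 T hT).2 0)).const_mul c).const_mul _)).add
        (((hint ((hD.1 T hT).2 1)).const_mul c).const_mul _)
    refine hi.congr ?_
    filter_upwards [hDt] with t ht
    have hH := h.memLp_transport hg.continuous ht.1.le
    exact ((((hasSum_spectral hH hH)).add
      ((hasSum_spectral (ht.2.2.1 0) (ht.2.2.1 0)).mul_left _)).add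
      ((hasSum_spectral (ht.2.2.1 1) (ht.2.2.1 1)).mul_left _)).tsum_eq.symm
  · filter_upwards [hDt] with t ht
    have hH := h.memLp_transport hg.continuous ht.1.le
    -- Summed over all modes the transport contribution is zero, and only the dissipation survives.
    have h0 := ht.2.integral_transport_eq_zero (hg.heat (ν * t))
    have h1 := (((hasSum_spectral (ht.2.2.1 0) hH).mul_left 2).neg).sub
      ((((hasSum_spectral (ht.2.2.1 0) (ht.2.2.1 0)).mul_left ((lam : ℝ) ^ 2 + 1)).add
        (hasSum_spectral (ht.2.2.1 1) (ht.2.2.1 1))).mul_left (2 * ν))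
    rw [h0] at h1
    have e : ∫ y, (((lam : ℝ) ^ 2 + 1) * (D 0 t y) ^ 2 + (D 1 t y) ^ 2)
        = ((lam : ℝ) ^ 2 + 1) * (∫ y, D 0 t y * D 0 t y) + ∫ y, D 1 t y * D 1 t y := by
      rw [integral_add ((ht.2.2.1 0).integrable_sq.const_mul _) (ht.2.2.1 1).integrable_sq,
        integral_const_mul]
      simp only [sq]
    rw [e]
    convert h1 using 1
    · exact funext fun n => spectralRate_eq ht.2 n
    · ring

end Energy

/-! ### Measure-preserving shears and the reduction from three dimensions to two. -/

theorem integral_comp_measurePreserving {X Y : Type*} [MeasurableSpace X] [MeasurableSpace Y]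
    {μ : Measure X} {ρ : Measure Y} {S : X → Y} (hS : MeasurePreserving S μ ρ) {v : Y → ℝ}
    (hv : AEStronglyMeasurable v ρ) : ∫ x, v (S x) ∂μ = ∫ y, v y ∂ρ := by
  rw [← hS.map_eq] at hv ⊢
  rw [integral_map hS.aemeasurable hv]

/-- The shear `y ↦ (y_1 + k(y_2), y_2)` of the two-dimensional torus. -/
noncomputable def shear (k : Circ → Circ) (y : Torus 2) : Torus 2 := ![y 0 + k (y 1), y 1]

/-- For fixed y_2 the map is a translation in y_1, so it is a skew product over y_2; the swaps put
the base variable first. -/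
theorem measurePreserving_shear {k : Circ → Circ} (hk : Measurable k) :
    MeasurePreserving (shear k) volume volume := by
  have h1 := volume_preserving_finTwoArrow Circ
  have h2 : MeasurePreserving (fun p : Circ × Circ => (p.1, p.2 + k p.1))
      (volume.prod volume) (volume.prod volume) :=
    (MeasurePreserving.id volume).skew_product
      (measurable_snd.add (hk.comp measurable_fst))
      (ae_of_all _ fun a => (measurePreserving_add_right volume (k a)).map_eq)
  have h3 : MeasurePreserving (Prod.swap : Circ × Circ → Circ × Circ)
      (volume.prod volume) (volume.prod volume) := Measure.measurePreserving_swap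
  have h4 := (h1.symm _).comp (h3.comp (h2.comp (h3.comp h1)))
  convert h4 using 1
  ext y i
  fin_cases i <;> rfl

/-- The coordinates `(x_1, λx_1 + x_2, x_3)` on the three-dimensional torus. -/
noncomputable def shearCoord (lam : ℤ) (p : Circ × Torus 2) : Torus 3 := ![p.1, p.2 0 - lam • p.1, p.2 1]

/-- The map `x ↦ (λx_1 + x_2, x_3)`. -/
noncomputable def phase (lam : ℤ) (x : Torus 3) : Torus 2 := ![lam • x 0 + x 1, x 2]

theorem phase_shearCoord (lam : ℤ) (p : Circ × Torus 2) : phase lam (shearCoord lam p) = p.2 := by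
  ext i
  fin_cases i
  · simp [phase, shearCoord]
  · simp [phase, shearCoord]

theorem shearCoord_phase (lam : ℤ) (x : Torus 3) : shearCoord lam (x 0, phase lam x) = x := by
  ext i
  fin_cases i
  · simp [phase, shearCoord]
  · simp [phase, shearCoord]
  · simp [phase, shearCoord]

theorem continuous_phase (lam : ℤ) : Continuous (phase lam) := by
  refine continuous_pi fun i => ?_
  fin_cases i
  · exact ((continuous_zsmul lam).comp (continuous_apply 0)).add (continuous_apply 1)
  · exact continuous_apply 2

theorem continuous_shearCoord (lam : ℤ) : Continuous (shearCoord lam) := by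
  refine continuous_pi fun i => ?_
  fin_cases i
  · exact continuous_fst
  · exact ((continuous_apply 0).comp continuous_snd).sub
      ((continuous_zsmul lam).comp continuous_fst)
  · exact (continuous_apply 1).comp continuous_snd

theorem measurePreserving_shearCoord (lam : ℤ) :
    MeasurePreserving (shearCoord lam) (volume.prod volume) volume := by
  have h1 := (volume_preserving_piFinSuccAbove (fun _ : Fin 3 => Circ) 0).symm
    (MeasurableEquiv.piFinSuccAbove (fun _ : Fin 3 => Circ) 0)
  have h2 : MeasurePreserving (fun p : Circ × Torus 2 => (p.1, p.2 + ![-(lam • p.1), 0]))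
      (volume.prod volume) (volume.prod volume) := by
    refine (MeasurePreserving.id volume).skew_product
      (g := fun (a : Circ) (y : Torus 2) => y + ![-(lam • a), 0])
      (Continuous.measurable ?_)
      (ae_of_all _ fun a => (measurePreserving_add_right volume _).map_eq)
    refine continuous_snd.add (continuous_pi fun i => ?_)
    fin_cases i
    · exact ((continuous_zsmul lam).comp continuous_fst).neg
    · exact continuous_const
  have e : shearCoord lam = (MeasurableEquiv.piFinSuccAbove (fun _ : Fin 3 => Circ) 0).symm ∘
      fun p : Circ × Torus 2 => (p.1, p.2 + ![-(lam • p.1), 0]) := by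
    refine funext fun p => funext fun i => ?_
    fin_cases i
    · rfl
    · exact sub_eq_add_neg _ _
    · exact (add_zero _).symm
  rw [e]
  exact h1.comp h2

/-- The coordinates as a measurable equivalence. -/
noncomputable def shearEquiv (lam : ℤ) : Circ × Torus 2 ≃ᵐ Torus 3 where
  toFun := shearCoord lam
  invFun x := (x 0, phase lam x)
  left_inv p := Prod.ext rfl (phase_shearCoord lam p)
  right_inv x := shearCoord_phase lam x
  measurable_toFun := (continuous_shearCoord lam).measurable
  measurable_invFun := ((continuous_apply 0).prodMk (continuous_phase lam)).measurable

theorem measurePreserving_shearEquiv (lam : ℤ) :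
    MeasurePreserving (shearEquiv lam) (volume.prod volume) volume :=
  measurePreserving_shearCoord lam

theorem integral_torus3 (lam : ℤ) (v : Torus 3 → ℝ) :
    ∫ x, v x = ∫ p : Circ × Torus 2, v (shearCoord lam p) ∂(volume.prod volume) :=
  ((measurePreserving_shearEquiv lam).integral_comp' (g := v)).symm

/-- In sheared coordinates the map forgets a free circle variable, whose length is the factor 2π. -/
theorem map_phase (lam : ℤ) :
    MeasurePreserving (phase lam) volume
      (ENNReal.ofReal (2 * Real.pi) • (volume : Measure (Torus 2))) := by
  have h1 := (measurePreserving_shearEquiv lam).symm (shearEquiv lam)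
  have h2 : MeasurePreserving (Prod.snd : Circ × Torus 2 → Torus 2) (volume.prod volume)
      (ENNReal.ofReal (2 * Real.pi) • (volume : Measure (Torus 2))) :=
    ⟨measurable_snd, by rw [Measure.map_snd_prod, AddCircle.measure_univ]⟩
  exact h2.comp h1

theorem integral_comp_phase (lam : ℤ) {v : Torus 2 → ℝ} (hv : AEStronglyMeasurable v volume) :
    ∫ x, v (phase lam x) = 2 * Real.pi * ∫ y, v y := by
  rw [integral_comp_measurePreserving (map_phase lam) (hv.smul_measure _), integral_smul_measure,
    ENNReal.toReal_ofReal Real.two_pi_pos.le, smul_eq_mul]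

theorem memLp_comp_phase (lam : ℤ) {v : Torus 2 → ℝ} {p : ENNReal} (hv : MemLp v p volume) :
    MemLp (fun x => v (phase lam x)) p volume :=
  (hv.smul_measure ENNReal.ofReal_ne_top).comp_measurePreserving (map_phase lam)

/-- The solution `ψ(y_1 + t g(y_2), y_2)` of the transport equation. -/
noncomputable def transport (g : Circ → ℝ) (ψ : Torus 2 → ℝ) (t : ℝ) (y : Torus 2) : ℝ :=
  ψ (shear (fun a => ((t * g a : ℝ) : Circ)) y)

theorem measurePreserving_transport {g : Circ → ℝ} (hg : Continuous g) (t : ℝ) :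
    MeasurePreserving (shear fun a => ((t * g a : ℝ) : Circ)) volume volume :=
  measurePreserving_shear ((AddCircle.continuous_mk' _).comp (continuous_const.mul hg)).measurable

theorem memLp_transport {g : Circ → ℝ} (hg : Continuous g) {ψ : Torus 2 → ℝ} {p : ENNReal}
    (hψ : MemLp ψ p volume) (t : ℝ) : MemLp (transport g ψ t) p volume :=
  hψ.comp_measurePreserving (measurePreserving_transport hg t)

theorem integral_transport {g : Circ → ℝ} (hg : Continuous g) {ψ : Torus 2 → ℝ}
    (hψ : AEStronglyMeasurable ψ volume) (t : ℝ) : ∫ y, transport g ψ t y = ∫ y, ψ y :=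
  integral_comp_measurePreserving (measurePreserving_transport hg t) hψ

theorem smoothCylinder_transport {g : Circ → ℝ} (hg : SmoothCirc g) {ψ : Torus 2 → ℝ}
    (hψ : SmoothTorus ψ) : SmoothCylinder (transport g ψ) := by
  have e : ∀ p : ℝ × (Fin 2 → ℝ), transport g ψ p.1 (proj p.2)
      = ψ (proj ![p.2 0 + p.1 * g (p.2 1 : Circ), p.2 1]) := fun p => by
    unfold transport shear
    congr 1
    ext i
    fin_cases i
    · simp
    · simp
  unfold SmoothCylinder
  simp_rw [e]
  have h1 : ContDiff ℝ ∞ fun p : ℝ × (Fin 2 → ℝ) =>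
      (![p.2 0 + p.1 * g (p.2 1 : Circ), p.2 1] : Fin 2 → ℝ) := by
    have hc : ∀ i : Fin 2, ContDiff ℝ ∞ fun p : ℝ × (Fin 2 → ℝ) => p.2 i := fun i =>
      (contDiff_apply ℝ ℝ i).comp contDiff_snd
    rw [contDiff_pi]
    intro i
    fin_cases i
    · exact (hc 0).add (contDiff_fst.mul
        (ContDiff.comp (g := fun z : ℝ => g (z : Circ)) hg (hc 1)))
    · exact hc 1
  exact ContDiff.comp (g := fun z : Fin 2 → ℝ => ψ (proj z)) hψ h1

theorem shear_add_single (k : Circ → Circ) (y : Torus 2) (a : Circ) :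
    shear k (y + Pi.single 0 a) = shear k y + Pi.single 0 a := by
  ext i
  fin_cases i
  · simp [shear, add_right_comm]
  · simp [shear]

theorem pd_zero_transport (g : Circ → ℝ) (ψ : Torus 2 → ℝ) (t : ℝ) :
    pd 0 (transport g ψ t) = transport g (pd 0 ψ) t := by
  ext y
  simp [pd, transport, shear_add_single]

/-- At fixed y the point at which ψ is evaluated moves on a line in the first direction with speed
g(y_2). Together with `pd_zero_transport` this is the inviscid transport equation. -/
theorem deriv_transport {g : Circ → ℝ} {ψ : Torus 2 → ℝ} (hψ : SmoothTorus ψ) (t : ℝ)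
    (y : Torus 2) :
    deriv (fun s => transport g ψ s y) t = g (y 1) * transport g (pd 0 ψ) t y := by
  have e : ∀ s, transport g ψ s y = ψ (y + proj (s • Pi.single 0 (g (y 1)))) := fun s => by
    unfold transport shear
    congr 1
    ext i
    fin_cases i
    · simp
    · simp
  have e' : transport g (pd 0 ψ) t y = pd 0 ψ (y + proj (t • Pi.single 0 (g (y 1)))) := by
    unfold transport shear
    congr 1
    ext i
    fin_cases i
    · simp
    · simp
  simp_rw [e, e']
  rw [(hψ.hasDerivAt_line y (Pi.single 0 (g (y 1))) t).deriv]
  simp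

/-! ### The inviscid limit of the profiles. -/

section InviscidLimit

variable {ν : ℝ} {lam : ℤ} {f : Torus 2 → ℝ} {g : Circ → ℝ} {F : ℝ → Torus 2 → ℝ}

theorem memLp_fun_sub {X : Type*} [MeasurableSpace X] {μ : Measure X} {a b : X → ℝ} {p : ENNReal}
    (ha : MemLp a p μ) (hb : MemLp b p μ) : MemLp (fun x => a x - b x) p μ := ha.sub hb

theorem integrable_fun_mul {X : Type*} [MeasurableSpace X] {μ : Measure X} {a b : X → ℝ}
    (ha : MemLp a 2 μ) (hb : MemLp b 2 μ) : Integrable (fun x => a x * b x) μ :=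
  ha.integrable_mul hb

/-- The weight matters: when b has L² norm at most δ, both terms are of order δ. -/
theorem integral_abs_mul_le {X : Type*} [MeasurableSpace X] {μ : Measure X} {a b : X → ℝ}
    (ha : MemLp a 2 μ) (hb : MemLp b 2 μ) {δ : ℝ} (hδ : 0 < δ) :
    |∫ x, a x * b x ∂μ| ≤ δ * (∫ x, a x ^ 2 ∂μ) + δ⁻¹ * ∫ x, b x ^ 2 ∂μ := by
  rw [← integral_const_mul, ← integral_const_mul,
    ← integral_add (ha.integrable_sq.const_mul _) (hb.integrable_sq.const_mul _)]
  refine (abs_integral_le_integral_abs).trans ?_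
  refine integral_mono_of_nonneg (ae_of_all _ fun x => abs_nonneg _)
    ((ha.integrable_sq.const_mul _).add (hb.integrable_sq.const_mul _)) (ae_of_all _ fun x => ?_)
  have h1 : δ * δ⁻¹ = 1 := mul_inv_cancel₀ hδ.ne'
  have h2 : 0 < δ⁻¹ := inv_pos.2 hδ
  have h3 : δ * a x ^ 2 + δ⁻¹ * b x ^ 2 - 2 * |a x * b x| = δ⁻¹ * (δ * |a x| - |b x|) ^ 2 := by
    rw [abs_mul]
    have h4 : a x ^ 2 = |a x| ^ 2 := (sq_abs _).symm
    have h5 : b x ^ 2 = |b x| ^ 2 := (sq_abs _).symm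
    rw [h4, h5]
    linear_combination (2 * |a x| * |b x| - δ * |a x| ^ 2) * h1
  have h6 : 0 ≤ δ⁻¹ * (δ * |a x| - |b x|) ^ 2 := by positivity
  have h7 := abs_nonneg (a x * b x)
  dsimp only
  linarith

theorem eLpNorm_two_eq {X : Type*} [MeasurableSpace X] {μ : Measure X} {v : X → ℝ}
    (hv : MemLp v 2 μ) : eLpNorm v 2 μ = ENNReal.ofReal (Real.sqrt (∫ x, v x ^ 2 ∂μ)) := by
  rw [hv.eLpNorm_eq_integral_rpow_norm (by simp) (by simp), Real.sqrt_eq_rpow]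
  simp

theorem exists_smooth_integral_sq_sub_le {d : ℕ} {v : Torus d → ℝ} (hv : MemLp v 2 volume)
    {δ : ℝ} (hδ : 0 < δ) : ∃ φ, SmoothTorus φ ∧ ∫ x, (v x - φ x) ^ 2 ≤ δ ^ 2 := by
  obtain ⟨φ, hφ, hlt⟩ := exists_smooth_eLpNorm_sub_lt hv (ENNReal.ofReal_pos.2 hδ)
  have hm : MemLp φ 2 volume := by
    obtain ⟨C, -, hC⟩ := exists_bound_of_continuous hφ.continuous
    exact MemLp.of_bound hφ.continuous.measurable.aestronglyMeasurable C (ae_of_all _ hC)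
  refine ⟨φ, hφ, ?_⟩
  rw [eLpNorm_two_eq (memLp_fun_sub hv hm), ENNReal.ofReal_lt_ofReal_iff hδ] at hlt
  exact ((Real.sqrt_lt' hδ).1 hlt).le

theorem SmoothTorus.memLp {d : ℕ} {φ : Torus d → ℝ} (hφ : SmoothTorus φ) (p : ENNReal) :
    MemLp φ p volume := by
  obtain ⟨C, -, hC⟩ := exists_bound_of_continuous hφ.continuous
  exact MemLp.of_bound hφ.continuous.measurable.aestronglyMeasurable C (ae_of_all _ hC)

theorem IsDriftHeatSolution.integral_sq_le (h : IsDriftHeatSolution ν lam f g F) (hν : 0 < ν)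
    (hg : SmoothCirc g) {t : ℝ} (ht : 0 ≤ t) : ∫ y, F t y ^ 2 ≤ ∫ y, f y ^ 2 := by
  obtain ⟨D, hD⟩ := h.gradient
  have h1 := h.energy_eq hν hg hD ht
  have h2 : 0 ≤ 2 * ν * ∫ t in Set.Ioo 0 t, ∫ y,
      (((lam : ℝ) ^ 2 + 1) * (D 0 t y) ^ 2 + (D 1 t y) ^ 2) :=
    mul_nonneg (by positivity) (integral_nonneg fun t => integral_nonneg fun y => by positivity)
  simp only [← sq] at h1
  linarith

/-- The time derivative cancels the drift up to the heat-flow error of g; with the viscous term this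
is all that survives as ν → 0. -/
theorem adjointOp_transport {ψ : Torus 2 → ℝ}
    (hψ : SmoothTorus ψ) (t : ℝ) (y : Torus 2) :
    adjointOp ν lam g (transport g ψ) t y
      = (g (y 1) - heat (ν * t) g (y 1)) * transport g (pd 0 ψ) t y
        + ν * (((lam : ℝ) ^ 2 + 1) * pd 0 (pd 0 (transport g ψ t)) y
          + pd 1 (pd 1 (transport g ψ t)) y) := by
  rw [adjointOp, deriv_transport hψ, pd_zero_transport]
  ring

theorem exists_abs_adjointOp_transport_le (lam : ℤ) (hg : SmoothCirc g) {ψ : Torus 2 → ℝ}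
    (hψ : SmoothTorus ψ) (T : ℝ) :
    ∃ C, 0 ≤ C ∧ ∀ ν, 0 < ν → ∀ t ∈ Set.Icc 0 T, ∀ y,
      |adjointOp ν lam g (transport g ψ) t y| ≤ C * (Real.sqrt ν + ν) := by
  obtain ⟨K, hK, hKb⟩ := hg.exists_heat_sub_le
  obtain ⟨C₁, hC₁, hb₁⟩ := exists_bound_of_continuous (hψ.pd 0).continuous
  have hφ := smoothCylinder_transport hg hψ
  have hc : Continuous fun p : ℝ × Torus 2 =>
      (((lam : ℝ) ^ 2 + 1) * pd 0 (pd 0 (transport g ψ p.1)) p.2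
          + pd 1 (pd 1 (transport g ψ p.1)) p.2) :=
    (continuous_const.mul ((hφ.pd 0).pd 0).continuous).add ((hφ.pd 1).pd 1).continuous
  obtain ⟨C₂, hb₂⟩ := ((isCompact_Icc (a := (0 : ℝ)) (b := T)).prod
    (isCompact_univ (X := Torus 2))).exists_bound_of_continuousOn hc.continuousOn
  refine ⟨max (K * Real.sqrt T * C₁) C₂, le_max_of_le_left (by positivity),
    fun ν hν t ht y => ?_⟩
  rw [adjointOp_transport hψ]
  have h1 : |g (y 1) - heat (ν * t) g (y 1)| ≤ K * (Real.sqrt ν * Real.sqrt T) := by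
    rw [abs_sub_comm]
    refine (hKb _ _).trans (mul_le_mul_of_nonneg_left ?_ hK)
    rw [Real.sqrt_mul hν.le]
    exact mul_le_mul_of_nonneg_left (Real.sqrt_le_sqrt ht.2) (Real.sqrt_nonneg _)
  have h2 : |transport g (pd 0 ψ) t y| ≤ C₁ := hb₁ _
  have h3 := hb₂ (t, y) ⟨ht, trivial⟩
  rw [Real.norm_eq_abs] at h3
  refine (abs_add_le _ _).trans ?_
  rw [abs_mul, abs_mul, abs_of_pos hν]
  calc _ ≤ K * (Real.sqrt ν * Real.sqrt T) * C₁ + ν * C₂ :=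
        add_le_add (mul_le_mul h1 h2 (abs_nonneg _) (by positivity))
          (mul_le_mul_of_nonneg_left h3 hν.le)
    _ = (K * Real.sqrt T * C₁) * Real.sqrt ν + C₂ * ν := by ring
    _ ≤ _ := by
        rw [mul_add]
        exact add_le_add
          (mul_le_mul_of_nonneg_right (le_max_left _ _) (Real.sqrt_nonneg _))
          (mul_le_mul_of_nonneg_right (le_max_right _ _) hν.le)

/-- The time derivative of the pairing is the pairing of F with the adjoint operator, and the L¹
norm of F is controlled by the energy uniformly in ν and t. -/
theorem IsDriftHeatSolution.abs_pairing_sub_le (h : IsDriftHeatSolution ν lam f g F) (hν : 0 < ν)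
    (hg : SmoothCirc g) {φ : ℝ → Torus 2 → ℝ} (hφ : SmoothCylinder φ) {T B : ℝ} (hT : 0 ≤ T)
    (hB : ∀ t ∈ Set.Icc 0 T, ∀ y, |adjointOp ν lam g φ t y| ≤ B) :
    |(∫ y, F T y * φ T y) - ∫ y, f y * φ 0 y|
      ≤ B * ((∫ y, f y ^ 2) + volume.real (Set.univ : Set (Torus 2))) * T := by
  have hf : ∫ y, f y * φ 0 y = ∫ y, F 0 y * φ 0 y := integral_congr_ae (by
    filter_upwards [h.initial] with y hy
    rw [hy])
  rw [hf]
  have hBc := h.continuousOn_pairing (continuous_adjointOp (ν := ν) (lam := lam) hg.continuous hφ)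
  rw [← intervalIntegral.integral_eq_sub_of_hasDerivAt_of_le hT
    ((h.continuousOn_pairing hφ.continuous).mono fun t ht => ht.1)
    (fun t ht => h.hasDerivAt_pairing hg.continuous hφ ht.1)
    ((hBc.mono fun t ht => by
      rw [Set.uIcc_of_le hT] at ht
      exact ht.1).intervalIntegrable)]
  have := intervalIntegral.norm_integral_le_of_norm_le_const (a := 0) (b := T)
    (C := B * ((∫ y, f y ^ 2) + volume.real (Set.univ : Set (Torus 2))))
    (f := fun t => ∫ y, F t y * adjointOp ν lam g φ t y) fun t ht => ?_
  · rwa [sub_zero, abs_of_nonneg hT, Real.norm_eq_abs] at this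
  · rw [Set.uIoc_of_le hT] at ht
    have hF := h.memLp t ht.1.le
    have hB0 : 0 ≤ B := (abs_nonneg _).trans (hB t ⟨ht.1.le, ht.2⟩ 0)
    refine (norm_integral_le_integral_norm _).trans ?_
    calc ∫ y, ‖F t y * adjointOp ν lam g φ t y‖ ≤ ∫ y, B * (F t y ^ 2 + 1) := by
          refine integral_mono_of_nonneg (ae_of_all _ fun y => norm_nonneg _)
            ((hF.integrable_sq.add (integrable_const _)).const_mul _) (ae_of_all _ fun y => ?_)
          dsimp only
          rw [norm_mul, mul_comm, Real.norm_eq_abs, Real.norm_eq_abs]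
          refine mul_le_mul (hB t ⟨ht.1.le, ht.2⟩ y) ?_ (abs_nonneg _) hB0
          rw [← sq_abs]
          -- The bound |F| ≤ F² + 1 stands in for the Cauchy–Schwarz inequality.
          nlinarith [sq_nonneg (|F t y| - 1), abs_nonneg (F t y)]
      _ = B * ((∫ y, F t y ^ 2) + volume.real (Set.univ : Set (Torus 2))) := by
          rw [integral_const_mul, integral_add hF.integrable_sq (integrable_const _)]
          simp
      _ ≤ _ := by
          refine mul_le_mul_of_nonneg_left ?_ hB0
          have := h.integral_sq_le hν hg ht.1.le
          linarith

/-- Weak convergence of the solutions tested against the inviscid solution. -/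
theorem tendsto_integral_mul_transport (hf : MemLp f 2 volume) (hg : SmoothCirc g)
    {F : ℝ → ℝ → Torus 2 → ℝ} (hF : ∀ ν, 0 < ν → IsDriftHeatSolution ν lam f g (F ν)) {t : ℝ}
    (ht : 0 ≤ t) :
    Tendsto (fun ν => ∫ y, F ν t y * transport g f t y) (𝓝[>] 0) (𝓝 (∫ y, f y ^ 2)) := by
  rw [Metric.tendsto_nhds]
  intro ε hε
  set E := ∫ y, f y ^ 2
  have hE : 0 ≤ E := integral_nonneg fun y => sq_nonneg _
  -- Error budget: replacing f by φ costs δE + δ in the pairing with F and again in the pairing with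
  -- f, and the drift of the pairing in time costs δ.
  obtain ⟨δ, hδ, hδε⟩ : ∃ δ : ℝ, 0 < δ ∧ δ * (2 * E + 3) < ε :=
    ⟨ε / (2 * E + 3) / 2, by positivity, by
      field_simp
      linarith⟩
  obtain ⟨φ, hφ, hle⟩ := exists_smooth_integral_sq_sub_le hf hδ
  obtain ⟨C, hC, hCb⟩ := exists_abs_adjointOp_transport_le lam hg hφ t
  set M := E + volume.real (Set.univ : Set (Torus 2))
  have hlim : Tendsto (fun ν : ℝ => C * (Real.sqrt ν + ν) * M * t) (𝓝[>] 0) (𝓝 0) := by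
    have : Continuous fun ν : ℝ => C * (Real.sqrt ν + ν) * M * t := by fun_prop
    simpa using (this.tendsto 0).mono_left nhdsWithin_le_nhds
  filter_upwards [self_mem_nhdsWithin, hlim.eventually (gt_mem_nhds hδ)] with ν hν hsmall
  replace hν : 0 < ν := hν
  have h := hF ν hν
  have hFt := h.memLp t ht
  have hφm := hφ.memLp 2
  have hd : MemLp (fun y => f y - φ y) 2 volume := memLp_fun_sub hf hφm
  have hφt : MemLp (transport g φ t) 2 volume := memLp_transport hg.continuous hφm t
  have hft : MemLp (transport g f t) 2 volume := memLp_transport hg.continuous hf t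
  have hdt := memLp_transport hg.continuous hd t
  have h1 := h.abs_pairing_sub_le hν hg (smoothCylinder_transport hg hφ) ht (hCb ν hν)
  have h2 := integral_abs_mul_le hFt hdt hδ
  have h3 := integral_abs_mul_le hf hd hδ
  have e2 : ∫ y, F ν t y * transport g (fun y => f y - φ y) t y
      = (∫ y, F ν t y * transport g f t y) - ∫ y, F ν t y * transport g φ t y := by
    rw [← integral_sub (integrable_fun_mul hFt hft) (integrable_fun_mul hFt hφt)]
    refine integral_congr_ae (ae_of_all _ fun y => ?_)
    simp only [transport]
    ring
  have e3 : ∫ y, f y * (f y - φ y) = E - ∫ y, f y * φ y := by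
    simp only [E]
    rw [← integral_sub hf.integrable_sq (integrable_fun_mul hf hφm)]
    refine integral_congr_ae (ae_of_all _ fun y => ?_)
    dsimp only
    ring
  have e4 : ∫ y, transport g (fun y => f y - φ y) t y ^ 2 = ∫ y, (f y - φ y) ^ 2 :=
    integral_transport (ψ := fun y => (f y - φ y) ^ 2) hg.continuous (hd.1.pow 2) t
  have e5 : transport g φ 0 = φ := by
    ext y
    unfold transport shear
    congr 1
    ext i
    fin_cases i
    · simp
    · simp
  have h4 : δ⁻¹ * ∫ y, (f y - φ y) ^ 2 ≤ δ := by
    calc _ ≤ δ⁻¹ * δ ^ 2 := mul_le_mul_of_nonneg_left hle (inv_nonneg.2 hδ.le)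
      _ = δ := by field_simp
  have h5 : δ * ∫ y, F ν t y ^ 2 ≤ δ * E :=
    mul_le_mul_of_nonneg_left (h.integral_sq_le hν hg ht) hδ.le
  rw [e5] at h1
  rw [e2, e4] at h2
  rw [e3] at h3
  have h6 : |(∫ y, F ν t y * transport g φ t y) - ∫ y, f y * φ y| ≤ δ := h1.trans hsmall.le
  rw [Real.dist_eq]
  rw [abs_le] at h2 h3 h6
  refine lt_of_le_of_lt ?_ hδε
  rw [abs_le]
  constructor <;> linarith [h2.1, h2.2, h3.1, h3.2, h6.1, h6.2]

/-- A squeeze: 2⟨F, f_t⟩ - ‖f‖² ≤ ‖F‖² because (F - f_t)² is nonnegative, and ‖F‖² ≤ ‖f‖² by the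
energy equality. -/
theorem tendsto_integral_sq (hf : MemLp f 2 volume) (hg : SmoothCirc g)
    {F : ℝ → ℝ → Torus 2 → ℝ} (hF : ∀ ν, 0 < ν → IsDriftHeatSolution ν lam f g (F ν)) {t : ℝ}
    (ht : 0 ≤ t) :
    Tendsto (fun ν => ∫ y, F ν t y ^ 2) (𝓝[>] 0) (𝓝 (∫ y, f y ^ 2)) := by
  have h1 := tendsto_integral_mul_transport hf hg hF ht
  have h2 : Tendsto (fun ν => 2 * (∫ y, F ν t y * transport g f t y) - ∫ y, f y ^ 2) (𝓝[>] 0)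
      (𝓝 (∫ y, f y ^ 2)) := by
    convert (h1.const_mul 2).sub_const (∫ y, f y ^ 2) using 2
    ring
  refine tendsto_of_tendsto_of_tendsto_of_le_of_le' h2 tendsto_const_nhds ?_ ?_
  · filter_upwards [self_mem_nhdsWithin] with ν hν
    have hFt := (hF ν hν).memLp t ht
    have hft := memLp_transport hg.continuous hf t
    have e4 : ∫ y, transport g f t y ^ 2 = ∫ y, f y ^ 2 :=
      integral_transport (ψ := fun y => f y ^ 2) hg.continuous (hf.1.pow 2) t
    rw [← e4, ← integral_const_mul,
      ← integral_sub ((integrable_fun_mul hFt hft).const_mul 2) hft.integrable_sq]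
    refine integral_mono (((integrable_fun_mul hFt hft).const_mul 2).sub hft.integrable_sq)
      hFt.integrable_sq fun y => ?_
    have := sq_nonneg (F ν t y - transport g f t y)
    linarith
  · filter_upwards [self_mem_nhdsWithin] with ν hν
    exact (hF ν hν).integral_sq_le hν hg ht

/-- Strong convergence to the inviscid solution. -/
theorem tendsto_eLpNorm_sub_transport (hf : MemLp f 2 volume) (hg : SmoothCirc g)
    {F : ℝ → ℝ → Torus 2 → ℝ} (hF : ∀ ν, 0 < ν → IsDriftHeatSolution ν lam f g (F ν)) {t : ℝ}
    (ht : 0 ≤ t) :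
    Tendsto (fun ν => eLpNorm (fun y => F ν t y - transport g f t y) 2 volume) (𝓝[>] 0)
      (𝓝 0) := by
  have h1 := tendsto_integral_mul_transport hf hg hF ht
  have h2 := tendsto_integral_sq hf hg hF ht
  have hft := memLp_transport hg.continuous hf t
  have e4 : ∫ y, transport g f t y ^ 2 = ∫ y, f y ^ 2 :=
    integral_transport (ψ := fun y => f y ^ 2) hg.continuous (hf.1.pow 2) t
  have h3 : Tendsto (fun ν => (∫ y, F ν t y ^ 2) - 2 * (∫ y, F ν t y * transport g f t y)
      + ∫ y, f y ^ 2) (𝓝[>] 0) (𝓝 0) := by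
    convert (h2.sub (h1.const_mul 2)).add_const (∫ y, f y ^ 2) using 2
    ring
  have h4 := (ENNReal.continuous_ofReal.comp Real.continuous_sqrt).tendsto 0 |>.comp h3
  simp only [Function.comp_apply, Real.sqrt_zero, ENNReal.ofReal_zero] at h4
  refine h4.congr' ?_
  filter_upwards [self_mem_nhdsWithin] with ν hν
  have hFt := (hF ν hν).memLp t ht
  rw [eLpNorm_two_eq (memLp_fun_sub hFt hft)]
  simp only [Function.comp_apply]
  congr 2
  have hi : Integrable (fun y => F ν t y ^ 2 - 2 * (F ν t y * transport g f t y)) volume :=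
    hFt.integrable_sq.sub ((integrable_fun_mul hFt hft).const_mul 2)
  rw [← e4, ← integral_const_mul, ← integral_sub hFt.integrable_sq
    ((integrable_fun_mul hFt hft).const_mul 2), ← integral_add hi hft.integrable_sq]
  refine integral_congr_ae (ae_of_all _ fun y => ?_)
  dsimp only
  ring

end InviscidLimit

/-! ### From profiles to velocity fields: convergence of the flows. -/

theorem norm_vec_le (a b : ℝ) : ‖(!₂[a, b, 0] : EuclideanSpace ℝ (Fin 3))‖ ≤ |a| + |b| := by
  rw [EuclideanSpace.norm_eq, Real.sqrt_le_left (by positivity)]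
  simp only [Fin.sum_univ_three, Real.norm_eq_abs]
  simp
  nlinarith [sq_abs a, sq_abs b, mul_nonneg (abs_nonneg a) (abs_nonneg b)]

theorem memLp_vec {X : Type*} [MeasurableSpace X] {μ : Measure X} {p : ENNReal} {a b : X → ℝ}
    (ha : MemLp a p μ) (hb : MemLp b p μ) :
    MemLp (fun x => (!₂[a x, b x, 0] : EuclideanSpace ℝ (Fin 3))) p μ := by
  refine MemLp.of_eval_piLp fun i => ?_
  fin_cases i
  · exact ha
  · exact hb
  · exact MemLp.zero'

theorem uNS_eq (ν : ℝ) (lam : ℤ) (g : Circ → ℝ) (F : ℝ → Torus 2 → ℝ) (t : ℝ) (x : Torus 3) :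
    uNS ν lam g F t x = !₂[F t (phase lam x),
      -(lam : ℝ) * F t (phase lam x) - heat (ν * t) g (x 2), 0] := rfl

theorem uEuler_eq (lam : ℤ) (f : Torus 2 → ℝ) (g : Circ → ℝ) (t : ℝ) (x : Torus 3) :
    uEuler lam f g t x = !₂[transport g f t (phase lam x),
      -(lam : ℝ) * transport g f t (phase lam x) - g (x 2), 0] := rfl

theorem memLp_of_continuous {X : Type*} [TopologicalSpace X] [CompactSpace X]
    [MeasurableSpace X] [OpensMeasurableSpace X] {μ : Measure X} [IsFiniteMeasure μ] {ψ : X → ℝ}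
    (hψ : Continuous ψ) (p : ENNReal) : MemLp ψ p μ := by
  obtain ⟨C, -, hC⟩ := exists_bound_of_continuous hψ
  exact MemLp.of_bound hψ.measurable.aestronglyMeasurable C (ae_of_all _ hC)

instance isFiniteMeasure_spacetime (d : ℕ) (T : ℝ) : IsFiniteMeasure (spacetime d T) := by
  unfold spacetime
  infer_instance

theorem memLp_comp_phase_spacetime (lam : ℤ) {v : ℝ → Torus 2 → ℝ} {p : ENNReal} {T : ℝ}
    (hv : MemLp (Function.uncurry v) p (spacetime 2 T)) :
    MemLp (fun q : ℝ × Torus 3 => v q.1 (phase lam q.2)) p (spacetime 3 T) := by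
  have h1 := (MeasurePreserving.id (volume.restrict (Set.Ioo 0 T))).prod (map_phase lam)
  have h2 : MemLp (Function.uncurry v) p ((volume.restrict (Set.Ioo 0 T)).prod
      (ENNReal.ofReal (2 * Real.pi) • (volume : Measure (Torus 2)))) := by
    rw [Measure.prod_smul_right]
    exact hv.smul_measure ENNReal.ofReal_ne_top
  exact h2.comp_measurePreserving h1

/-- The time-dependent shear, as a map of space-time, preserves the product measure; this settles
joint measurability as well as the norm. -/
theorem memLp_transport_spacetime {g : Circ → ℝ} (hg : Continuous g) {f : Torus 2 → ℝ}
    {p : ENNReal} (hf : MemLp f p volume) (T : ℝ) :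
    MemLp (Function.uncurry (transport g f)) p (spacetime 2 T) := by
  have h1 : MeasurePreserving
      (fun q : ℝ × Torus 2 => (q.1, shear (fun a => ((q.1 * g a : ℝ) : Circ)) q.2))
      (spacetime 2 T) (spacetime 2 T) := by
    refine (MeasurePreserving.id _).skew_product
      (g := fun (t : ℝ) y => shear (fun a => ((t * g a : ℝ) : Circ)) y) (Continuous.measurable ?_)
      (ae_of_all _ fun t => (measurePreserving_transport hg t).map_eq)
    refine continuous_pi fun i => ?_
    fin_cases i
    · exact ((continuous_apply 0).comp continuous_snd).add ((AddCircle.continuous_mk' _).comp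
        (continuous_fst.mul (hg.comp ((continuous_apply 1).comp continuous_snd))))
    · have h : Continuous fun q : ℝ × Torus 2 => q.2 1 := (continuous_apply 1).comp continuous_snd
      exact h
  have h2 : MemLp (fun q : ℝ × Torus 2 => f q.2) p (spacetime 2 T) := hf.comp_snd _
  exact h2.comp_measurePreserving h1

theorem memLp_heat_spacetime {g : Circ → ℝ} (hg : Continuous g) (ν T : ℝ) (p : ENNReal) :
    MemLp (fun q : ℝ × Torus 3 => heat (ν * q.1) g (q.2 2)) p (spacetime 3 T) := by
  obtain ⟨C, -, hC⟩ := exists_bound_of_continuous hg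
  exact MemLp.of_bound (continuous_heat_mul hg ν 2).measurable.aestronglyMeasurable C
    (ae_of_all _ fun q => abs_heat_le hC _ _)

theorem memLp_uNS_spacetime {ν : ℝ} {lam : ℤ} {g : Circ → ℝ} (hg : Continuous g)
    {F : ℝ → Torus 2 → ℝ} {T : ℝ} (hF : MemLp (Function.uncurry F) 2 (spacetime 2 T)) :
    MemLp (Function.uncurry (uNS ν lam g F)) 2 (spacetime 3 T) := by
  have h1 := memLp_comp_phase_spacetime lam hF
  exact memLp_vec h1 ((h1.const_mul (-(lam : ℝ))).sub (memLp_heat_spacetime hg ν T 2))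

theorem memLp_uNS {ν : ℝ} {lam : ℤ} {g : Circ → ℝ} (hg : Continuous g)
    {F : ℝ → Torus 2 → ℝ} {t : ℝ} (hF : MemLp (F t) 2 volume) :
    MemLp (uNS ν lam g F t) 2 volume := by
  have h1 := memLp_comp_phase lam hF
  exact memLp_vec h1 ((h1.const_mul (-(lam : ℝ))).sub
    (memLp_of_continuous (ψ := fun x : Torus 3 => heat (ν * t) g (x 2))
      ((continuous_heat hg _).comp (continuous_apply 2)) 2))

theorem memLp_uEuler_spacetime (lam : ℤ) {g : Circ → ℝ} (hg : Continuous g)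
    {f : Torus 2 → ℝ} {p : ENNReal} (hf : MemLp f p volume) (T : ℝ) :
    MemLp (Function.uncurry (uEuler lam f g)) p (spacetime 3 T) := by
  have h1 := memLp_comp_phase_spacetime lam (memLp_transport_spacetime hg hf T)
  have h2 : MemLp (fun q : ℝ × Torus 3 => g (q.2 2)) p (spacetime 3 T) :=
    (memLp_of_continuous (ψ := fun x : Torus 3 => g (x 2))
      (hg.comp (continuous_apply 2)) p).comp_snd _
  exact memLp_vec h1 ((h1.const_mul (-(lam : ℝ))).sub h2)

theorem memLp_uEuler (lam : ℤ) {g : Circ → ℝ} (hg : Continuous g)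
    {f : Torus 2 → ℝ} {p : ENNReal} (hf : MemLp f p volume) (t : ℝ) :
    MemLp (uEuler lam f g t) p volume := by
  have h1 := memLp_comp_phase lam (memLp_transport hg hf t)
  exact memLp_vec h1 ((h1.const_mul (-(lam : ℝ))).sub
    (memLp_of_continuous (ψ := fun x : Torus 3 => g (x 2)) (hg.comp (continuous_apply 2)) p))

theorem eLpNorm_comp_phase (lam : ℤ) {v : Torus 2 → ℝ} (hv : AEStronglyMeasurable v volume) :
    eLpNorm (fun x => v (phase lam x)) 2 volume
      = ENNReal.ofReal (2 * Real.pi) ^ (1 / 2 : ℝ) * eLpNorm v 2 volume := by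
  have h := eLpNorm_comp_measurePreserving (p := 2) (hv.smul_measure _) (map_phase lam)
  rw [eLpNorm_smul_measure_of_ne_top (by simp)] at h
  simpa [Function.comp_def] using h

/-- The difference of the two shear flows is controlled by the difference of the profiles. -/
theorem eLpNorm_uNS_sub_uEuler_le {ν : ℝ} {lam : ℤ} {f : Torus 2 → ℝ} {g : Circ → ℝ}
    {F : ℝ → Torus 2 → ℝ} {t B : ℝ}
    (hd : AEStronglyMeasurable (fun y => F t y - transport g f t y) volume)
    (hB : ∀ x, |heat (ν * t) g x - g x| ≤ B) :
    eLpNorm (fun x => uNS ν lam g F t x - uEuler lam f g t x) 2 volume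
      ≤ ENNReal.ofReal (1 + |(lam : ℝ)|) * (ENNReal.ofReal (2 * Real.pi) ^ (1 / 2 : ℝ)
          * eLpNorm (fun y => F t y - transport g f t y) 2 volume)
        + ENNReal.ofReal B * volume (Set.univ : Set (Torus 3)) ^ (1 / 2 : ℝ) := by
  have hB0 : 0 ≤ B := (abs_nonneg _).trans (hB 0)
  have hm : AEStronglyMeasurable (fun x => F t (phase lam x) - transport g f t (phase lam x))
      (volume : Measure (Torus 3)) :=
    (hd.smul_measure _).comp_measurePreserving (map_phase lam)
  calc eLpNorm (fun x => uNS ν lam g F t x - uEuler lam f g t x) 2 volume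
      ≤ eLpNorm (fun x => (1 + |(lam : ℝ)|) * |F t (phase lam x) - transport g f t (phase lam x)|
          + B) 2 volume := by
        refine eLpNorm_mono_real fun x => ?_
        have e : uNS ν lam g F t x - uEuler lam f g t x
            = !₂[F t (phase lam x) - transport g f t (phase lam x),
              -(lam : ℝ) * (F t (phase lam x) - transport g f t (phase lam x))
                - (heat (ν * t) g (x 2) - g (x 2)), 0] := by
          rw [uNS_eq, uEuler_eq]
          ext i
          fin_cases i
          · simp
          · simp
            ring
          · simp
        rw [e]
        refine (norm_vec_le _ _).trans ?_
        have h1 := abs_sub (-(lam : ℝ) * (F t (phase lam x) - transport g f t (phase lam x)))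
          (heat (ν * t) g (x 2) - g (x 2))
        rw [abs_mul, abs_neg] at h1
        have h2 := hB (x 2)
        linarith
    _ ≤ eLpNorm (fun x => (1 + |(lam : ℝ)|)
          * |F t (phase lam x) - transport g f t (phase lam x)|) 2 volume
        + eLpNorm (fun _ : Torus 3 => B) 2 volume :=
        eLpNorm_add_le (hm.norm.const_mul _) aestronglyMeasurable_const (by norm_num)
    _ = _ := by
        congr 1
        · rw [← eLpNorm_comp_phase lam hd]
          have := eLpNorm_const_smul (1 + |(lam : ℝ)|)
            (fun x => ‖F t (phase lam x) - transport g f t (phase lam x)‖) 2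
            (volume : Measure (Torus 3))
          rw [eLpNorm_norm, Real.enorm_of_nonneg (by positivity)] at this
          exact this
        · rw [eLpNorm_const' B (by simp) (by simp), Real.enorm_of_nonneg hB0]
          simp

/-- Dominated convergence in time for `L²` norms in space. -/
theorem tendsto_eLpNorm_spacetime {d : ℕ} {E : Type*} [NormedAddCommGroup E] {T : ℝ}
    {u : ℝ → ℝ × Torus d → E}
    (hm : ∀ ν, 0 < ν → AEStronglyMeasurable (u ν) (spacetime d T)) {C : ENNReal} (hC : C ≠ ⊤)
    (hb : ∀ᶠ ν in 𝓝[>] 0, ∀ t ∈ Set.Ioo 0 T, eLpNorm (fun x => u ν (t, x)) 2 volume ≤ C)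
    (hl : ∀ t ∈ Set.Ioo 0 T,
      Tendsto (fun ν => eLpNorm (fun x => u ν (t, x)) 2 volume) (𝓝[>] 0) (𝓝 0)) :
    Tendsto (fun ν => eLpNorm (u ν) 2 (spacetime d T)) (𝓝[>] 0) (𝓝 0) := by
  have hsq : ∀ {X : Type _} [MeasurableSpace X] (μ : Measure X) (k : X → E),
      eLpNorm k 2 μ ^ (2 : ℝ) = ∫⁻ x, ‖k x‖ₑ ^ (2 : ℝ) ∂μ := fun μ k => by
    have := eLpNorm_nnreal_pow_eq_lintegral (μ := μ) (f := k) (p := 2) (by norm_num)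
    simpa using this
  have key : Tendsto (fun ν => eLpNorm (u ν) 2 (spacetime d T) ^ (2 : ℝ)) (𝓝[>] 0) (𝓝 0) := by
    have h1 : ∀ ν, 0 < ν → eLpNorm (u ν) 2 (spacetime d T) ^ (2 : ℝ)
        = ∫⁻ t in Set.Ioo 0 T, eLpNorm (fun x => u ν (t, x)) 2 volume ^ (2 : ℝ) := by
      intro ν hν
      rw [hsq, spacetime, lintegral_prod _ ((hm ν hν).enorm.pow_const _)]
      simp_rw [hsq]
    have h2 : Tendsto (fun ν => ∫⁻ t in Set.Ioo 0 T,
        eLpNorm (fun x => u ν (t, x)) 2 volume ^ (2 : ℝ)) (𝓝[>] 0) (𝓝 (∫⁻ t in Set.Ioo 0 T, 0)) := by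
      refine tendsto_lintegral_filter_of_dominated_convergence' (fun _ => C ^ (2 : ℝ)) ?_ ?_ ?_ ?_
      · filter_upwards [self_mem_nhdsWithin] with ν hν
        simp_rw [hsq]
        exact ((hm ν hν).enorm.pow_const _).lintegral_prod_right'
      · filter_upwards [hb] with ν hν
        filter_upwards [ae_restrict_mem measurableSet_Ioo] with t ht
        exact ENNReal.rpow_le_rpow (hν t ht) (by norm_num)
      · rw [lintegral_const]
        refine ENNReal.mul_ne_top (ENNReal.rpow_ne_top_of_nonneg (by norm_num) hC) ?_
        exact measure_ne_top _ _
      · filter_upwards [ae_restrict_mem measurableSet_Ioo] with t ht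
        have := (ENNReal.continuous_rpow_const (y := (2 : ℝ))).tendsto 0 |>.comp (hl t ht)
        simpa [Function.comp_def] using this
    rw [lintegral_zero] at h2
    refine h2.congr' ?_
    filter_upwards [self_mem_nhdsWithin] with ν hν
    exact (h1 ν hν).symm
  have := (ENNReal.continuous_rpow_const (y := (1 / 2 : ℝ))).tendsto 0 |>.comp key
  simp only [Function.comp_def, ← ENNReal.rpow_mul] at this
  simpa using this

section Convergence

variable {lam : ℤ} {f : Torus 2 → ℝ} {g : Circ → ℝ} {F : ℝ → ℝ → Torus 2 → ℝ}

theorem tendsto_eLpNorm_uNS_sub_uEuler (hf : MemLp f 2 volume) (hg : SmoothCirc g)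
    (hF : ∀ ν, 0 < ν → IsDriftHeatSolution ν lam f g (F ν)) {t : ℝ} (ht : 0 ≤ t) :
    Tendsto (fun ν => eLpNorm (fun x => uNS ν lam g (F ν) t x - uEuler lam f g t x) 2 volume)
      (𝓝[>] 0) (𝓝 0) := by
  obtain ⟨K, hK, hKb⟩ := hg.exists_heat_sub_le
  have h1 := tendsto_eLpNorm_sub_transport hf hg hF ht
  have hc : ENNReal.ofReal (2 * Real.pi) ^ (1 / 2 : ℝ) ≠ ⊤ :=
    ENNReal.rpow_ne_top_of_nonneg (by norm_num) ENNReal.ofReal_ne_top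
  have hv : volume (Set.univ : Set (Torus 3)) ^ (1 / 2 : ℝ) ≠ ⊤ :=
    ENNReal.rpow_ne_top_of_nonneg (by norm_num) (measure_ne_top _ _)
  have h2 : Tendsto (fun ν : ℝ => ENNReal.ofReal (K * Real.sqrt (ν * t))) (𝓝[>] 0) (𝓝 0) := by
    have : Continuous fun ν : ℝ => ENNReal.ofReal (K * Real.sqrt (ν * t)) :=
      ENNReal.continuous_ofReal.comp (by fun_prop)
    simpa using (this.tendsto 0).mono_left nhdsWithin_le_nhds
  have h3 := (ENNReal.Tendsto.const_mul (a := ENNReal.ofReal (1 + |(lam : ℝ)|))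
    (ENNReal.Tendsto.const_mul h1 (Or.inr hc)) (Or.inr ENNReal.ofReal_ne_top)).add
    (ENNReal.Tendsto.mul_const h2 (Or.inr hv))
  simp only [mul_zero, zero_mul, add_zero] at h3
  refine tendsto_of_tendsto_of_tendsto_of_le_of_le' tendsto_const_nhds h3
    (Eventually.of_forall fun _ => zero_le) ?_
  filter_upwards [self_mem_nhdsWithin] with ν hν
  exact eLpNorm_uNS_sub_uEuler_le
    (memLp_fun_sub ((hF ν hν).memLp t ht) (memLp_transport hg.continuous hf t)).1
    fun x => hKb _ x

theorem tendsto_eLpNorm_uNS_sub_uEuler_spacetime (hf : MemLp f 2 volume) (hg : SmoothCirc g)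
    (hF : ∀ ν, 0 < ν → IsDriftHeatSolution ν lam f g (F ν)) {T : ℝ} (hT : 0 < T) :
    Tendsto (fun ν => eLpNorm
      (fun p : ℝ × Torus 3 => uNS ν lam g (F ν) p.1 p.2 - uEuler lam f g p.1 p.2) 2
      (spacetime 3 T)) (𝓝[>] 0) (𝓝 0) := by
  obtain ⟨K, hK, hKb⟩ := hg.exists_heat_sub_le
  have hc : ENNReal.ofReal (2 * Real.pi) ^ (1 / 2 : ℝ) ≠ ⊤ :=
    ENNReal.rpow_ne_top_of_nonneg (by norm_num) ENNReal.ofReal_ne_top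
  have hv : volume (Set.univ : Set (Torus 3)) ^ (1 / 2 : ℝ) ≠ ⊤ :=
    ENNReal.rpow_ne_top_of_nonneg (by norm_num) (measure_ne_top _ _)
  refine tendsto_eLpNorm_spacetime
    (C := ENNReal.ofReal (1 + |(lam : ℝ)|) * (ENNReal.ofReal (2 * Real.pi) ^ (1 / 2 : ℝ)
          * (eLpNorm f 2 volume + eLpNorm f 2 volume))
        + ENNReal.ofReal (K * Real.sqrt T) * volume (Set.univ : Set (Torus 3)) ^ (1 / 2 : ℝ))
    (u := fun ν p => uNS ν lam g (F ν) p.1 p.2 - uEuler lam f g p.1 p.2) ?_ ?_ ?_ ?_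
  · intro ν hν
    obtain ⟨D, hD⟩ := (hF ν hν).gradient
    exact (memLp_uNS_spacetime hg.continuous (hD.1 T hT).1).1.sub
      (memLp_uEuler_spacetime lam hg.continuous hf T).1
  · exact ENNReal.add_ne_top.2 ⟨ENNReal.mul_ne_top ENNReal.ofReal_ne_top (ENNReal.mul_ne_top hc
      (ENNReal.add_ne_top.2 ⟨hf.2.ne, hf.2.ne⟩)), ENNReal.mul_ne_top ENNReal.ofReal_ne_top hv⟩
  -- For ν < 1 the heat error K √(νt) is at most K √T, a bound uniform in ν and t.
  · have h1 : ∀ᶠ ν : ℝ in 𝓝[>] 0, ν < 1 :=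
      (gt_mem_nhds one_pos).filter_mono nhdsWithin_le_nhds
    filter_upwards [self_mem_nhdsWithin, h1] with ν hν hν1 t ht
    replace hν : 0 < ν := hν
    have hFt := (hF ν hν).memLp t ht.1.le
    have hft := memLp_transport hg.continuous hf t
    refine (eLpNorm_uNS_sub_uEuler_le (memLp_fun_sub hFt hft).1
      (B := K * Real.sqrt T) fun x => (hKb _ x).trans ?_).trans ?_
    · refine mul_le_mul_of_nonneg_left (Real.sqrt_le_sqrt ?_) hK
      nlinarith [ht.1, ht.2]
    · gcongr
      refine (eLpNorm_sub_le hFt.1 hft.1 (by norm_num)).trans (add_le_add ?_ ?_)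
      · rw [eLpNorm_two_eq hFt, eLpNorm_two_eq hf]
        exact ENNReal.ofReal_le_ofReal
          (Real.sqrt_le_sqrt ((hF ν hν).integral_sq_le hν hg ht.1.le))
      · exact (eLpNorm_comp_measurePreserving hf.1
          (measurePreserving_transport hg.continuous t)).le
  · intro t ht
    exact tendsto_eLpNorm_uNS_sub_uEuler hf hg hF ht.1.le

end Convergence

/-! ### Gradients of the velocity field and vanishing dissipation. -/

theorem SmoothTorus.isWeakGradient {d : ℕ} {φ : Torus d → ℝ} (hφ : SmoothTorus φ) :
    IsWeakGradient φ fun i => ShearFlow.pd i φ :=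
  ⟨hφ.memLp 2, fun i => (hφ.pd i).memLp 2, fun _ hψ i => hφ.integral_mul_pd hψ i⟩

theorem IsWeakGradient.linear_comb {d : ℕ} {v v' : Torus d → ℝ} {w w' : Fin d → Torus d → ℝ}
    (h : IsWeakGradient v w) (h' : IsWeakGradient v' w') (a b : ℝ) :
    IsWeakGradient (fun x => a * v x + b * v' x) fun i x => a * w i x + b * w' i x := by
  refine ⟨(h.1.const_mul a).add (h'.1.const_mul b),
    fun i => ((h.2.1 i).const_mul a).add ((h'.2.1 i).const_mul b), fun φ hφ i => ?_⟩
  have hi : ∀ {k ψ : Torus d → ℝ}, MemLp k 2 volume → SmoothTorus ψ →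
      Integrable (fun x => k x * ψ x) volume := fun hk hψ =>
    integrable_mul_of_continuous (hk.integrable one_le_two) hψ.continuous
  simp_rw [add_mul, mul_assoc]
  rw [integral_add ((hi h.1 (hφ.pd i)).const_mul a) ((hi h'.1 (hφ.pd i)).const_mul b),
    integral_add ((hi (h.2.1 i) hφ).const_mul a) ((hi (h'.2.1 i) hφ).const_mul b),
    integral_const_mul, integral_const_mul, integral_const_mul, integral_const_mul,
    h.2.2 φ hφ i, h'.2.2 φ hφ i]
  ring

theorem IsSpatialGradient.linear_comb {d : ℕ} {v v' : ℝ → Torus d → ℝ}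
    {D D' : Fin d → ℝ → Torus d → ℝ}
    (h : IsSpatialGradient v D) (h' : IsSpatialGradient v' D') (a b : ℝ) :
    IsSpatialGradient (fun t x => a * v t x + b * v' t x)
      fun i t x => a * D i t x + b * D' i t x := by
  refine ⟨fun T hT => ⟨((h.1 T hT).1.const_mul a).add ((h'.1 T hT).1.const_mul b),
    fun i => (((h.1 T hT).2 i).const_mul a).add (((h'.1 T hT).2 i).const_mul b)⟩, ?_⟩
  filter_upwards [h.2, h'.2] with t ht ht'
  exact ht.linear_comb ht' a b

/-- The gradient of `v(λx_1 + x_2, x_3)` in terms of that of `v`. -/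
noncomputable def phaseGradient (lam : ℤ) (w : Fin 2 → Torus 2 → ℝ) (i : Fin 3) (x : Torus 3) : ℝ :=
  ![(lam : ℝ) * w 0 (phase lam x), w 0 (phase lam x), w 1 (phase lam x)] i

theorem shearCoord_add_single_zero (lam : ℤ) (a c : Circ) (y : Torus 2) :
    shearCoord lam (a, y + Pi.single 0 c) = shearCoord lam (a, y) + Pi.single 1 c := by
  ext i
  fin_cases i
  · simp [shearCoord]
  · simp [shearCoord, add_sub_right_comm]
  · simp [shearCoord]

theorem shearCoord_add_single_one (lam : ℤ) (a c : Circ) (y : Torus 2) :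
    shearCoord lam (a, y + Pi.single 1 c) = shearCoord lam (a, y) + Pi.single 2 c := by
  ext i
  fin_cases i
  · simp [shearCoord]
  · simp [shearCoord]
  · simp [shearCoord]

theorem SmoothTorus.comp_shearCoord {φ : Torus 3 → ℝ} (hφ : SmoothTorus φ) (lam : ℤ) (a : Circ) :
    SmoothTorus fun y => φ (shearCoord lam (a, y)) := by
  obtain ⟨r, rfl⟩ := circ_coe_surjective a
  have e : ∀ z : Fin 2 → ℝ, φ (shearCoord lam ((r : Circ), proj z))
      = φ (proj ![r, z 0 - lam * r, z 1]) := fun z => by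
    congr 1
    ext i
    fin_cases i
    · simp [shearCoord]
    · simp only [shearCoord, proj_apply]
      change (z 0 : Circ) - lam • (r : Circ) = ((z 0 - lam * r : ℝ) : Circ)
      rw [AddCircle.coe_sub, ← AddCircle.coe_zsmul, zsmul_eq_mul]
    · simp [shearCoord]
  unfold SmoothTorus
  dsimp only
  simp_rw [e]
  refine ContDiff.comp (g := fun z : Fin 3 → ℝ => φ (proj z)) hφ (contDiff_pi.2 fun i => ?_)
  fin_cases i
  · exact contDiff_const
  · exact (contDiff_apply ℝ ℝ 0).sub contDiff_const
  · exact contDiff_apply ℝ ℝ 1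

theorem pd_zero_comp_shearCoord (φ : Torus 3 → ℝ) (lam : ℤ) (a : Circ) (y : Torus 2) :
    pd 0 (fun y => φ (shearCoord lam (a, y))) y = pd 1 φ (shearCoord lam (a, y)) := by
  simp [pd, shearCoord_add_single_zero]

theorem pd_one_comp_shearCoord (φ : Torus 3 → ℝ) (lam : ℤ) (a : Circ) (y : Torus 2) :
    pd 1 (fun y => φ (shearCoord lam (a, y))) y = pd 2 φ (shearCoord lam (a, y)) := by
  simp [pd, shearCoord_add_single_one]

theorem integral_phase_mul (lam : ℤ) {v : Torus 2 → ℝ} (hv : MemLp v 2 volume)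
    {ψ : Torus 3 → ℝ} (hψ : Continuous ψ) :
    ∫ x, v (phase lam x) * ψ x = ∫ a, ∫ y, v y * ψ (shearCoord lam (a, y)) := by
  have hi : Integrable (fun x => v (phase lam x) * ψ x) volume :=
    integrable_mul_of_continuous ((memLp_comp_phase lam hv).integrable one_le_two) hψ
  have hi' : Integrable (fun p => v (phase lam (shearCoord lam p)) * ψ (shearCoord lam p))
      (volume.prod volume) := (measurePreserving_shearCoord lam).integrable_comp_of_integrable hi
  rw [integral_torus3 lam, integral_prod _ hi']
  simp_rw [phase_shearCoord]

/-- On each fibre of the sheared coordinates ∂_2 and ∂_3 become the two derivatives of the plane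
torus. The derivative ∂_1 is then λ∂_2, by invariance along (1, -λ, 0). -/
theorem IsWeakGradient.comp_phase {v : Torus 2 → ℝ} {w : Fin 2 → Torus 2 → ℝ}
    (h : IsWeakGradient v w) (lam : ℤ) :
    IsWeakGradient (fun x => v (phase lam x)) (phaseGradient lam w) := by
  have h1 : ∀ φ : Torus 3 → ℝ, SmoothTorus φ →
      ∫ x, v (phase lam x) * pd 1 φ x = -∫ x, w 0 (phase lam x) * φ x := by
    intro φ hφ
    rw [integral_phase_mul lam h.1 (hφ.pd 1).continuous,
      integral_phase_mul lam (h.2.1 0) hφ.continuous, ← integral_neg]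
    congr 1
    ext a
    simp_rw [← pd_zero_comp_shearCoord]
    exact h.2.2 _ (hφ.comp_shearCoord lam a) 0
  have h2 : ∀ φ : Torus 3 → ℝ, SmoothTorus φ →
      ∫ x, v (phase lam x) * pd 2 φ x = -∫ x, w 1 (phase lam x) * φ x := by
    intro φ hφ
    rw [integral_phase_mul lam h.1 (hφ.pd 2).continuous,
      integral_phase_mul lam (h.2.1 1) hφ.continuous, ← integral_neg]
    congr 1
    ext a
    simp_rw [← pd_one_comp_shearCoord]
    exact h.2.2 _ (hφ.comp_shearCoord lam a) 1
  have hv := memLp_comp_phase lam h.1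
  refine ⟨hv, fun i => ?_, fun φ hφ i => ?_⟩
  · fin_cases i
    · exact (memLp_comp_phase lam (h.2.1 0)).const_mul _
    · exact memLp_comp_phase lam (h.2.1 0)
    · exact memLp_comp_phase lam (h.2.1 1)
  · fin_cases i
    -- The phase is constant along (1, -λ, 0), so ∂_1 - λ∂_2 annihilates the composed function
    -- weakly.
    · have h0 := hφ.integral_mul_line_eq_zero (hv.integrable one_le_two) ![1, -(lam : ℝ), 0]
        fun r x => by
          congr 1
          ext i
          fin_cases i
          · simp only [phase]
            change lam • (x 0 + ((r * 1 : ℝ) : Circ)) + (x 1 + ((r * -(lam : ℝ) : ℝ) : Circ))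
              = lam • x 0 + x 1
            rw [mul_one, mul_neg, mul_comm r, AddCircle.coe_neg, ← zsmul_eq_mul,
              AddCircle.coe_zsmul, smul_add]
            abel
          · simp [phase, proj]
      have hi : ∀ i, Integrable (fun x => v (phase lam x) * pd i φ x) volume := fun i =>
        integrable_mul_of_continuous (hv.integrable one_le_two) (hφ.pd i).continuous
      have e : ∀ x, v (phase lam x) * ∑ i, ![1, -(lam : ℝ), 0] i * pd i φ x
          = v (phase lam x) * pd 0 φ x - lam * (v (phase lam x) * pd 1 φ x) := fun x => by
        simp [Fin.sum_univ_three]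
        ring
      simp_rw [e] at h0
      rw [integral_sub (hi 0) ((hi 1).const_mul _), integral_const_mul, h1 φ hφ] at h0
      change ∫ x, v (phase lam x) * pd 0 φ x = -∫ x, (lam * w 0 (phase lam x)) * φ x
      simp_rw [mul_assoc]
      rw [integral_const_mul]
      linarith
    · exact h1 φ hφ
    · exact h2 φ hφ

theorem IsSpatialGradient.comp_phase {v : ℝ → Torus 2 → ℝ} {D : Fin 2 → ℝ → Torus 2 → ℝ}
    (h : IsSpatialGradient v D) (lam : ℤ) :
    IsSpatialGradient (fun t x => v t (phase lam x))
      fun i t => phaseGradient lam (fun j => D j t) i := by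
  refine ⟨fun T hT => ⟨memLp_comp_phase_spacetime lam (h.1 T hT).1, fun i => ?_⟩, ?_⟩
  · have h0 := memLp_comp_phase_spacetime lam ((h.1 T hT).2 0)
    have h1 := memLp_comp_phase_spacetime lam ((h.1 T hT).2 1)
    fin_cases i
    · exact h0.const_mul _
    · exact h0
    · exact h1
  · filter_upwards [h.2] with t ht
    exact ht.comp_phase lam

theorem SmoothCirc.isSpatialGradient_heat {g : Circ → ℝ} (hg : SmoothCirc g) (ν : ℝ) :
    IsSpatialGradient (fun t (x : Torus 3) => ShearFlow.heat (ν * t) g (x 2))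
      fun i t x => ![0, 0, ShearFlow.heat (ν * t) (ShearFlow.circDeriv g) (x 2)] i := by
  refine ⟨fun T _ => ⟨memLp_heat_spacetime hg.continuous ν T 2, fun i => ?_⟩,
    ae_of_all _ fun t => ?_⟩
  · fin_cases i
    · exact MemLp.zero'
    · exact MemLp.zero'
    · exact memLp_heat_spacetime hg.circDeriv.continuous ν T 2
  · convert ((hg.heat (ν * t)).smoothTorus (d := 3) 2).isWeakGradient using 1
    ext i x
    fin_cases i
    · exact (pd_circ_of_ne _ (by decide) _).symm
    · exact (pd_circ_of_ne _ (by decide) _).symm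
    · refine Eq.trans ?_ (pd_circ _ _ _).symm
      rw [hg.circDeriv_heat]
      rfl

/-- The gradient of the Navier–Stokes shear flow in terms of that of its profile. -/
noncomputable def uNSGradient (ν : ℝ) (lam : ℤ) (g : Circ → ℝ) (D : Fin 2 → ℝ → Torus 2 → ℝ)
    (k i : Fin 3) (t : ℝ) (x : Torus 3) : ℝ :=
  ![phaseGradient lam (fun j => D j t) i x,
    -(lam : ℝ) * phaseGradient lam (fun j => D j t) i x
      + -1 * ![0, 0, heat (ν * t) (circDeriv g) (x 2)] i, 0] k

theorem IsSpatialGradient.uNS {ν : ℝ} {lam : ℤ} {g : Circ → ℝ} (hg : SmoothCirc g)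
    {F : ℝ → Torus 2 → ℝ} {D : Fin 2 → ℝ → Torus 2 → ℝ} (h : IsSpatialGradient F D) (k : Fin 3) :
    IsSpatialGradient (fun t x => uNS ν lam g F t x k) (uNSGradient ν lam g D k) := by
  have h1 := h.comp_phase lam
  fin_cases k
  · exact h1
  · have h2 := h1.linear_comb (hg.isSpatialGradient_heat ν) (-(lam : ℝ)) (-1)
    have e : (fun (t : ℝ) (x : Torus 3) => ShearFlow.uNS ν lam g F t x 1) = fun t x =>
        -(lam : ℝ) * F t (phase lam x) + -1 * heat (ν * t) g (x 2) := by
      ext t x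
      rw [uNS_eq]
      simp
      ring
    exact e ▸ h2
  -- The vanishing third component is obtained as a linear combination with zero coefficients.
  · have h2 := h1.linear_comb h1 0 0
    simp only [zero_mul, add_zero] at h2
    exact h2

/-- The factor 2 comes from (a + b)² ≤ 2a² + 2b² in the only entry where the profile and the heat
flow meet. The right side is arranged to show the dissipation density of the energy equality. -/
theorem sum_uNSGradient_sq_le (ν : ℝ) (lam : ℤ) (g : Circ → ℝ) (D : Fin 2 → ℝ → Torus 2 → ℝ)
    (t : ℝ) (x : Torus 3) :
    ∑ k, ∑ i, uNSGradient ν lam g D k i t x ^ 2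
      ≤ (1 + 2 * (lam : ℝ) ^ 2) * (((lam : ℝ) ^ 2 + 1) * D 0 t (phase lam x) ^ 2
          + D 1 t (phase lam x) ^ 2)
        + 2 * heat (ν * t) (circDeriv g) (x 2) ^ 2 := by
  simp [Fin.sum_univ_three, uNSGradient, phaseGradient]
  nlinarith [sq_nonneg ((lam : ℝ) * D 1 t (phase lam x) - heat (ν * t) (circDeriv g) (x 2)),
    sq_nonneg ((lam : ℝ) * D 0 t (phase lam x)), sq_nonneg (D 0 t (phase lam x)),
    sq_nonneg ((lam : ℝ) * (lam : ℝ) * D 0 t (phase lam x))]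

section Dissipation

variable {ν : ℝ} {lam : ℤ} {f : Torus 2 → ℝ} {g : Circ → ℝ} {F : ℝ → Torus 2 → ℝ}

/-- The energy equality converts the profile part into the energy lost by time t. The constant π is
the fibre length 2π divided by the 2 of 2ν. The heat part is bounded uniformly and keeps its factor
ν. -/
theorem IsDriftHeatSolution.dissipation_le (h : IsDriftHeatSolution ν lam f g F) (hν : 0 < ν)
    (hg : SmoothCirc g) {D : Fin 2 → ℝ → Torus 2 → ℝ} (hD : IsSpatialGradient F D) {C : ℝ}
    (hC : ∀ x, |circDeriv g x| ≤ C) {t : ℝ} (ht : 0 ≤ t) :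
    ν * ∫ s in (0 : ℝ)..t, ∫ x, ∑ k, ∑ i, uNSGradient ν lam g D k i s x ^ 2
      ≤ (1 + 2 * (lam : ℝ) ^ 2) * Real.pi * ((∫ y, f y ^ 2) - ∫ y, F t y ^ 2)
        + ν * (2 * C ^ 2 * volume.real (Set.univ : Set (Torus 3)) * t) := by
  rcases ht.eq_or_lt with rfl | ht
  · have : ∫ y, F 0 y ^ 2 = ∫ y, f y ^ 2 := integral_congr_ae (by
      filter_upwards [h.initial] with y hy
      rw [hy])
    simp [this]
  have hE := h.energy_eq hν hg hD ht.le
  simp only [← sq] at hE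
  set J : ℝ → ℝ := fun s => ∫ y, (((lam : ℝ) ^ 2 + 1) * (D 0 s y) ^ 2 + (D 1 s y) ^ 2) with hJ
  set V := volume.real (Set.univ : Set (Torus 3))
  have hJi : Integrable J (volume.restrict (Set.Ioo 0 t)) :=
    ((((hD.1 t ht).2 0).integrable_sq.const_mul _).add
      ((hD.1 t ht).2 1).integrable_sq).integral_prod_left
  have hle : ∫ s in Set.Ioo 0 t, ∫ x, ∑ k, ∑ i, uNSGradient ν lam g D k i s x ^ 2
      ≤ ∫ s in Set.Ioo 0 t, ((1 + 2 * (lam : ℝ) ^ 2) * (2 * Real.pi * J s) + 2 * C ^ 2 * V) := by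
    refine integral_mono_of_nonneg (ae_of_all _ fun s => integral_nonneg fun x =>
      Finset.sum_nonneg fun k _ => Finset.sum_nonneg fun i _ => sq_nonneg _)
      (((hJi.const_mul _).const_mul _).add (integrable_const _)) ?_
    filter_upwards [ae_restrict_of_ae_restrict_of_subset Set.Ioo_subset_Ioi_self hD.2] with s hs
    have hi2 : Integrable (fun y => ((lam : ℝ) ^ 2 + 1) * (D 0 s y) ^ 2 + (D 1 s y) ^ 2) volume :=
      ((hs.2.1 0).integrable_sq.const_mul _).add (hs.2.1 1).integrable_sq
    have hi3 : Integrable (fun x => ((lam : ℝ) ^ 2 + 1) * (D 0 s (phase lam x)) ^ 2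
        + (D 1 s (phase lam x)) ^ 2) (volume : Measure (Torus 3)) :=
      (map_phase lam).integrable_comp_of_integrable (hi2.smul_measure ENNReal.ofReal_ne_top)
    have e : (1 + 2 * (lam : ℝ) ^ 2) * (2 * Real.pi * J s) + 2 * C ^ 2 * V
        = ∫ x : Torus 3, ((1 + 2 * (lam : ℝ) ^ 2) * (((lam : ℝ) ^ 2 + 1) * D 0 s (phase lam x) ^ 2
          + D 1 s (phase lam x) ^ 2) + 2 * C ^ 2) := by
      rw [integral_add (hi3.const_mul _) (integrable_const _), integral_const_mul,
        integral_comp_phase lam hi2.1, integral_const, smul_eq_mul, hJ]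
      ring
    rw [e]
    refine integral_mono_of_nonneg (ae_of_all _ fun x =>
      Finset.sum_nonneg fun k _ => Finset.sum_nonneg fun i _ => sq_nonneg _)
      ((hi3.const_mul _).add (integrable_const _)) (ae_of_all _ fun x => ?_)
    refine (sum_uNSGradient_sq_le ν lam g D s x).trans ?_
    have := sq_le_sq' (abs_le.1 (abs_heat_le hC (ν * s) (x 2))).1
      (abs_le.1 (abs_heat_le hC (ν * s) (x 2))).2
    dsimp only
    linarith
  rw [integral_add ((hJi.const_mul _).const_mul _) (integrable_const _), integral_const_mul,
    integral_const_mul, setIntegral_const, Real.volume_real_Ioo_of_le ht.le, sub_zero,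
    smul_eq_mul] at hle
  rw [intervalIntegral.integral_of_le ht.le, integral_Ioc_eq_integral_Ioo]
  refine (mul_le_mul_of_nonneg_left hle hν.le).trans (le_of_eq ?_)
  linear_combination (1 + 2 * (lam : ℝ) ^ 2) * Real.pi * hE

theorem tendsto_dissipation (hf : MemLp f 2 volume) (hg : SmoothCirc g)
    {F : ℝ → ℝ → Torus 2 → ℝ} (hF : ∀ ν, 0 < ν → IsDriftHeatSolution ν lam f g (F ν))
    {D : ℝ → Fin 2 → ℝ → Torus 2 → ℝ} (hD : ∀ ν, 0 < ν → IsSpatialGradient (F ν) (D ν)) {t : ℝ}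
    (ht : 0 ≤ t) :
    Tendsto (fun ν => ν * ∫ s in (0 : ℝ)..t, ∫ x, ∑ k, ∑ i,
      uNSGradient ν lam g (D ν) k i s x ^ 2) (𝓝[>] 0) (𝓝 0) := by
  obtain ⟨C, -, hC⟩ := exists_bound_of_continuous hg.circDeriv.continuous
  have h1 : Tendsto (fun ν : ℝ => ν * (2 * C ^ 2 * volume.real (Set.univ : Set (Torus 3)) * t))
      (𝓝[>] 0) (𝓝 0) := by
    have : Continuous fun ν : ℝ =>
      ν * (2 * C ^ 2 * volume.real (Set.univ : Set (Torus 3)) * t) := by fun_prop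
    simpa using (this.tendsto 0).mono_left nhdsWithin_le_nhds
  have h2 := (((tendsto_integral_sq hf hg hF ht).const_sub (∫ y, f y ^ 2)).const_mul
    ((1 + 2 * (lam : ℝ) ^ 2) * Real.pi)).add h1
  rw [sub_self, mul_zero, add_zero] at h2
  refine tendsto_of_tendsto_of_tendsto_of_le_of_le' tendsto_const_nhds h2 ?_ ?_
  · filter_upwards [self_mem_nhdsWithin] with ν hν
    exact mul_nonneg (le_of_lt hν) (intervalIntegral.integral_nonneg ht fun s _ =>
      integral_nonneg fun x => Finset.sum_nonneg fun k _ => Finset.sum_nonneg fun i _ =>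
        sq_nonneg _)
  · filter_upwards [self_mem_nhdsWithin] with ν hν
    exact (hF ν hν).dissipation_le hν hg (hD ν hν) hC ht

end Dissipation

/-! ### Test functions smooth up to the initial time. -/

/-- The lift of a function on `ℝ × 𝕋^d` to `ℝ × ℝ^d`. -/
noncomputable def cylLift {d : ℕ} (φ : ℝ → Torus d → ℝ) (p : ℝ × (Fin d → ℝ)) : ℝ :=
  φ p.1 (proj p.2)

section HalfCylinder

variable {d : ℕ} {φ : ℝ → Torus d → ℝ}

theorem SmoothHalfCylinder.smoothTorus (h : SmoothHalfCylinder φ) {t : ℝ} (ht : 0 ≤ t) :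
    SmoothTorus (φ t) := by
  have h1 : ContDiff ℝ ∞ fun z : Fin d → ℝ => (t, z) := contDiff_const.prodMk contDiff_id
  exact contDiffOn_univ.1 (ContDiffOn.comp (g := cylLift φ) h h1.contDiffOn
    fun z _ => ⟨ht, trivial⟩)

theorem SmoothHalfCylinder.hasFDerivAt (h : SmoothHalfCylinder φ) {s : ℝ} (hs : 0 < s)
    (z : Fin d → ℝ) :
    HasFDerivAt (cylLift φ) (fderiv ℝ (cylLift φ) (s, z)) (s, z) := by
  have h1 : ContDiffAt ℝ ∞ (cylLift φ) (s, z) :=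
    ContDiffOn.contDiffAt h (prod_mem_nhds (Ici_mem_nhds hs) univ_mem)
  exact (h1.differentiableAt (by simp)).hasFDerivAt

theorem SmoothHalfCylinder.deriv_time_proj (h : SmoothHalfCylinder φ) {s : ℝ} (hs : 0 < s)
    (z : Fin d → ℝ) :
    deriv (fun r => φ r (proj z)) s = fderiv ℝ (cylLift φ) (s, z) (1, 0) :=
  ((h.hasFDerivAt hs z).comp_hasDerivAt (f := fun s : ℝ => (s, z)) s
    ((hasDerivAt_id s).prodMk (hasDerivAt_const s z))).deriv

theorem SmoothHalfCylinder.pd_proj (h : SmoothHalfCylinder φ) {s : ℝ} (hs : 0 < s)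
    (i : Fin d) (z : Fin d → ℝ) :
    pd i (φ s) (proj z) = fderiv ℝ (cylLift φ) (s, z) (0, Pi.single i 1) := by
  rw [ShearFlow.pd_proj]
  have h1 : HasDerivAt (fun r : ℝ => (s, z + r • (Pi.single i (1 : ℝ) : Fin d → ℝ)))
      ((0 : ℝ), (Pi.single i (1 : ℝ) : Fin d → ℝ)) 0 := by
    refine (hasDerivAt_const (0 : ℝ) s).prodMk ?_
    simpa using ((hasDerivAt_id (0 : ℝ)).smul_const (Pi.single i (1 : ℝ) : Fin d → ℝ)).const_add z
  have h2 : HasFDerivAt (cylLift φ) (fderiv ℝ (cylLift φ) (s, z))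
      (s, z + (0 : ℝ) • (Pi.single i (1 : ℝ) : Fin d → ℝ)) := by
    simpa using h.hasFDerivAt hs z
  exact (h2.comp_hasDerivAt (0 : ℝ) h1).deriv

theorem SmoothHalfCylinder.continuousAt_fderiv (h : SmoothHalfCylinder φ) {s : ℝ} (hs : 0 < s)
    (z : Fin d → ℝ) (v : ℝ × (Fin d → ℝ)) :
    ContinuousAt (fun p => fderiv ℝ (cylLift φ) p v) (s, z) := by
  have h1 : ContDiffOn ℝ ∞ (cylLift φ) (Set.Ioi 0 ×ˢ Set.univ) :=
    ContDiffOn.mono h (Set.prod_mono Set.Ioi_subset_Ici_self le_rfl)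
  have ho : IsOpen ((Set.Ioi 0 : Set ℝ) ×ˢ (Set.univ : Set (Fin d → ℝ))) :=
    isOpen_Ioi.prod isOpen_univ
  have h2 := (h1.continuousOn_fderiv_of_isOpen ho (by simp)).continuousAt
    (ho.mem_nhds (Set.mk_mem_prod (Set.mem_Ioi.2 hs) (Set.mem_univ z)))
  exact h2.clm_apply continuousAt_const

/-- Continuity descends through the open quotient map. Time zero is left out, since two-sided
derivatives there would depend on the uncontrolled values at negative times. -/
theorem continuousOn_of_lift_fderiv {k : ℝ → Torus d → ℝ} (h : SmoothHalfCylinder φ)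
    {v : ℝ × (Fin d → ℝ)}
    (hk : ∀ s, 0 < s → ∀ z, k s (proj z) = fderiv ℝ (cylLift φ) (s, z) v) :
    ContinuousOn (Function.uncurry k) (Set.Ioi 0 ×ˢ Set.univ) := by
  rintro ⟨s, x⟩ ⟨hs, -⟩
  replace hs : 0 < s := hs
  obtain ⟨z, rfl⟩ := proj_surjective x
  refine ContinuousAt.continuousWithinAt ?_
  have hq : IsOpenQuotientMap (Prod.map id proj : ℝ × (Fin d → ℝ) → ℝ × Torus d) :=
    IsOpenQuotientMap.id.prodMap isOpenQuotientMap_proj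
  refine (hq.continuousAt_comp_iff (g := Function.uncurry k) (x := (s, z))).1 ?_
  refine (h.continuousAt_fderiv hs z v).congr ?_
  filter_upwards [prod_mem_nhds (Ioi_mem_nhds hs) univ_mem] with p hp
  exact (hk p.1 hp.1 p.2).symm

theorem SmoothHalfCylinder.continuousOn_deriv_time (h : SmoothHalfCylinder φ) :
    ContinuousOn (fun p : ℝ × Torus d => deriv (fun r => φ r p.2) p.1) (Set.Ioi 0 ×ˢ Set.univ) :=
  continuousOn_of_lift_fderiv (k := fun s x => deriv (fun r => φ r x) s) h
    fun _ hs z => h.deriv_time_proj hs z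

theorem SmoothHalfCylinder.continuousOn_pd (h : SmoothHalfCylinder φ) (i : Fin d) :
    ContinuousOn (fun p : ℝ × Torus d => pd i (φ p.1) p.2) (Set.Ioi 0 ×ˢ Set.univ) :=
  continuousOn_of_lift_fderiv (k := fun s => pd i (φ s)) h fun _ hs z => h.pd_proj hs i z

theorem aestronglyMeasurable_spacetime {k : ℝ × Torus d → ℝ}
    (hk : ContinuousOn k (Set.Ioi 0 ×ˢ Set.univ)) (T : ℝ) :
    AEStronglyMeasurable k (spacetime d T) := by
  have e : spacetime d T
      = (volume.prod volume).restrict (Set.Ioo 0 T ×ˢ (Set.univ : Set (Torus d))) := by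
    rw [spacetime, ← Measure.prod_restrict, Measure.restrict_univ]
  rw [e]
  exact (hk.mono (Set.prod_mono Set.Ioo_subset_Ioi_self le_rfl)).aestronglyMeasurable
    (measurableSet_Ioo.prod MeasurableSet.univ)

theorem exists_lift_mem_Icc (x : Torus d) :
    ∃ z ∈ Set.Icc (0 : Fin d → ℝ) (fun _ => 2 * Real.pi), proj z = x := by
  have h : ∀ i, ∃ r ∈ Set.Icc (0 : ℝ) (2 * Real.pi), (r : Circ) = x i := fun i => by
    have := AddCircle.coe_image_Icc_eq (2 * Real.pi) 0
    rw [zero_add] at this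
    have hx : x i ∈ ((↑) : ℝ → Circ) '' Set.Icc 0 (2 * Real.pi) := by
      rw [this]
      trivial
    exact hx
  choose r hr hrx using h
  exact ⟨r, ⟨fun i => (hr i).1, fun i => (hr i).2⟩, funext hrx⟩

/-- The one-sided derivative is continuous up to t = 0, hence bounded on a compact fundamental
domain, and for s > 0 it is the ordinary derivative. Thus the derivatives do not blow up as s → 0.
-/
theorem SmoothHalfCylinder.exists_bound (h : SmoothHalfCylinder φ) (T : ℝ) :
    ∃ C, 0 ≤ C ∧ ∀ s, 0 < s → s ≤ T → ∀ x, |deriv (fun r => φ r x) s| ≤ C ∧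
      ∀ i, |pd i (φ s) x| ≤ C := by
  have hu : UniqueDiffOn ℝ ((Set.Ici 0 : Set ℝ) ×ˢ (Set.univ : Set (Fin d → ℝ))) :=
    (uniqueDiffOn_Ici 0).prod uniqueDiffOn_univ
  have hc := ContDiffOn.continuousOn_fderivWithin (f := cylLift φ) h hu (by simp)
  obtain ⟨C, hC⟩ := ((isCompact_Icc (a := (0 : ℝ)) (b := T)).prod
    (isCompact_Icc (a := (0 : Fin d → ℝ)) (b := fun _ => 2 * Real.pi))).exists_bound_of_continuousOn
    (hc.mono fun p hp => ⟨hp.1.1, trivial⟩)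
  have key : ∀ s, 0 < s → s ≤ T → ∀ z ∈ Set.Icc (0 : Fin d → ℝ) (fun _ => 2 * Real.pi),
      ∀ v : ℝ × (Fin d → ℝ), ‖v‖ ≤ 1 → |fderiv ℝ (cylLift φ) (s, z) v| ≤ max C 0 := by
    intro s hs hsT z hz v hv
    have h1 := hC (s, z) ⟨⟨hs.le, hsT⟩, hz⟩
    rw [fderivWithin_of_mem_nhds (prod_mem_nhds (Ici_mem_nhds hs) univ_mem)] at h1
    refine ((fderiv ℝ (cylLift φ) (s, z)).le_opNorm v).trans ?_
    calc _ ≤ max C 0 * 1 := mul_le_mul (h1.trans (le_max_left _ _)) hv (norm_nonneg _)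
          (le_max_right _ _)
      _ = _ := mul_one _
  refine ⟨max C 0, le_max_right _ _, fun s hs hsT x => ?_⟩
  obtain ⟨z, hz, rfl⟩ := exists_lift_mem_Icc x
  refine ⟨?_, fun i => ?_⟩
  · rw [h.deriv_time_proj hs]
    exact key s hs hsT z hz _ (by simp [Prod.norm_def])
  · rw [h.pd_proj hs]
    refine key s hs hsT z hz _ ?_
    rw [Prod.norm_def, norm_zero, max_eq_right (norm_nonneg _)]
    refine (pi_norm_le_iff_of_nonneg zero_le_one).2 fun j => ?_
    by_cases hj : j = i
    · subst hj
      simp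
    · simp [hj]

/-- The chain rule along a straight line in space-time. -/
theorem SmoothHalfCylinder.hasDerivAt_line (h : SmoothHalfCylinder φ) (x : Torus d)
    (v : Fin d → ℝ) {s : ℝ} (hs : 0 < s) :
    HasDerivAt (fun s => φ s (x + proj (s • v)))
      (deriv (fun r => φ r (x + proj (s • v))) s
        + ∑ i, v i * pd i (φ s) (x + proj (s • v))) s := by
  obtain ⟨z, rfl⟩ := proj_surjective x
  simp only [← proj_add]
  rw [h.deriv_time_proj hs]
  simp_rw [h.pd_proj hs]
  have h1 : HasDerivAt (fun s : ℝ => (s, z + s • v)) ((1 : ℝ), v) s := by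
    refine (hasDerivAt_id s).prodMk ?_
    simpa using ((hasDerivAt_id s).smul_const v).const_add z
  have h2 := (h.hasFDerivAt hs (z + s • v)).comp_hasDerivAt s h1
  have e : ((1 : ℝ), v) = (1, 0) + ∑ i, v i • ((0 : ℝ), (Pi.single i 1 : Fin d → ℝ)) := by
    refine Prod.ext ?_ ?_
    · simp [Prod.fst_sum]
    · ext j
      simp [Prod.snd_sum, Finset.sum_apply, Pi.single_apply]
  have h3 : fderiv ℝ (cylLift φ) (s, z + s • v) (1, v)
      = fderiv ℝ (cylLift φ) (s, z + s • v) (1, 0)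
        + ∑ i, v i * fderiv ℝ (cylLift φ) (s, z + s • v) (0, Pi.single i 1) := by
    conv_lhs => rw [e]
    simp only [map_add, map_sum, map_smul, smul_eq_mul]
  rw [← h3]
  exact h2

theorem SmoothHalfCylinder.continuousOn_line (h : SmoothHalfCylinder φ) (x : Torus d)
    (v : Fin d → ℝ) : ContinuousOn (fun s => φ s (x + proj (s • v))) (Set.Ici 0) := by
  obtain ⟨z, rfl⟩ := proj_surjective x
  simp only [← proj_add]
  have h1 : Continuous fun s : ℝ => (s, z + s • v) := by fun_prop
  exact (ContDiffOn.continuousOn (f := cylLift φ) h).comp h1.continuousOn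
    fun s hs => ⟨hs, trivial⟩

/-- Continuity on the closed interval, differentiability inside it and a bounded derivative suffice
for the fundamental theorem of calculus. -/
theorem SmoothHalfCylinder.integral_line (h : SmoothHalfCylinder φ) (x : Torus d)
    (v : Fin d → ℝ) {t : ℝ} (ht : 0 ≤ t) :
    ∫ s in Set.Ioo 0 t, (deriv (fun r => φ r (x + proj (s • v))) s
        + ∑ i, v i * pd i (φ s) (x + proj (s • v)))
      = φ t (x + proj (t • v)) - φ 0 x := by
  obtain ⟨C, hC0, hC⟩ := h.exists_bound t
  have hline : Continuous fun s : ℝ => (s, x + proj (s • v)) :=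
    continuous_id.prodMk (continuous_const.add (continuous_proj.comp (by fun_prop)))
  have hmaps : Set.MapsTo (fun s : ℝ => (s, x + proj (s • v))) (Set.Ioi 0)
      (Set.Ioi 0 ×ˢ Set.univ) := fun s hs => ⟨hs, trivial⟩
  have hcont : ContinuousOn (fun s => deriv (fun r => φ r (x + proj (s • v))) s
        + ∑ i, v i * pd i (φ s) (x + proj (s • v))) (Set.Ioi 0) :=
    (h.continuousOn_deriv_time.comp hline.continuousOn hmaps).add
      (continuousOn_finsetSum _ fun i _ => continuousOn_const.mul
        ((h.continuousOn_pd i).comp hline.continuousOn hmaps))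
  rw [← integral_Ioc_eq_integral_Ioo, ← intervalIntegral.integral_of_le ht]
  rw [intervalIntegral.integral_eq_sub_of_hasDerivAt_of_le ht
    ((h.continuousOn_line x v).mono fun s hs => hs.1) (fun s hs => h.hasDerivAt_line x v hs.1)]
  · simp [proj_zero]
  · rw [intervalIntegrable_iff_integrableOn_Ioo_of_le ht]
    refine Integrable.of_bound
      ((hcont.mono Set.Ioo_subset_Ioi_self).aestronglyMeasurable measurableSet_Ioo)
      (C + ∑ i, |v i| * C) ?_
    filter_upwards [ae_restrict_mem measurableSet_Ioo] with s hs
    have h1 := hC s hs.1 hs.2.le (x + proj (s • v))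
    refine (abs_add_le _ _).trans (add_le_add h1.1 ((Finset.abs_sum_le_sum_abs _ _).trans ?_))
    refine Finset.sum_le_sum fun i _ => ?_
    rw [abs_mul]
    exact mul_le_mul_of_nonneg_left (h1.2 i) (abs_nonneg _)

end HalfCylinder

/-! ### Particle trajectories of the Euler flow and the local energy balance. -/

section Flow

variable {lam : ℤ} {f : Torus 2 → ℝ} {g : Circ → ℝ}

/-- The constant velocity of the particle with phase `y`. -/
noncomputable def particleVelocity (lam : ℤ) (f : Torus 2 → ℝ) (g : Circ → ℝ) (y : Torus 2) :
    EuclideanSpace ℝ (Fin 3) :=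
  !₂[f y, -(lam : ℝ) * f y - g (y 1), 0]

/-- The particle trajectories of the Euler shear flow, in sheared coordinates. -/
noncomputable def trajectory (lam : ℤ) (f : Torus 2 → ℝ) (g : Circ → ℝ) (s : ℝ)
    (p : Circ × Torus 2) : Torus 3 :=
  shearCoord lam (p.1 + ((s * f p.2 : ℝ) : Circ), shear (fun a => ((-s * g a : ℝ) : Circ)) p.2)

/-- The contributions λf and -λf to the velocity of the phase cancel, leaving -g of the fixed
coordinate x_3. This reconciles the sheared description, which shows preservation of volume, with
the straight line needed for differentiation. -/
theorem trajectory_eq (lam : ℤ) (f : Torus 2 → ℝ) (g : Circ → ℝ) (s : ℝ) (p : Circ × Torus 2) :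
    trajectory lam f g s p
      = shearCoord lam p + proj (s • fun i => particleVelocity lam f g p.2 i) := by
  ext i
  fin_cases i
  · simp [trajectory, shearCoord, particleVelocity]
  · change p.2 0 + ((-s * g (p.2 1) : ℝ) : Circ) - lam • (p.1 + ((s * f p.2 : ℝ) : Circ))
      = p.2 0 - lam • p.1 + ((s * (-(lam : ℝ) * f p.2 - g (p.2 1)) : ℝ) : Circ)
    have e : s * (-(lam : ℝ) * f p.2 - g (p.2 1))
        = -s * g (p.2 1) - (lam : ℝ) * (s * f p.2) := by ring
    rw [e, AddCircle.coe_sub, ← zsmul_eq_mul, AddCircle.coe_zsmul, smul_add]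
    abel
  · simp [trajectory, shearCoord, particleVelocity, shear]

/-- The drift of the phase undoes the shift by s g in the inviscid profile, so a particle keeps its
initial velocity. -/
theorem uEuler_trajectory (lam : ℤ) (f : Torus 2 → ℝ) (g : Circ → ℝ) (s : ℝ)
    (p : Circ × Torus 2) :
    uEuler lam f g s (trajectory lam f g s p) = particleVelocity lam f g p.2 := by
  have e : transport g f s (phase lam (trajectory lam f g s p)) = f p.2 := by
    rw [trajectory, phase_shearCoord, transport]
    congr 1
    ext i
    fin_cases i
    · simp [shear]
    · simp [shear]
  rw [uEuler_eq, e]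
  rfl

theorem uEuler_zero (lam : ℤ) (f : Torus 2 → ℝ) (g : Circ → ℝ) :
    uEuler lam f g 0 = uIn lam f g := by
  ext x i
  rw [uEuler, uIn]
  simp

theorem trajectory_zero (lam : ℤ) (f : Torus 2 → ℝ) (g : Circ → ℝ) (p : Circ × Torus 2) :
    trajectory lam f g 0 p = shearCoord lam p := by
  rw [trajectory_eq]
  simp [proj_zero]

theorem measurable_shear_time (hg : Continuous g) (c : ℝ) :
    Measurable fun q : ℝ × Torus 2 => shear (fun a => ((c * q.1 * g a : ℝ) : Circ)) q.2 := by
  refine Continuous.measurable (continuous_pi fun i => ?_)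
  have h1 : Continuous fun q : ℝ × Torus 2 => q.2 1 := (continuous_apply 1).comp continuous_snd
  have h0 : Continuous fun q : ℝ × Torus 2 => q.2 0 := (continuous_apply 0).comp continuous_snd
  fin_cases i
  · exact h0.add ((AddCircle.continuous_mk' _).comp
      ((continuous_const.mul continuous_fst).mul (hg.comp h1)))
  · exact h1

theorem measurable_trajectory (hf : Measurable f) (hg : Continuous g) :
    Measurable fun q : ℝ × (Circ × Torus 2) => trajectory lam f g q.1 q.2 := by
  refine (continuous_shearCoord lam).measurable.comp (Measurable.prodMk ?_ ?_)
  · exact (measurable_fst.comp measurable_snd).add (AddCircle.measurable_mk'.comp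
      (measurable_fst.mul (hf.comp (measurable_snd.comp measurable_snd))))
  · have := (measurable_shear_time hg (-1)).comp
      (measurable_fst.prodMk (measurable_snd.comp measurable_snd) :
        Measurable fun q : ℝ × (Circ × Torus 2) => (q.1, q.2.2))
    simpa [Function.comp_def] using this

/-- A skew product: the phase is sheared, and over each phase the circle variable is translated by s
f. Here f has to be genuinely measurable. -/
theorem measurePreserving_trajectory (hf : Measurable f) (hg : Continuous g) (s : ℝ) :
    MeasurePreserving (trajectory lam f g s) (volume.prod volume) volume := by
  have h1 : MeasurePreserving (fun q : Torus 2 × Circ =>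
      (shear (fun a => ((-s * g a : ℝ) : Circ)) q.1, q.2 + ((s * f q.1 : ℝ) : Circ)))
      (volume.prod volume) (volume.prod volume) :=
    (measurePreserving_transport hg (-s)).skew_product
      (g := fun (y : Torus 2) (a : Circ) => a + ((s * f y : ℝ) : Circ))
      (measurable_snd.add (AddCircle.measurable_mk'.comp
        (measurable_const.mul (hf.comp measurable_fst))))
      (ae_of_all _ fun y => (measurePreserving_add_right volume _).map_eq)
  exact (measurePreserving_shearCoord lam).comp
    (Measure.measurePreserving_swap.comp (h1.comp Measure.measurePreserving_swap))

theorem measurePreserving_trajectory_spacetime (hf : Measurable f) (hg : Continuous g) (T : ℝ) :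
    MeasurePreserving (fun q : ℝ × (Circ × Torus 2) => (q.1, trajectory lam f g q.1 q.2))
      ((volume.restrict (Set.Ioo 0 T)).prod (volume.prod volume)) (spacetime 3 T) :=
  (MeasurePreserving.id _).skew_product (measurable_trajectory hf hg)
    (ae_of_all _ fun s => (measurePreserving_trajectory hf hg s).map_eq)

theorem integrable_energy_mul (hf : MemLp f 2 volume) (hg : Continuous g) (t : ℝ)
    {ψ : Torus 3 → ℝ} (hψ : Continuous ψ) :
    Integrable (fun x => ‖uEuler lam f g t x‖ ^ 2 * ψ x) volume :=
  integrable_mul_of_continuous (memLp_uEuler lam hg hf t).norm.integrable_sq hψ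

/-- The density of the energy flux in the local energy balance. -/
noncomputable def fluxDensity (lam : ℤ) (f : Torus 2 → ℝ) (g : Circ → ℝ) (φ : ℝ → Torus 3 → ℝ)
    (p : ℝ × Torus 3) : ℝ :=
  deriv (fun r => φ r p.2) p.1 * ‖uEuler lam f g p.1 p.2‖ ^ 2
    + ‖uEuler lam f g p.1 p.2‖ ^ 2 * ∑ i, uEuler lam f g p.1 p.2 i * pd i (φ p.1) p.2

/-- The term |u|² u·∇φ is cubic in u, and on (0, t) it is dominated by 3C|u|³; this is the use of f
∈ L³. -/
theorem integrable_fluxDensity (hf : MemLp f 2 volume) (hf3 : MemLp f 3 volume)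
    (hg : Continuous g) {φ : ℝ → Torus 3 → ℝ} (hφ : SmoothHalfCylinder φ) (t : ℝ) :
    Integrable (fluxDensity lam f g φ) (spacetime 3 t) := by
  obtain ⟨C, hC0, hC⟩ := hφ.exists_bound t
  have hs : ∀ᵐ p ∂(spacetime 3 t), 0 < p.1 ∧ p.1 < t := by
    have : ∀ᵐ s ∂(volume.restrict (Set.Ioo 0 t)), 0 < s ∧ s < t :=
      ae_restrict_mem measurableSet_Ioo
    exact Measure.quasiMeasurePreserving_fst.ae this
  have h2 := memLp_uEuler_spacetime lam hg hf t
  have h3 := memLp_uEuler_spacetime lam hg hf3 t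
  have hcube : Integrable (fun p : ℝ × Torus 3 => ‖uEuler lam f g p.1 p.2‖ ^ 3)
      (spacetime 3 t) := h3.integrable_norm_pow (p := 3) (by norm_num)
  refine Integrable.add ?_ ?_
  · refine h2.norm.integrable_sq.bdd_mul (c := C)
      (aestronglyMeasurable_spacetime hφ.continuousOn_deriv_time t) ?_
    filter_upwards [hs] with p hp
    exact (hC p.1 hp.1 hp.2.le p.2).1
  · refine (hcube.const_mul (3 * C)).mono ?_ ?_
    · refine (h2.norm.1.pow 2).mul ?_
      refine Finset.aestronglyMeasurable_fun_sum _ fun i _ => ?_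
      exact (h2.eval_piLp i).1.mul (aestronglyMeasurable_spacetime (hφ.continuousOn_pd i) t)
    · filter_upwards [hs] with p hp
      have hb := (hC p.1 hp.1 hp.2.le p.2).2
      set u := uEuler lam f g p.1 p.2
      have h1 : |∑ i, u i * pd i (φ p.1) p.2| ≤ 3 * C * ‖u‖ := by
        refine (Finset.abs_sum_le_sum_abs _ _).trans ?_
        calc ∑ i, |u i * pd i (φ p.1) p.2| ≤ ∑ _i : Fin 3, ‖u‖ * C := by
              refine Finset.sum_le_sum fun i _ => ?_
              rw [abs_mul]
              exact mul_le_mul (PiLp.norm_apply_le u i) (hb i) (abs_nonneg _) (norm_nonneg _)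
          _ = 3 * C * ‖u‖ := by
              simp
              ring
      have h0 : 0 ≤ 3 * C * ‖u‖ ^ 3 := by positivity
      rw [Real.norm_eq_abs, Real.norm_eq_abs, abs_of_nonneg h0, abs_mul,
        abs_of_nonneg (sq_nonneg ‖u‖)]
      calc ‖u‖ ^ 2 * |∑ i, u i * pd i (φ p.1) p.2| ≤ ‖u‖ ^ 2 * (3 * C * ‖u‖) :=
            mul_le_mul_of_nonneg_left h1 (sq_nonneg _)
        _ = 3 * C * ‖u‖ ^ 3 := by ring

/-- Pulled back to particle labels, |u|² is constant in time and can be taken out of the time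
integral; what remains is the increment of φ along a line. -/
theorem energy_balance_of_measurable (hfm : Measurable f) (hf : MemLp f 2 volume)
    (hf3 : MemLp f 3 volume) (hg : Continuous g) {φ : ℝ → Torus 3 → ℝ}
    (hφ : SmoothHalfCylinder φ) {t : ℝ} (ht : 0 ≤ t) :
    (∫ x, ‖uEuler lam f g t x‖ ^ 2 * φ t x) - (∫ x, ‖uEuler lam f g 0 x‖ ^ 2 * φ 0 x)
      = ∫ s in Set.Ioo 0 t, ∫ x, fluxDensity lam f g φ (s, x) := by
  have hpull : ∀ s, 0 ≤ s → ∫ x, ‖uEuler lam f g s x‖ ^ 2 * φ s x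
      = ∫ p : Circ × Torus 2, ‖particleVelocity lam f g p.2‖ ^ 2 * φ s (trajectory lam f g s p)
        ∂(volume.prod volume) := fun s hs => by
    rw [← integral_comp_measurePreserving (measurePreserving_trajectory (lam := lam) hfm hg s)
      (integrable_energy_mul hf hg s (hφ.smoothTorus hs).continuous).1]
    simp_rw [uEuler_trajectory]
  have hint : ∀ s, 0 ≤ s → Integrable (fun p : Circ × Torus 2 =>
      ‖particleVelocity lam f g p.2‖ ^ 2 * φ s (trajectory lam f g s p))
      (volume.prod volume) := fun s hs => by
    have : Integrable (fun p => ‖uEuler lam f g s (trajectory lam f g s p)‖ ^ 2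
        * φ s (trajectory lam f g s p)) (volume.prod volume) :=
      (measurePreserving_trajectory (lam := lam) hfm hg s).integrable_comp_of_integrable
        (integrable_energy_mul hf hg s (hφ.smoothTorus hs).continuous)
    simpa only [uEuler_trajectory] using this
  have hflux := integrable_fluxDensity (lam := lam) hf hf3 hg hφ t
  have hK : Integrable (fun q : ℝ × (Circ × Torus 2) =>
      fluxDensity lam f g φ (q.1, trajectory lam f g q.1 q.2))
      ((volume.restrict (Set.Ioo 0 t)).prod (volume.prod volume)) :=
    (measurePreserving_trajectory_spacetime hfm hg t).integrable_comp_of_integrable hflux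
  have hslice : ∀ᵐ s ∂(volume.restrict (Set.Ioo 0 t)), ∫ x, fluxDensity lam f g φ (s, x)
      = ∫ p : Circ × Torus 2, fluxDensity lam f g φ (s, trajectory lam f g s p)
        ∂(volume.prod volume) := by
    filter_upwards [hflux.prod_right_ae] with s hs
    exact (integral_comp_measurePreserving (measurePreserving_trajectory (lam := lam) hfm hg s)
      hs.1).symm
  -- After exchanging the integrals the identity is checked for each particle separately.
  rw [integral_congr_ae hslice, integral_integral_swap hK, hpull t ht, hpull 0 le_rfl,
    ← integral_sub (hint t ht) (hint 0 le_rfl)]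
  refine integral_congr_ae (ae_of_all _ fun p => ?_)
  have e : ∀ s, fluxDensity lam f g φ (s, trajectory lam f g s p)
      = ‖particleVelocity lam f g p.2‖ ^ 2
        * (deriv (fun r => φ r (trajectory lam f g s p)) s
          + ∑ i, particleVelocity lam f g p.2 i * pd i (φ s) (trajectory lam f g s p)) :=
    fun s => by
      simp only [fluxDensity, uEuler_trajectory]
      ring
  simp_rw [e]
  rw [integral_const_mul, trajectory_zero]
  simp_rw [trajectory_eq]
  rw [hφ.integral_line _ _ ht]
  ring

theorem uEuler_ae_eq {f' : Torus 2 → ℝ} (hg : Continuous g) (hff : f =ᵐ[volume] f') (t : ℝ) :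
    uEuler lam f g t =ᵐ[volume] uEuler lam f' g t := by
  have h1 : transport g f t =ᵐ[volume] transport g f' t :=
    (measurePreserving_transport hg t).quasiMeasurePreserving.ae_eq_comp hff
  have h2 : (fun x => transport g f t (phase lam x)) =ᵐ[volume]
      fun x => transport g f' t (phase lam x) :=
    (map_phase lam).quasiMeasurePreserving.ae_eq_comp (Measure.ae_smul_measure h1 _)
  filter_upwards [h2] with x hx
  rw [uEuler_eq, uEuler_eq, hx]

/-- **Local energy balance** of the Euler shear flow. -/
theorem energy_balance (hf : MemLp f 2 volume) (hf3 : MemLp f 3 volume) (hg : Continuous g)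
    {φ : ℝ → Torus 3 → ℝ} (hφ : SmoothHalfCylinder φ) {t : ℝ} (ht : 0 ≤ t) :
    (∫ x, ‖uEuler lam f g t x‖ ^ 2 * φ t x) - (∫ x, ‖uIn lam f g x‖ ^ 2 * φ 0 x)
      = ∫ s in (0 : ℝ)..t, ∫ x, fluxDensity lam f g φ (s, x) := by
  -- Trajectories are sensitive to the choice of representative of f but the integrals are not, so f
  -- is replaced by a measurable one.
  have hff := hf.1.ae_eq_mk
  have hE : ∀ s, ∫ x, ‖uEuler lam f g s x‖ ^ 2 * φ s x
      = ∫ x, ‖uEuler lam (hf.1.mk f) g s x‖ ^ 2 * φ s x := fun s => integral_congr_ae (by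
    filter_upwards [uEuler_ae_eq (lam := lam) hg hff s] with x hx
    rw [hx])
  have hD : ∀ s, ∫ x, fluxDensity lam f g φ (s, x)
      = ∫ x, fluxDensity lam (hf.1.mk f) g φ (s, x) := fun s => integral_congr_ae (by
    filter_upwards [uEuler_ae_eq (lam := lam) hg hff s] with x hx
    simp only [fluxDensity, hx])
  rw [← uEuler_zero, hE t, hE 0, intervalIntegral.integral_of_le ht, integral_Ioc_eq_integral_Ioo]
  simp_rw [hD]
  exact energy_balance_of_measurable hf.1.stronglyMeasurable_mk.measurable (hf.ae_eq hff)
    (hf3.ae_eq hff) hg hφ ht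

end Flow

end ShearFlow

/-! ### Assembly of the four assertions. -/

open ShearFlow
theorem mainTheorem4 (lam : ℤ) (f : Torus 2 → ℝ) (hf : MemLp f 2 volume)
    (g : Circ → ℝ) (hg : SmoothCirc g) :
    (∀ F : ℝ → ℝ → Torus 2 → ℝ,
      (∀ ν : ℝ, 0 < ν → IsDriftHeatSolution ν lam f g (F ν)) →
      -- (1) convergence in `L²((0,T) × 𝕋³)`
      (∀ T : ℝ, 0 < T →
        MemLp (Function.uncurry (uEuler lam f g)) 2 (spacetime 3 T) ∧
        (∀ ν : ℝ, 0 < ν → MemLp (Function.uncurry (uNS ν lam g (F ν))) 2 (spacetime 3 T)) ∧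
        Tendsto (fun ν : ℝ => eLpNorm
            (fun p : ℝ × Torus 3 => uNS ν lam g (F ν) p.1 p.2 - uEuler lam f g p.1 p.2)
            2 (spacetime 3 T)) (𝓝[>] 0) (𝓝 0)) ∧
      -- (2) convergence in `L²(𝕋³)` at every time
      (∀ t : ℝ, 0 ≤ t →
        MemLp (uEuler lam f g t) 2 volume ∧
        (∀ ν : ℝ, 0 < ν → MemLp (uNS ν lam g (F ν) t) 2 volume) ∧
        Tendsto (fun ν : ℝ => eLpNorm
            (fun x : Torus 3 => uNS ν lam g (F ν) t x - uEuler lam f g t x) 2 volume)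
          (𝓝[>] 0) (𝓝 0)) ∧
      -- (3) absence of anomalous dissipation; `D ν k i` is the weak derivative `∂_i` of the
      -- `k`-th component of the Navier–Stokes flow
      (∃ D : ℝ → Fin 3 → Fin 3 → ℝ → Torus 3 → ℝ,
        (∀ ν : ℝ, 0 < ν → ∀ k : Fin 3,
          IsSpatialGradient (fun t x => uNS ν lam g (F ν) t x k) (D ν k)) ∧
        ∀ t : ℝ, 0 ≤ t →
          Tendsto (fun ν : ℝ => ν * ∫ s in (0 : ℝ)..t, ∫ x, ∑ k, ∑ i, (D ν k i s x) ^ 2)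
            (𝓝[>] 0) (𝓝 0))) ∧
    -- (4) local energy balance of the Euler flow
    (MemLp f 3 volume →
      ∀ φ : ℝ → Torus 3 → ℝ, SmoothHalfCylinder φ → (∀ t, 0 ≤ t → ∀ x, 0 ≤ φ t x) →
      ∀ t : ℝ, 0 ≤ t →
        Integrable (fun x => ‖uEuler lam f g t x‖ ^ 2 * φ t x) volume ∧
        Integrable (fun x => ‖uIn lam f g x‖ ^ 2 * φ 0 x) volume ∧
        Integrable (fun p : ℝ × Torus 3 =>
          deriv (fun r => φ r p.2) p.1 * ‖uEuler lam f g p.1 p.2‖ ^ 2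
            + ‖uEuler lam f g p.1 p.2‖ ^ 2
              * ∑ i, uEuler lam f g p.1 p.2 i * pd i (φ p.1) p.2) (spacetime 3 t) ∧
        (∫ x, ‖uEuler lam f g t x‖ ^ 2 * φ t x) - (∫ x, ‖uIn lam f g x‖ ^ 2 * φ 0 x)
          = ∫ s in (0 : ℝ)..t, ∫ x,
              (deriv (fun r => φ r x) s * ‖uEuler lam f g s x‖ ^ 2
                + ‖uEuler lam f g s x‖ ^ 2
                  * ∑ i, uEuler lam f g s x i * pd i (φ s) x)) := by 
  refine ⟨fun F hF => ⟨fun T hT => ⟨memLp_uEuler_spacetime lam hg.continuous hf T,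
    fun ν hν => ?_, tendsto_eLpNorm_uNS_sub_uEuler_spacetime hf hg hF hT⟩,
    fun t ht => ⟨memLp_uEuler lam hg.continuous hf t,
      fun ν hν => memLp_uNS hg.continuous ((hF ν hν).memLp t ht),
      tendsto_eLpNorm_uNS_sub_uEuler hf hg hF ht⟩, ?_⟩,
    fun hf3 φ hφ _ t ht => ⟨integrable_energy_mul hf hg.continuous t
      (hφ.smoothTorus ht).continuous, ?_,
      integrable_fluxDensity hf hf3 hg.continuous hφ t,
      energy_balance hf hf3 hg.continuous hφ ht⟩⟩
  · obtain ⟨D, hD⟩ := (hF ν hν).gradient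
    exact memLp_uNS_spacetime hg.continuous (hD.1 T hT).1
  -- A weak gradient of the profile is selected for each ν > 0; the values at other ν play no role
  -- in the limit from the right.
  · choose! D hD using fun (ν : ℝ) (hν : 0 < ν) => (hF ν hν).gradient
    exact ⟨fun ν => uNSGradient ν lam g (D ν), fun ν hν k => (hD ν hν).uNS hg k,
      fun t ht => tendsto_dissipation hf hg hF hD ht⟩
  · rw [← uEuler_zero]
    exact integrable_energy_mul hf hg.continuous 0 (hφ.smoothTorus le_rfl).continuous
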